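/- Let $d\ge 1$. For $f:\mathbb R^d\to V$ ($V=\mathbb R$, or $V=\mathbb R^{d\times d}$ with the Euclidean norm) put $\|f\|_{C^0}=\sup_x|f(x)|$, $[f]=\sup_{x\ne y}|f(x)-f(y)|/|x-y|$, $\|f\|_{C^1}=\|f\|_{C^0}+[f]$ and $\|f\|_{C^2}=\|f\|_{C^0}+\sum_{i}\|\partial_i f\|_{C^0}+\sum_i[\partial_i f]$. Let $C^1$ be the space of all $f$ with $\|f\|_{C^1}<\infty$ and $C^2$ the space of all differentiable $f$ with $\|f\|_{C^2}<\infty$. For every $K\ge 0$ there is a constant $c=c(d,K)>0$, and for every $\lambda>0$ there is a constant $N=N(d,\lambda,K)>0$, such that the following holds. Let $\sigma\in C^2(\mathbb R^d,\mathbb R^{d\times d})$ satisfy $\|\sigma\|_{C^2}\le K$ and $\sigma(x)\sigma(x)^T\succeq\lambda I$ for all $x$. Let $B$ be a $d$-dimensional Brownian motion on a probability space, let $n\ge 1$ and $y\in\mathbb R^d$, and let $\bar X^n$ be the solution of $$d\bar X^n_t=\sigma(\bar X^n_{\kappa_n(t)})\,dB_t,\qquad \bar X^n_0=y,\qquad \kappa_n(t)=\lfloor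 nt\rfloor/n .$$ Then for every $G\in C^1(\mathbb R^d,\mathbb R)$, every $t\in\{1/n,2/n,\dots,1\}$ and every $k\in\{1,\dots,d\}$, $G$ is almost surely differentiable at $\bar X^n_t$, the random variable $\partial_kG(\bar X^n_t)$ is integrable, and $$\bigl|\mathbb E\,\partial_kG(\bar X^n_t)\bigr|\le N\|G\|_{C^0}\,t^{-1/2}+N\|G\|_{C^1}\,e^{-cn}.$$ -/

import Mathlib

open MeasureTheory ProbabilityTheory
open scoped ENNReal NNReal Matrix.Norms.Frobenius

noncomputable section

namespace EulerMaruyama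

/-- The `k`-th partial derivative `∂ₖ f`. -/
def partialDeriv {d : ℕ} {V : Type*} [NormedAddCommGroup V] [NormedSpace ℝ V] (k : Fin d)
    (f : EuclideanSpace ℝ (Fin d) → V) (x : EuclideanSpace ℝ (Fin d)) : V :=
  fderiv ℝ f x (EuclideanSpace.single k 1)

/-- The supremum norm `‖f‖_{C⁰} = sup_x |f x|`, with values in `[0, ∞]`. -/
def c0Norm {d : ℕ} {V : Type*} [NormedAddCommGroup V]
    (f : EuclideanSpace ℝ (Fin d) → V) : ℝ≥0∞ :=
  ⨆ x, ‖f x‖ₑ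

/-- The Lipschitz seminorm `[f]_{C¹} = sup_{x ≠ y} |f x - f y| / |x - y|`,
with values in `[0, ∞]`. -/
def lipSeminorm {d : ℕ} {V : Type*} [NormedAddCommGroup V]
    (f : EuclideanSpace ℝ (Fin d) → V) : ℝ≥0∞ :=
  ⨆ (x) (y) (_ : x ≠ y), ‖f x - f y‖ₑ / ‖x - y‖ₑ

/-- The norm `‖f‖_{C¹} = sup |f| + [f]_{C¹}`. The space `C¹` consists of the functions for which
it is finite, that is, of the bounded Lipschitz functions. -/
def c1Norm {d : ℕ} {V : Type*} [NormedAddCommGroup V]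
    (f : EuclideanSpace ℝ (Fin d) → V) : ℝ≥0∞ :=
  c0Norm f + lipSeminorm f

/-- The norm `‖f‖_{C²} = sup |f| + ∑ᵢ sup |∂ᵢ f| + ∑ᵢ [∂ᵢ f]_{C¹}`. The space `C²` consists of the
differentiable functions for which it is finite. -/
def c2Norm {d : ℕ} {V : Type*} [NormedAddCommGroup V] [NormedSpace ℝ V]
    (f : EuclideanSpace ℝ (Fin d) → V) : ℝ≥0∞ :=
  c0Norm f + ∑ i, c0Norm (partialDeriv i f) + ∑ i, lipSeminorm (partialDeriv i f)

/-- Uniform ellipticity: `σ σᵀ ⪰ lam I` everywhere. -/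
def IsElliptic {d : ℕ} (lam : ℝ)
    (σ : EuclideanSpace ℝ (Fin d) → Matrix (Fin d) (Fin d) ℝ) : Prop :=
  ∀ x, (σ x * (σ x).transpose - lam • (1 : Matrix (Fin d) (Fin d) ℝ)).PosSemidef

/-- A standard `d`-dimensional Brownian motion on `[0, ∞)`: the coordinates are independent
one-dimensional Brownian motions. -/
structure IsBrownianVec {d : ℕ} {Ω : Type*} [MeasurableSpace Ω]
    (B : ℝ≥0 → Ω → EuclideanSpace ℝ (Fin d)) (P : Measure Ω) : Prop where
  isBrownianReal : ∀ i, IsBrownianReal (fun t ω ↦ B t ω i) P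
  indep : iIndepFun (fun (i : Fin d) (ω : Ω) (t : ℝ≥0) ↦ B t ω i) P

/-- The stochastic integral `∫₀ᵗ H_{κₙ(r)} dB_r`, where `κₙ(r) = ⌊n r⌋ / n`. The integrand is
the constant `H_{i/n}` on `[i/n, (i+1)/n)`, so the integral is the finite sum
`∑_{i ≤ n t} H_{i/n} (B_{t ∧ (i+1)/n} - B_{i/n})`. -/
def gridIntegral {d : ℕ} {Ω : Type*} (n : ℕ) (H : ℝ≥0 → Ω → Matrix (Fin d) (Fin d) ℝ)
    (B : ℝ≥0 → Ω → EuclideanSpace ℝ (Fin d)) (t : ℝ≥0) (ω : Ω) : EuclideanSpace ℝ (Fin d) :=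
  ∑ i ∈ Finset.range (⌊(n : ℝ≥0) * t⌋₊ + 1),
    (H ((i : ℝ≥0) / n) ω).toEuclideanLin
      (B (min t (((i : ℝ≥0) + 1) / n)) ω - B ((i : ℝ≥0) / n) ω)

/-- `X` solves `dX_t = σ(X_{κₙ(t)}) dB_t`, `X_0 = y`: it is the drift-free Euler–Maruyama scheme
with step `1/n` started at `y`. -/
def IsEulerMaruyama {d : ℕ} {Ω : Type*} [MeasurableSpace Ω] (P : Measure Ω) (n : ℕ)
    (σ : EuclideanSpace ℝ (Fin d) → Matrix (Fin d) (Fin d) ℝ)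
    (B : ℝ≥0 → Ω → EuclideanSpace ℝ (Fin d)) (y : EuclideanSpace ℝ (Fin d))
    (X : ℝ≥0 → Ω → EuclideanSpace ℝ (Fin d)) : Prop :=
  ∀ᵐ ω ∂P, ∀ t : ℝ≥0, X t ω = y + gridIntegral n (fun s ω ↦ σ (X s ω)) B t ω

end EulerMaruyama

end

/-!
Put `s = n^{-1/2}` and let `Z` be a standard normal vector. On the grid `i / n` the scheme is the
Markov chain `Y_{i+1} = Y_i + s σ(Y_i) Z_{i+1}` with transition operator
`Q f (x) = 𝔼 f (x + s σ(x) Z)`, so that `𝔼 ∂_v G(Y_{i+1}) = Q^{i+1} (∂_v G) (y)`. Gaussian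
integration by parts turns `Q ∂_v` into the operator
`T_v f (x) = s⁻¹ 𝔼 [f (x + s σ(x) Z) ⟪σ(x)⁻¹ v, Z⟫]`, which involves no derivative of `f`
(`IsCoeff.stepOp_fderiv_eq_dualOp`). Hence it suffices to bound `Q^i T_v` on
bounded continuous functions by a multiple of `((i + 1) s²)^{-1/2}` (`IsCoeff.dualBound`); the naive
bound is `s⁻¹`. The estimate holds without an exponentially small remainder, so in the final
inequality the term with `exp (-c n)` is only added, with `c = 1`.

The bound for `Q^i T_v` rests on three facts.

* Gradient estimate `‖∇ Q^r f‖ ≤ C (r s²)^{-1/2} sup |f|` (`IsCoeff.norm_fderiv_iterate_le`).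
  It is a discrete Bakry–Émery argument: `s² |∇ Q f|² ≤ A (Q f² - (Q f)²)` from the Bismut
  formula for one step and the Cauchy–Schwarz inequality, and `|∇ Q f|² ≤ (1 + B s²) Q |∇ f|²` since
  the derivative of the noise term is centred. Along the iteration the variances telescope.
* Duality by commutators (`IsCoeff.iterate_dualOp_eq`): with `C_v = ∂_v Q - T_v`,
  `Q^j T_v f = ∂_v Q^{j+1} f - ∑_{r ≤ j} Q^{j-r} C_v Q^r f`.
* Commutator estimate (`IsCoeff.abs_iterate_commOp_le`): `C_v f` is `s²` times a sum of terms
  `T_u (∂_w f)` with `w` depending on the base point. Replacing `w(x)` by `w(y)` at the new point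
  `y` costs `O(1)`, because `w` is Lipschitz and the weight of `T_u` is of order `s⁻¹`. Hence a
  bound `a` for `Q^i T` gives the bound `C s² (a + 1) sup ‖∇ f‖` for `Q^i C_v f`.

Together they give for the norms `a_j` of `Q^j T` the Volterra inequality
`a_j ≤ C (((j + 1) s²)^{-1/2} + 1 + s² ∑_{1 ≤ r ≤ j} (a_{j-r} + 1) (r s²)^{-1/2})`
(`IsCoeff.dualBound_of_forall_lt`). Its kernel is integrable, so the bound
`a_j ≤ 8 C ((j + 1) s²)^{-1/2}` closes by induction on a short time interval
(`IsCoeff.dualBound_short`), and extends to time one since `Q` is a contraction for the supremum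
norm.
-/

namespace EulerMaruyama

set_option linter.unusedSectionVars false

section Gaussian

open Module Real
open scoped RealInnerProductSpace Topology

variable {E : Type*} [NormedAddCommGroup E] [InnerProductSpace ℝ E] [FiniteDimensional ℝ E]
  [MeasurableSpace E] [BorelSpace E]

/-! ### Density and integration by parts for the standard Gaussian measure -/

/-- The density of the standard Gaussian measure with respect to Lebesgue measure. -/
noncomputable def gaussianDensity (z : E) : ℝ :=
  rexp (-(1 / 2) * ‖z‖ ^ 2) / (π / (1 / 2)) ^ (finrank ℝ E / 2 : ℝ)

lemma gaussianDensity_nonneg (z : E) : 0 ≤ gaussianDensity z := by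
  unfold gaussianDensity; positivity

lemma continuous_gaussianDensity : Continuous (gaussianDensity : E → ℝ) := by
  unfold gaussianDensity; fun_prop

lemma integral_gaussianDensity : ∫ z : E, gaussianDensity z = 1 := by
  unfold gaussianDensity
  rw [integral_div, GaussianFourier.integral_rexp_neg_mul_sq_norm (by norm_num)]
  exact div_self (by positivity)

lemma integrable_gaussianDensity : Integrable (gaussianDensity : E → ℝ) := by
  by_contra h
  have := integral_gaussianDensity (E := E)
  rw [integral_undef h] at this
  norm_num at this

/-- Both sides have the same characteristic function. -/
lemma stdGaussian_eq_withDensity :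
    stdGaussian E = volume.withDensity (fun z ↦ ENNReal.ofReal (gaussianDensity z)) := by
  have hmeas : Measurable (fun z : E ↦ ENNReal.ofReal (gaussianDensity z)) :=
    continuous_gaussianDensity.measurable.ennreal_ofReal
  have : IsFiniteMeasure
      ((volume : Measure E).withDensity (fun z ↦ ENNReal.ofReal (gaussianDensity z))) :=
    isFiniteMeasure_withDensity_ofReal integrable_gaussianDensity.2
  apply Measure.ext_of_charFun
  ext t
  rw [charFun_stdGaussian, charFun_apply,
    integral_withDensity_eq_integral_toReal_smul hmeas (by simp)]
  have h1 : ∀ z : E, (ENNReal.ofReal (gaussianDensity z)).toReal •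
      Complex.exp ((⟪z, t⟫ : ℝ) * Complex.I) =
      Complex.exp (-(1 / 2 : ℂ) * ‖z‖ ^ 2 + Complex.I * (⟪t, z⟫ : ℝ)) *
        (((π / (1 / 2)) ^ (finrank ℝ E / 2 : ℝ) : ℝ) : ℂ)⁻¹ := by
    intro z
    rw [ENNReal.toReal_ofReal (gaussianDensity_nonneg z), gaussianDensity, Complex.exp_add,
      real_inner_comm, Complex.real_smul]
    push_cast
    rw [mul_comm Complex.I]
    ring
  simp_rw [h1]
  rw [integral_mul_const, GaussianFourier.integral_cexp_neg_mul_sq_norm_add (by norm_num)]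
  have h2 : ((((π / (1 / 2)) ^ (finrank ℝ E / 2 : ℝ) : ℝ) : ℂ)) =
      ((π : ℂ) / (1 / 2)) ^ ((finrank ℝ E : ℂ) / 2) := by
    rw [Complex.ofReal_cpow (by positivity)]
    push_cast
    rfl
  rw [h2, mul_assoc, mul_comm (Complex.exp _), ← mul_assoc, mul_inv_cancel₀, one_mul]
  · congr 1
    rw [Complex.I_sq]
    ring
  · rw [← h2]
    exact_mod_cast (by positivity : ((π / (1 / 2)) ^ (finrank ℝ E / 2 : ℝ) : ℝ) ≠ 0)

lemma integral_stdGaussian_eq (f : E → ℝ) :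
    ∫ z, f z ∂(stdGaussian E) = ∫ z, f z * gaussianDensity z := by
  rw [stdGaussian_eq_withDensity, integral_withDensity_eq_integral_toReal_smul
    continuous_gaussianDensity.measurable.ennreal_ofReal (by simp)]
  simp_rw [ENNReal.toReal_ofReal (gaussianDensity_nonneg _), smul_eq_mul, mul_comm]

lemma integrable_stdGaussian_iff {f : E → ℝ} :
    Integrable f (stdGaussian E) ↔ Integrable (fun z ↦ f z * gaussianDensity z) := by
  rw [stdGaussian_eq_withDensity, integrable_withDensity_iff_integrable_smul'
    continuous_gaussianDensity.measurable.ennreal_ofReal (by simp)]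
  simp_rw [ENNReal.toReal_ofReal (gaussianDensity_nonneg _), smul_eq_mul, mul_comm]

lemma stdGaussian_absolutelyContinuous : stdGaussian E ≪ (volume : Measure E) := by
  rw [stdGaussian_eq_withDensity]
  exact withDensity_absolutelyContinuous _ _

/-- Gaussian integration by parts in the direction `w`. -/
lemma integral_lineDeriv_stdGaussian {F F' : E → ℝ} {w : E}
    (hF : Integrable F (stdGaussian E)) (hF' : Integrable F' (stdGaussian E))
    (hFw : Integrable (fun z ↦ F z * ⟪w, z⟫) (stdGaussian E))
    (h : ∀ z, HasLineDerivAt ℝ F (F' z) z w) :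
    ∫ z, F' z ∂(stdGaussian E) = ∫ z, F z * ⟪w, z⟫ ∂(stdGaussian E) := by
  have hd : ∀ z : E, HasLineDerivAt ℝ (gaussianDensity : E → ℝ) (-⟪w, z⟫ * gaussianDensity z)
      z w := by
    intro z
    have h1 : HasFDerivAt (fun z : E ↦ ‖z‖ ^ 2) (2 • innerSL ℝ z) z :=
      (hasStrictFDerivAt_norm_sq z).hasFDerivAt
    have h2 := ((h1.const_mul (-(1 / 2))).exp.mul_const
      (((π / (1 / 2)) ^ (finrank ℝ E / 2 : ℝ) : ℝ)⁻¹)).hasLineDerivAt w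
    convert! h2 using 1
    simp only [gaussianDensity, smul_apply, innerSL_apply_apply, smul_eq_mul,
      real_inner_comm w z, nsmul_eq_mul]
    push_cast
    ring
  have e := integral_bilinear_hasLineDerivAt_right_eq_neg_left_of_integrable
    (μ := (volume : Measure E)) (B := ContinuousLinearMap.mul ℝ ℝ) (f := F) (f' := F')
    (g := gaussianDensity) (g' := fun z ↦ -⟪w, z⟫ * gaussianDensity z) (v := w)
    (by simpa using integrable_stdGaussian_iff.1 hF')
    (by
      have := (integrable_stdGaussian_iff.1 hFw).neg
      refine this.congr (Filter.Eventually.of_forall fun z ↦ ?_)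
      simp only [Pi.neg_apply, ContinuousLinearMap.mul_apply']
      ring)
    (by simpa using integrable_stdGaussian_iff.1 hF)
    (fun z _ ↦ h z) (fun z _ ↦ hd z)
  simp only [ContinuousLinearMap.mul_apply'] at e
  rw [integral_stdGaussian_eq, integral_stdGaussian_eq, ← neg_eq_iff_eq_neg.2 e, ← integral_neg]
  congr 1
  ext z
  ring

lemma integrable_norm_pow_stdGaussian (k : ℕ) :
    Integrable (fun z : E ↦ ‖z‖ ^ k) (stdGaussian E) := by
  have := (IsGaussian.memLp_id (stdGaussian E) k (by simp)).integrable_norm_pow'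
  simpa using this

/-- Measurable functions of at most quartic growth are integrable. -/
lemma integrable_stdGaussian_of_le {V : Type*} [NormedAddCommGroup V] {F : E → V}
    (hF : AEStronglyMeasurable F (stdGaussian E)) (C : ℝ)
    (h : ∀ z, ‖F z‖ ≤ C * (1 + ‖z‖) ^ 4) : Integrable F (stdGaussian E) := by
  refine Integrable.mono' (g := fun z ↦ C * (1 + ‖z‖) ^ 4) ?_ hF (.of_forall h)
  have e : (fun z : E ↦ C * (1 + ‖z‖) ^ 4) =
      fun z ↦ C * (1 + 4 * ‖z‖ ^ 1 + 6 * ‖z‖ ^ 2 + 4 * ‖z‖ ^ 3 + ‖z‖ ^ 4) := by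
    ext z; ring
  rw [e]
  refine Integrable.const_mul ?_ C
  have i := integrable_norm_pow_stdGaussian (E := E)
  exact ((((integrable_const 1).add ((i 1).const_mul 4)).add ((i 2).const_mul 6)).add
    ((i 3).const_mul 4)).add (i 4)

/-- Averages of a Lipschitz function along a segment stay close to its value at the endpoint. -/
lemma abs_segmentAverage_sub_le {F : E → ℝ} {C : ℝ≥0} (hF : LipschitzWith C F) (w z : E)
    {h : ℝ} (h0 : 0 < h) :
    |h⁻¹ * (∫ a in (0 : ℝ)..h, F (z + a • w)) - F z| ≤ C * ‖w‖ * h := by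
  have hc : Continuous fun a : ℝ ↦ F (z + a • w) := hF.continuous.comp (by fun_prop)
  have e : h⁻¹ * (∫ a in (0 : ℝ)..h, F (z + a • w)) - F z =
      h⁻¹ * ∫ a in (0 : ℝ)..h, (F (z + a • w) - F z) := by
    rw [intervalIntegral.integral_sub (hc.intervalIntegrable _ _) (by simp)]
    simp
    field_simp
  have b : ‖∫ a in (0 : ℝ)..h, (F (z + a • w) - F z)‖ ≤ C * ‖w‖ * h * |h - 0| := by
    refine intervalIntegral.norm_integral_le_of_norm_le_const fun a ha ↦ ?_
    rw [Set.uIoc_of_le h0.le] at ha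
    have := hF.dist_le_mul (z + a • w) z
    rw [Real.dist_eq, dist_eq_norm, add_sub_cancel_left, norm_smul, Real.norm_eq_abs,
      abs_of_pos ha.1] at this
    refine this.trans ?_
    rw [mul_assoc, mul_comm ‖w‖]
    gcongr
    exact ha.2
  rw [e, abs_mul, abs_of_pos (inv_pos.2 h0), inv_mul_le_iff₀ h0]
  rw [sub_zero, abs_of_pos h0, Real.norm_eq_abs] at b
  linarith

lemma hasLineDerivAt_segmentAverage {F : E → ℝ} (hF : Continuous F) (w z : E) (h : ℝ) :
    HasLineDerivAt ℝ (fun z ↦ h⁻¹ * ∫ a in (0 : ℝ)..h, F (z + a • w))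
      (h⁻¹ * (F (z + h • w) - F z)) z w := by
  have hc : Continuous fun a : ℝ ↦ F (z + a • w) := hF.comp (by fun_prop)
  have e : (fun t : ℝ ↦ h⁻¹ * ∫ a in (0 : ℝ)..h, F (z + t • w + a • w)) =
      fun t ↦ h⁻¹ * ((∫ a in (0 : ℝ)..(t + h), F (z + a • w)) -
        ∫ a in (0 : ℝ)..t, F (z + a • w)) := by
    ext t
    rw [intervalIntegral.integral_interval_sub_left (hc.intervalIntegrable _ _)
      (hc.intervalIntegrable _ _)]
    have := intervalIntegral.integral_comp_add_left (a := 0) (b := h)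
      (fun a ↦ F (z + a • w)) t
    rw [add_zero] at this
    rw [← this]
    simp only [add_smul, add_assoc]
  unfold HasLineDerivAt
  rw [e]
  refine HasDerivAt.const_mul _ (HasDerivAt.sub ?_ ?_)
  · have h1 : HasDerivAt (fun u ↦ ∫ a in (0 : ℝ)..u, F (z + a • w)) (F (z + h • w)) (0 + h) := by
      rw [zero_add]
      exact intervalIntegral.integral_hasDerivAt_right (hc.intervalIntegrable _ _)
        (hc.stronglyMeasurableAtFilter _ _) hc.continuousAt
    exact h1.comp_add_const 0 h
  · have h1 := intervalIntegral.integral_hasDerivAt_right (hc.intervalIntegrable 0 0)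
      (hc.stronglyMeasurableAtFilter _ _) hc.continuousAt
    simpa using h1

/-- Gaussian integration by parts for a Lipschitz function, which by Rademacher's theorem is
differentiable almost everywhere. It follows from the smooth case applied to the averages
`h⁻¹ ∫₀ʰ F (z + a w) da`, whose derivative in the direction `w` is `h⁻¹ (F (z + h w) - F z)`. -/
lemma integral_lineDeriv_stdGaussian_of_lipschitz {F : E → ℝ} {C : ℝ≥0} (hF : LipschitzWith C F)
    (w : E) :
    ∫ z, lineDeriv ℝ F z w ∂(stdGaussian E) = ∫ z, F z * ⟪w, z⟫ ∂(stdGaussian E) := by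
  let h : ℕ → ℝ := fun n ↦ 1 / ((n : ℝ) + 1)
  have h0 : ∀ n, 0 < h n := fun n ↦ by positivity
  have h1 : ∀ n, h n ≤ 1 := fun n ↦ by
    rw [div_le_one (by positivity)]; linarith [n.cast_nonneg (α := ℝ)]
  have hlim : Filter.Tendsto h Filter.atTop (𝓝 0) := tendsto_one_div_add_atTop_nhds_zero_nat
  let A : ℕ → E → ℝ := fun n z ↦ (h n)⁻¹ * ∫ a in (0 : ℝ)..(h n), F (z + a • w)
  have hFc := hF.continuous
  have hAc : ∀ n, Continuous (A n) := fun n ↦ by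
    refine continuous_const.mul ?_
    exact intervalIntegral.continuous_parametric_intervalIntegral_of_continuous'
      (f := fun (z : E) (a : ℝ) ↦ F (z + a • w)) (by fun_prop) _ _
  have hA : ∀ n z, |A n z - F z| ≤ C * ‖w‖ * h n := fun n z ↦
    abs_segmentAverage_sub_le hF w z (h0 n)
  set D : ℝ := |F 0| + C * ‖w‖ + C with hD
  have hD0 : 0 ≤ D := by positivity
  have hAD : ∀ n z, |A n z| ≤ D * (1 + ‖z‖) := fun n z ↦ by
    have a1 := hA n z
    have a2 := hF.dist_le_mul z 0
    rw [Real.dist_eq, dist_zero_right] at a2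
    have a3 : (C : ℝ) * ‖w‖ * h n ≤ C * ‖w‖ := mul_le_of_le_one_right (by positivity) (h1 n)
    have a4 : |A n z| ≤ |A n z - F z| + |F z - F 0| + |F 0| := by
      have := abs_add_three (A n z - F z) (F z - F 0) (F 0)
      simpa using this
    have a5 : 0 ≤ (|F 0| + C * ‖w‖) * ‖z‖ := by positivity
    have a6 : (0 : ℝ) ≤ C := C.2
    rw [hD]
    nlinarith
  have hAw : ∀ n z, ‖A n z * ⟪w, z⟫‖ ≤ D * ‖w‖ * (1 + ‖z‖) ^ 4 := fun n z ↦ by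
    have b1 : |⟪w, z⟫| ≤ ‖w‖ * (1 + ‖z‖) :=
      (abs_real_inner_le_norm w z).trans (by gcongr; linarith)
    have b2 : (1 + ‖z‖) ^ 2 ≤ (1 + ‖z‖) ^ 4 :=
      pow_le_pow_right₀ (by linarith [norm_nonneg z]) (by norm_num)
    rw [Real.norm_eq_abs, abs_mul]
    calc |A n z| * |⟪w, z⟫| ≤ (D * (1 + ‖z‖)) * (‖w‖ * (1 + ‖z‖)) :=
          mul_le_mul (hAD n z) b1 (abs_nonneg _) (by positivity)
      _ = D * ‖w‖ * (1 + ‖z‖) ^ 2 := by ring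
      _ ≤ _ := by gcongr
  have hq : ∀ n z, |(h n)⁻¹ * (F (z + h n • w) - F z)| ≤ C * ‖w‖ := fun n z ↦ by
    have := hF.dist_le_mul (z + h n • w) z
    rw [Real.dist_eq, dist_eq_norm, add_sub_cancel_left, norm_smul, Real.norm_eq_abs,
      abs_of_pos (h0 n)] at this
    rw [abs_mul, abs_of_pos (inv_pos.2 (h0 n)), inv_mul_le_iff₀ (h0 n)]
    linarith
  have key : ∀ n, ∫ z, (h n)⁻¹ * (F (z + h n • w) - F z) ∂(stdGaussian E) =
      ∫ z, A n z * ⟪w, z⟫ ∂(stdGaussian E) := fun n ↦ by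
    refine integral_lineDeriv_stdGaussian (F := A n) ?_ ?_ ?_
      (fun z ↦ hasLineDerivAt_segmentAverage hFc w z (h n))
    · refine integrable_stdGaussian_of_le (hAc n).aestronglyMeasurable D fun z ↦ ?_
      refine (hAD n z).trans ?_
      gcongr
      exact le_self_pow₀ (by linarith [norm_nonneg z]) (by norm_num)
    · refine (integrable_const ((C : ℝ) * ‖w‖)).mono' ?_ (.of_forall (hq n))
      exact Continuous.aestronglyMeasurable (by fun_prop)
    · refine integrable_stdGaussian_of_le ?_ _ (hAw n)
      exact ((hAc n).mul (by fun_prop)).aestronglyMeasurable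
  have L1 : Filter.Tendsto (fun n ↦ ∫ z, (h n)⁻¹ * (F (z + h n • w) - F z) ∂(stdGaussian E))
      Filter.atTop (𝓝 (∫ z, lineDeriv ℝ F z w ∂(stdGaussian E))) := by
    refine tendsto_integral_of_dominated_convergence (fun _ ↦ (C : ℝ) * ‖w‖) (fun n ↦ ?_)
      (integrable_const _) (fun n ↦ .of_forall (hq n)) ?_
    · exact Continuous.aestronglyMeasurable (by fun_prop)
    · filter_upwards [stdGaussian_absolutelyContinuous.ae_le
        (hF.ae_lineDifferentiableAt (μ := volume) w)] with z hz
      refine hz.hasLineDerivAt.tendsto_slope_zero_right.comp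
        (tendsto_nhdsWithin_iff.2 ⟨hlim, .of_forall h0⟩)
  have L2 : Filter.Tendsto (fun n ↦ ∫ z, A n z * ⟪w, z⟫ ∂(stdGaussian E))
      Filter.atTop (𝓝 (∫ z, F z * ⟪w, z⟫ ∂(stdGaussian E))) := by
    refine tendsto_integral_of_dominated_convergence (fun z ↦ D * ‖w‖ * (1 + ‖z‖) ^ 4)
      (fun n ↦ ((hAc n).mul (by fun_prop)).aestronglyMeasurable)
      (integrable_stdGaussian_of_le (Continuous.aestronglyMeasurable (by fun_prop)) (D * ‖w‖)
        fun z ↦ ?_)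
      (fun n ↦ .of_forall (hAw n)) (.of_forall fun z ↦ Filter.Tendsto.mul_const _ ?_)
    · rw [Real.norm_of_nonneg (by positivity)]
    · rw [tendsto_iff_dist_tendsto_zero]
      refine squeeze_zero (fun _ ↦ dist_nonneg) (fun n ↦ hA n z) ?_
      simpa using hlim.const_mul ((C : ℝ) * ‖w‖)
  simp_rw [key] at L1
  exact tendsto_nhds_unique L1 L2

end Gaussian

section OneStep

open Module
open scoped RealInnerProductSpace Topology

variable {E : Type*} [NormedAddCommGroup E] [InnerProductSpace ℝ E] [FiniteDimensional ℝ E]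
  [MeasurableSpace E] [BorelSpace E]

/-! ### Gaussian moments and the one-step operators -/

/-- A fixed Gaussian moment that dominates all moments of order at most four. -/
noncomputable def momentConst (E : Type*) [NormedAddCommGroup E] [InnerProductSpace ℝ E]
    [FiniteDimensional ℝ E] [MeasurableSpace E] [BorelSpace E] : ℝ :=
  ∫ z : E, (1 + ‖z‖) ^ 4 ∂(stdGaussian E)

lemma integrable_one_add_norm_pow_four :
    Integrable (fun z : E ↦ (1 + ‖z‖) ^ 4) (stdGaussian E) :=
  integrable_stdGaussian_of_le (Continuous.aestronglyMeasurable (by fun_prop)) 1 fun z ↦ by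
    rw [one_mul, Real.norm_of_nonneg (by positivity)]

lemma one_le_momentConst : 1 ≤ momentConst E := by
  have h : ∫ _ : E, (1 : ℝ) ∂(stdGaussian E) ≤ momentConst E :=
    integral_mono (integrable_const _) integrable_one_add_norm_pow_four fun z ↦
      one_le_pow₀ (by linarith [norm_nonneg z])
  simpa using h

lemma norm_integral_stdGaussian_le {V : Type*} [NormedAddCommGroup V] [NormedSpace ℝ V]
    {F : E → V} {C : ℝ} (h : ∀ z, ‖F z‖ ≤ C * (1 + ‖z‖) ^ 4) :
    ‖∫ z, F z ∂(stdGaussian E)‖ ≤ C * momentConst E := by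
  rw [momentConst, ← integral_const_mul]
  exact norm_integral_le_of_norm_le (integrable_one_add_norm_pow_four.const_mul C) (.of_forall h)

lemma norm_pow_le_one_add_pow_four (z : E) {k : ℕ} (hk : k ≤ 4) : ‖z‖ ^ k ≤ (1 + ‖z‖) ^ 4 :=
  (pow_le_pow_left₀ (norm_nonneg z) (by linarith) k).trans
    (pow_le_pow_right₀ (by linarith [norm_nonneg z]) hk)

/-- The Cauchy–Schwarz inequality for integrals of real functions. -/
lemma sq_integral_mul_le {α : Type*} [MeasurableSpace α] {μ : Measure α} {f g : α → ℝ}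
    (hf : Integrable (fun a ↦ f a ^ 2) μ) (hg : Integrable (fun a ↦ g a ^ 2) μ)
    (hfg : Integrable (fun a ↦ f a * g a) μ) :
    (∫ a, f a * g a ∂μ) ^ 2 ≤ (∫ a, f a ^ 2 ∂μ) * ∫ a, g a ^ 2 ∂μ := by
  have h : ∀ t : ℝ, 0 ≤ (∫ a, f a ^ 2 ∂μ) * (t * t) + (2 * ∫ a, f a * g a ∂μ) * t +
      ∫ a, g a ^ 2 ∂μ := by
    intro t
    have e : ∫ a, (t * f a + g a) ^ 2 ∂μ = (∫ a, f a ^ 2 ∂μ) * (t * t) +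
        (2 * ∫ a, f a * g a ∂μ) * t + ∫ a, g a ^ 2 ∂μ := by
      have e1 : (fun a ↦ (t * f a + g a) ^ 2) =
          fun a ↦ (t * t) * f a ^ 2 + (2 * t) * (f a * g a) + g a ^ 2 := by
        ext a; ring
      have i1 : Integrable (fun a ↦ (t * t) * f a ^ 2) μ := hf.const_mul _
      have i2 : Integrable (fun a ↦ (2 * t) * (f a * g a)) μ := hfg.const_mul _
      have i3 : Integrable (fun a ↦ (t * t) * f a ^ 2 + (2 * t) * (f a * g a)) μ := i1.add i2
      rw [e1, integral_add i3 hg, integral_add i1 i2, integral_const_mul, integral_const_mul]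
      ring
    rw [← e]
    exact integral_nonneg fun a ↦ sq_nonneg _
  have := discrim_le_zero h
  rw [discrim] at this
  nlinarith

/-- Hypotheses on the diffusion coefficient: `S` is differentiable with derivative `D`, every `S x`
is invertible with inverse `R x`, the three maps are bounded by `M`, and `D` is `M`-Lipschitz. -/
structure IsCoeff (M : ℝ) (S : E → E →L[ℝ] E) (D : E → E →L[ℝ] E →L[ℝ] E)
    (R : E → E →L[ℝ] E) : Prop where
  one_le : 1 ≤ M
  hasFDerivAt : ∀ x, HasFDerivAt S (D x) x
  norm_S_le : ∀ x, ‖S x‖ ≤ M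
  norm_D_le : ∀ x, ‖D x‖ ≤ M
  norm_R_le : ∀ x, ‖R x‖ ≤ M
  D_lip : ∀ x y, ‖D x - D y‖ ≤ M * ‖x - y‖
  S_R : ∀ x v, S x (R x v) = v
  R_S : ∀ x v, R x (S x v) = v

/-- One step of the scheme of step size `s ^ 2` from `x`, driven by the normal vector `z`. -/
def eulerStep (s : ℝ) (S : E → E →L[ℝ] E) (x z : E) : E := x + s • S x z

/-- The transition operator `Q f (x) = 𝔼 f (x + s S(x) Z)` of the scheme. -/
noncomputable def stepOp (s : ℝ) (S : E → E →L[ℝ] E) (f : E → ℝ) (x : E) : ℝ :=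
  ∫ z, f (eulerStep s S x z) ∂(stdGaussian E)

/-- The operator `T_v f (x) = s⁻¹ 𝔼 [f (x + s S(x) Z) ⟪S(x)⁻¹ v, Z⟫]`, which is `Q (∂_v f)` after
a Gaussian integration by parts, but makes sense for any bounded continuous `f`. -/
noncomputable def dualOp (s : ℝ) (S R : E → E →L[ℝ] E) (v : E) (f : E → ℝ) (x : E) : ℝ :=
  s⁻¹ * ∫ z, f (eulerStep s S x z) * ⟪R x v, z⟫ ∂(stdGaussian E)

/-- The commutator `C_v f = ∂_v (Q f) - Q (∂_v f)`, written out by the chain rule: it is the part of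
`∂_v (Q f)` in which the derivative falls on the coefficient `S`, whose derivative is `D`. -/
noncomputable def commOp (s : ℝ) (S : E → E →L[ℝ] E) (D : E → E →L[ℝ] E →L[ℝ] E) (v : E)
    (f : E → ℝ) (x : E) : ℝ :=
  s * ∫ z, fderiv ℝ f (eulerStep s S x z) (D x v z) ∂(stdGaussian E)

/-- `f` is continuously differentiable, `|f| ≤ c` and `‖f'‖ ≤ c'`. -/
structure IsC1Bounded (c c' : ℝ) (f : E → ℝ) : Prop where
  contDiff : ContDiff ℝ 1 f
  le : ∀ x, |f x| ≤ c
  fderiv_le : ∀ x, ‖fderiv ℝ f x‖ ≤ c'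

namespace IsC1Bounded

variable {f : E → ℝ} {c c' : ℝ}

lemma continuous (hf : IsC1Bounded c c' f) : Continuous f := hf.contDiff.continuous

lemma differentiable (hf : IsC1Bounded c c' f) : Differentiable ℝ f :=
  hf.contDiff.differentiable (by simp)

lemma continuous_fderiv (hf : IsC1Bounded c c' f) : Continuous (fderiv ℝ f) :=
  hf.contDiff.continuous_fderiv (by simp)

lemma c'_nonneg (hf : IsC1Bounded c c' f) : 0 ≤ c' := (norm_nonneg _).trans (hf.fderiv_le 0)

lemma c_nonneg (hf : IsC1Bounded c c' f) : 0 ≤ c := (abs_nonneg _).trans (hf.le 0)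

lemma lipschitz (hf : IsC1Bounded c c' f) : LipschitzWith c'.toNNReal f := by
  refine lipschitzWith_of_nnnorm_fderiv_le hf.differentiable fun x ↦ ?_
  rw [← NNReal.coe_le_coe, coe_nnnorm, Real.coe_toNNReal _ hf.c'_nonneg]
  exact hf.fderiv_le x

end IsC1Bounded

section

variable {M s : ℝ} {S R : E → E →L[ℝ] E} {D : E → E →L[ℝ] E →L[ℝ] E}

namespace IsCoeff

lemma continuous_S (h : IsCoeff M S D R) : Continuous S :=
  continuous_iff_continuousAt.2 fun x ↦ (h.hasFDerivAt x).continuousAt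

lemma pos (h : IsCoeff M S D R) : 0 < M := zero_lt_one.trans_le h.one_le

lemma continuous_D (h : IsCoeff M S D R) : Continuous D := by
  have : LipschitzWith M.toNNReal D := LipschitzWith.of_dist_le_mul fun x y ↦ by
    rw [dist_eq_norm, dist_eq_norm, Real.coe_toNNReal _ h.pos.le]
    exact h.D_lip x y
  exact this.continuous

lemma S_lip (h : IsCoeff M S D R) (x y : E) : ‖S x - S y‖ ≤ M * ‖x - y‖ := by
  have := convex_univ.norm_image_sub_le_of_norm_hasFDerivWithin_le (f := S) (f' := D) (C := M)
    (fun x _ ↦ (h.hasFDerivAt x).hasFDerivWithinAt) (fun x _ ↦ h.norm_D_le x)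
    (Set.mem_univ y) (Set.mem_univ x)
  exact this

/-- The inverse is Lipschitz since `R x - R y = R x (S y - S x) R y`. -/
lemma continuous_R (h : IsCoeff M S D R) : Continuous R := by
  have : LipschitzWith (M * M * M).toNNReal R := LipschitzWith.of_dist_le_mul fun x y ↦ by
    have hM := h.pos
    rw [dist_eq_norm, dist_eq_norm, Real.coe_toNNReal _ (by positivity)]
    have e : R x - R y = (R x) ∘L (S y - S x) ∘L (R y) := by
      ext v
      simp [h.S_R, h.R_S]
    rw [e]
    calc ‖(R x) ∘L (S y - S x) ∘L (R y)‖ ≤ ‖R x‖ * (‖S y - S x‖ * ‖R y‖) :=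
          (ContinuousLinearMap.opNorm_comp_le _ _).trans
            (by gcongr; exact ContinuousLinearMap.opNorm_comp_le _ _)
      _ ≤ M * ((M * ‖x - y‖) * M) := by
          gcongr
          · exact h.norm_R_le x
          · rw [norm_sub_rev x y]; exact h.S_lip y x
          · exact h.norm_R_le y
      _ = _ := by ring
  exact this.continuous

lemma norm_S_apply_le (h : IsCoeff M S D R) (x v : E) : ‖S x v‖ ≤ M * ‖v‖ :=
  (S x).le_of_opNorm_le (h.norm_S_le x) v

lemma norm_R_apply_le (h : IsCoeff M S D R) (x v : E) : ‖R x v‖ ≤ M * ‖v‖ :=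
  (R x).le_of_opNorm_le (h.norm_R_le x) v

lemma norm_D_apply_le (h : IsCoeff M S D R) (x v : E) : ‖D x v‖ ≤ M * ‖v‖ :=
  (D x).le_of_opNorm_le (h.norm_D_le x) v

lemma norm_D_apply_apply_le (h : IsCoeff M S D R) (x v z : E) :
    ‖D x v z‖ ≤ M * ‖v‖ * ‖z‖ :=
  (D x v).le_of_opNorm_le (h.norm_D_apply_le x v) z

lemma norm_R_D_apply_le (h : IsCoeff M S D R) (x v z : E) :
    ‖R x (D x v z)‖ ≤ M ^ 2 * ‖v‖ * ‖z‖ := by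
  have hM := h.pos
  calc ‖R x (D x v z)‖ ≤ M * (M * ‖v‖ * ‖z‖) :=
        (h.norm_R_apply_le x _).trans (by gcongr; exact h.norm_D_apply_apply_le x v z)
    _ = _ := by ring

lemma continuous_eulerStep (h : IsCoeff M S D R) :
    Continuous fun p : E × E ↦ eulerStep s S p.1 p.2 := by
  have := h.continuous_S
  unfold eulerStep
  fun_prop

lemma continuous_eulerStep_left (h : IsCoeff M S D R) (z : E) :
    Continuous fun x ↦ eulerStep s S x z :=
  h.continuous_eulerStep.comp (by fun_prop : Continuous fun x : E ↦ (x, z))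

end IsCoeff

lemma continuous_eulerStep_right (x : E) : Continuous (eulerStep s S x) := by
  unfold eulerStep
  fun_prop

/-! ### Integrals against a weight -/

/-- Dominated convergence for weighted Gaussian averages: they depend continuously on the
starting point. -/
lemma IsCoeff.continuous_integral_mul (h : IsCoeff M S D R) {f : E → ℝ} {g : E → E → ℝ} {c C : ℝ}
    (hf : Continuous f) (hc : ∀ x, |f x| ≤ c) (hg : Continuous fun p : E × E ↦ g p.1 p.2)
    (hC : ∀ x z, |g x z| ≤ C * (1 + ‖z‖) ^ 4) :
    Continuous fun x ↦ ∫ z, f (eulerStep s S x z) * g x z ∂(stdGaussian E) := by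
  refine continuous_of_dominated (bound := fun z ↦ c * (C * (1 + ‖z‖) ^ 4)) (fun x ↦ ?_)
    (fun x ↦ .of_forall fun z ↦ ?_)
    ((integrable_one_add_norm_pow_four.const_mul C).const_mul c) (.of_forall fun z ↦ ?_)
  · exact ((hf.comp (continuous_eulerStep_right x)).mul
      (hg.comp (by fun_prop : Continuous fun z : E ↦ (x, z)))).aestronglyMeasurable
  · rw [Real.norm_eq_abs, abs_mul]
    exact mul_le_mul (hc _) (hC x z) (abs_nonneg _) ((abs_nonneg _).trans (hc x))
  · exact (hf.comp (h.continuous_eulerStep_left z)).mul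
      (hg.comp (by fun_prop : Continuous fun x : E ↦ (x, z)))

lemma integrable_mul_weight {f : E → ℝ} {w : E → ℝ} {c C : ℝ} {x : E}
    (hf : Continuous f) (hc : ∀ x, |f x| ≤ c) (hw : Continuous w)
    (hC : ∀ z, |w z| ≤ C * (1 + ‖z‖) ^ 4) :
    Integrable (fun z ↦ f (eulerStep s S x z) * w z) (stdGaussian E) := by
  refine integrable_stdGaussian_of_le
    ((hf.comp (continuous_eulerStep_right x)).mul hw).aestronglyMeasurable (c * C) fun z ↦ ?_
  rw [Real.norm_eq_abs, abs_mul, mul_assoc]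
  exact mul_le_mul (hc _) (hC z) (abs_nonneg _) ((abs_nonneg _).trans (hc x))

lemma abs_integral_mul_weight_le {f : E → ℝ} {w : E → ℝ} {c C : ℝ} {x : E}
    (hc : ∀ x, |f x| ≤ c) (hC : ∀ z, |w z| ≤ C * (1 + ‖z‖) ^ 4) :
    |∫ z, f (eulerStep s S x z) * w z ∂(stdGaussian E)| ≤ c * C * momentConst E := by
  refine norm_integral_stdGaussian_le (V := ℝ) fun z ↦ ?_
  rw [Real.norm_eq_abs, abs_mul, mul_assoc]
  exact mul_le_mul (hc _) (hC z) (abs_nonneg _) ((abs_nonneg _).trans (hc x))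

lemma tendsto_integral_mul_weight {f : E → ℝ} {fn : ℕ → E → ℝ} {w : E → ℝ} {c C : ℝ} {x : E}
    (hfn : ∀ n, Continuous (fn n)) (hc : ∀ n x, |fn n x| ≤ c)
    (hlim : ∀ x, Filter.Tendsto (fun n ↦ fn n x) Filter.atTop (𝓝 (f x))) (hw : Continuous w)
    (hC : ∀ z, |w z| ≤ C * (1 + ‖z‖) ^ 4) :
    Filter.Tendsto (fun n ↦ ∫ z, fn n (eulerStep s S x z) * w z ∂(stdGaussian E)) Filter.atTop
      (𝓝 (∫ z, f (eulerStep s S x z) * w z ∂(stdGaussian E))) := by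
  refine tendsto_integral_of_dominated_convergence (fun z ↦ c * (C * (1 + ‖z‖) ^ 4))
    (fun n ↦ ((hfn n).comp (continuous_eulerStep_right x)).mul hw |>.aestronglyMeasurable)
    ((integrable_one_add_norm_pow_four.const_mul C).const_mul c)
    (fun n ↦ .of_forall fun z ↦ ?_) (.of_forall fun z ↦ (hlim _).mul_const _)
  rw [Real.norm_eq_abs, abs_mul]
  exact mul_le_mul (hc n _) (hC z) (abs_nonneg _) ((abs_nonneg _).trans (hc n x))

lemma one_le_one_mul_pow_four (z : E) : |(1 : ℝ)| ≤ 1 * (1 + ‖z‖) ^ 4 := by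
  rw [abs_one, one_mul]
  exact one_le_pow₀ (by linarith [norm_nonneg z])

lemma IsCoeff.abs_inner_R_le (h : IsCoeff M S D R) (v x z : E) :
    |⟪R x v, z⟫| ≤ M * ‖v‖ * (1 + ‖z‖) ^ 4 := by
  have hM := h.pos
  calc |⟪R x v, z⟫| ≤ ‖R x v‖ * ‖z‖ := abs_real_inner_le_norm _ _
    _ ≤ M * ‖v‖ * (1 + ‖z‖) ^ 4 := by
      gcongr
      · exact h.norm_R_apply_le x v
      · simpa using norm_pow_le_one_add_pow_four z (k := 1) (by norm_num)

/-! ### The transition operator on bounded continuous functions -/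

lemma integrable_comp_eulerStep {f : E → ℝ} {c : ℝ} (hf : Continuous f) (hc : ∀ x, |f x| ≤ c)
    (x : E) : Integrable (fun z ↦ f (eulerStep s S x z)) (stdGaussian E) := by
  simpa using integrable_mul_weight (s := s) (S := S) (x := x) hf hc
    (continuous_const (y := (1 : ℝ))) one_le_one_mul_pow_four

lemma IsCoeff.continuous_stepOp (h : IsCoeff M S D R) {f : E → ℝ} {c : ℝ} (hf : Continuous f)
    (hc : ∀ x, |f x| ≤ c) : Continuous (stepOp s S f) := by
  have := h.continuous_integral_mul (s := s) hf hc
    (continuous_const (y := (1 : ℝ))) (fun _ ↦ one_le_one_mul_pow_four)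
  simp only [mul_one] at this
  exact this

lemma abs_stepOp_le {f : E → ℝ} {c : ℝ} (hc : ∀ x, |f x| ≤ c) (x : E) :
    |stepOp s S f x| ≤ c := by
  have := norm_integral_le_of_norm_le_const (μ := stdGaussian E)
    (f := fun z ↦ f (eulerStep s S x z)) (C := c) (.of_forall fun _ ↦ hc _)
  simpa [stepOp] using this

lemma stepOp_add {f g : E → ℝ} {c c₁ : ℝ} (hf : Continuous f) (hc : ∀ x, |f x| ≤ c)
    (hg : Continuous g) (hc₁ : ∀ x, |g x| ≤ c₁) :
    stepOp s S (fun x ↦ f x + g x) = fun x ↦ stepOp s S f x + stepOp s S g x := by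
  ext x
  exact integral_add (integrable_comp_eulerStep hf hc x) (integrable_comp_eulerStep hg hc₁ x)

lemma stepOp_sub {f g : E → ℝ} {c c₁ : ℝ} (hf : Continuous f) (hc : ∀ x, |f x| ≤ c)
    (hg : Continuous g) (hc₁ : ∀ x, |g x| ≤ c₁) :
    stepOp s S (fun x ↦ f x - g x) = fun x ↦ stepOp s S f x - stepOp s S g x := by
  ext x
  exact integral_sub (integrable_comp_eulerStep hf hc x) (integrable_comp_eulerStep hg hc₁ x)

lemma stepOp_const_mul (a : ℝ) (f : E → ℝ) :
    stepOp s S (fun x ↦ a * f x) = fun x ↦ a * stepOp s S f x := by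
  ext x
  exact integral_const_mul _ _

lemma stepOp_mono {f g : E → ℝ} {c c₁ : ℝ} (hf : Continuous f) (hc : ∀ x, |f x| ≤ c)
    (hg : Continuous g) (hc₁ : ∀ x, |g x| ≤ c₁) (hfg : ∀ x, f x ≤ g x) (x : E) :
    stepOp s S f x ≤ stepOp s S g x :=
  integral_mono (integrable_comp_eulerStep hf hc x) (integrable_comp_eulerStep hg hc₁ x)
    fun _ ↦ hfg _

lemma IsCoeff.continuous_iterate_stepOp (h : IsCoeff M S D R) {f : E → ℝ} {c : ℝ}
    (hf : Continuous f) (hc : ∀ x, |f x| ≤ c) (r : ℕ) :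
    Continuous ((stepOp s S)^[r] f) ∧ ∀ x, |(stepOp s S)^[r] f x| ≤ c := by
  induction r with
  | zero => exact ⟨hf, hc⟩
  | succ r ih =>
    rw [Function.iterate_succ_apply']
    exact ⟨h.continuous_stepOp ih.1 ih.2, abs_stepOp_le ih.2⟩

lemma IsCoeff.iterate_stepOp_add (h : IsCoeff M S D R) {f g : E → ℝ} {c c₁ : ℝ}
    (hf : Continuous f) (hc : ∀ x, |f x| ≤ c) (hg : Continuous g) (hc₁ : ∀ x, |g x| ≤ c₁)
    (r : ℕ) : (stepOp s S)^[r] (fun x ↦ f x + g x) =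
      fun x ↦ (stepOp s S)^[r] f x + (stepOp s S)^[r] g x := by
  induction r with
  | zero => rfl
  | succ r ih =>
    have i1 := h.continuous_iterate_stepOp (s := s) hf hc r
    have i2 := h.continuous_iterate_stepOp (s := s) hg hc₁ r
    simp only [Function.iterate_succ_apply', ih, stepOp_add i1.1 i1.2 i2.1 i2.2]

lemma IsCoeff.iterate_stepOp_sub (h : IsCoeff M S D R) {f g : E → ℝ} {c c₁ : ℝ}
    (hf : Continuous f) (hc : ∀ x, |f x| ≤ c) (hg : Continuous g) (hc₁ : ∀ x, |g x| ≤ c₁)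
    (r : ℕ) : (stepOp s S)^[r] (fun x ↦ f x - g x) =
      fun x ↦ (stepOp s S)^[r] f x - (stepOp s S)^[r] g x := by
  induction r with
  | zero => rfl
  | succ r ih =>
    have i1 := h.continuous_iterate_stepOp (s := s) hf hc r
    have i2 := h.continuous_iterate_stepOp (s := s) hg hc₁ r
    simp only [Function.iterate_succ_apply', ih, stepOp_sub i1.1 i1.2 i2.1 i2.2]

lemma iterate_stepOp_const_mul (a : ℝ) (f : E → ℝ) (r : ℕ) :
    (stepOp s S)^[r] (fun x ↦ a * f x) = fun x ↦ a * (stepOp s S)^[r] f x := by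
  induction r with
  | zero => rfl
  | succ r ih => simp only [Function.iterate_succ_apply', ih, stepOp_const_mul]

lemma IsCoeff.tendsto_iterate_stepOp (h : IsCoeff M S D R) {f : E → ℝ} {fn : ℕ → E → ℝ} {c : ℝ}
    (hfn : ∀ n, Continuous (fn n)) (hc : ∀ n x, |fn n x| ≤ c)
    (hlim : ∀ x, Filter.Tendsto (fun n ↦ fn n x) Filter.atTop (𝓝 (f x))) (r : ℕ) (x : E) :
    Filter.Tendsto (fun n ↦ (stepOp s S)^[r] (fn n) x) Filter.atTop
      (𝓝 ((stepOp s S)^[r] f x)) := by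
  induction r generalizing x with
  | zero => exact hlim x
  | succ r ih =>
    simp only [Function.iterate_succ_apply']
    simpa [stepOp] using tendsto_integral_mul_weight (s := s) (S := S) (x := x)
      (fun n ↦ (h.continuous_iterate_stepOp (hfn n) (hc n) r).1)
      (fun n ↦ (h.continuous_iterate_stepOp (hfn n) (hc n) r).2) ih
      (continuous_const (y := (1 : ℝ))) one_le_one_mul_pow_four

/-! ### The dual derivative operator -/

lemma IsCoeff.continuous_dualOp (h : IsCoeff M S D R) {f : E → ℝ} {c : ℝ} (hf : Continuous f)
    (hc : ∀ x, |f x| ≤ c) (v : E) : Continuous (dualOp s S R v f) := by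
  have hR := h.continuous_R
  exact continuous_const.mul (h.continuous_integral_mul hf hc (by fun_prop)
    (h.abs_inner_R_le v))

lemma IsCoeff.abs_dualOp_le (h : IsCoeff M S D R) (hs : 0 < s) {f : E → ℝ} {c : ℝ}
    (hc : ∀ x, |f x| ≤ c) (v x : E) :
    |dualOp s S R v f x| ≤ s⁻¹ * (c * (M * ‖v‖) * momentConst E) := by
  rw [dualOp, abs_mul, abs_of_pos (inv_pos.2 hs)]
  gcongr
  exact abs_integral_mul_weight_le hc (h.abs_inner_R_le v x)

lemma IsCoeff.tendsto_dualOp (h : IsCoeff M S D R) {f : E → ℝ} {fn : ℕ → E → ℝ} {c : ℝ}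
    (hfn : ∀ n, Continuous (fn n)) (hc : ∀ n x, |fn n x| ≤ c)
    (hlim : ∀ x, Filter.Tendsto (fun n ↦ fn n x) Filter.atTop (𝓝 (f x))) (v x : E) :
    Filter.Tendsto (fun n ↦ dualOp s S R v (fn n) x) Filter.atTop
      (𝓝 (dualOp s S R v f x)) :=
  (tendsto_integral_mul_weight hfn hc hlim (by fun_prop) (h.abs_inner_R_le v x)).const_mul _

lemma IsCoeff.dualOp_sum_smul (h : IsCoeff M S D R) {ι : Type*} (t : Finset ι) (a : ι → ℝ)
    (u : ι → E) {f : E → ℝ} {c : ℝ} (hf : Continuous f) (hc : ∀ x, |f x| ≤ c) (x : E) :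
    dualOp s S R (∑ i ∈ t, a i • u i) f x = ∑ i ∈ t, a i * dualOp s S R (u i) f x := by
  have e : ∀ z, f (eulerStep s S x z) * ⟪R x (∑ i ∈ t, a i • u i), z⟫ =
      ∑ i ∈ t, a i * (f (eulerStep s S x z) * ⟪R x (u i), z⟫) := by
    intro z
    simp only [map_sum, map_smul, sum_inner, real_inner_smul_left, Finset.mul_sum]
    exact Finset.sum_congr rfl fun i _ ↦ by ring
  simp_rw [dualOp, e]
  rw [integral_finsetSum _ fun i _ ↦ (integrable_mul_weight hf hc (by fun_prop)
    (h.abs_inner_R_le (u i) x)).const_mul _, Finset.mul_sum]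
  exact Finset.sum_congr rfl fun i _ ↦ by rw [integral_const_mul]; ring

lemma IsCoeff.ae_differentiableAt_eulerStep (h : IsCoeff M S D R) (hs : 0 < s) {f : E → ℝ}
    {C : ℝ≥0} (hf : LipschitzWith C f) (x : E) :
    ∀ᵐ z ∂(stdGaussian E), DifferentiableAt ℝ f (eulerStep s S x z) := by
  refine stdGaussian_absolutelyContinuous.ae_le ?_
  let L : E →ₗ[ℝ] E := s • (S x : E →ₗ[ℝ] E)
  have hL : LinearMap.det L ≠ 0 := by
    have e : L * (s⁻¹ • (R x : E →ₗ[ℝ] E)) = 1 := by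
      ext v
      simp [L, h.S_R, hs.ne']
    intro h0
    have := congrArg LinearMap.det e
    rw [map_mul, h0, zero_mul, map_one] at this
    exact zero_ne_one this
  have q1 := Measure.LinearMap.quasiMeasurePreserving (volume : Measure E) L hL
  have q2 := (measurePreserving_add_left (volume : Measure E) x).quasiMeasurePreserving
  exact (q2.comp q1).ae hf.ae_differentiableAt

/-- `Q (∂_v f) = T_v f` for a Lipschitz function `f`. -/
lemma IsCoeff.stepOp_fderiv_eq_dualOp (h : IsCoeff M S D R) (hs : 0 < s) {f : E → ℝ}
    {C : ℝ≥0} (hf : LipschitzWith C f) (v x : E) :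
    stepOp s S (fun x ↦ fderiv ℝ f x v) x = dualOp s S R v f x := by
  have hF : LipschitzWith (C * (s • ‖S x‖).toNNReal) (fun z ↦ f (eulerStep s S x z)) := by
    refine hf.comp (LipschitzWith.of_dist_le_mul fun z z' ↦ ?_)
    rw [dist_eq_norm, dist_eq_norm, Real.coe_toNNReal _ (by positivity), eulerStep, eulerStep,
      add_sub_add_left_eq_sub, ← smul_sub, ← map_sub, norm_smul, Real.norm_of_nonneg hs.le,
      smul_eq_mul, mul_assoc]
    gcongr
    exact (S x).le_opNorm _
  have key := integral_lineDeriv_stdGaussian_of_lipschitz hF (s⁻¹ • R x v)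
  rw [stepOp, dualOp, ← integral_const_mul]
  calc ∫ z, fderiv ℝ f (eulerStep s S x z) v ∂(stdGaussian E)
      = ∫ z, lineDeriv ℝ (fun z ↦ f (eulerStep s S x z)) z (s⁻¹ • R x v) ∂(stdGaussian E) := by
        refine integral_congr_ae ?_
        filter_upwards [h.ae_differentiableAt_eulerStep hs hf x] with z hz
        have hd : HasFDerivAt (eulerStep s S x) (s • S x) z :=
          ((s • S x).hasFDerivAt).const_add x
        have := (hz.hasFDerivAt.comp z hd).hasLineDerivAt (s⁻¹ • R x v)
        refine Eq.trans ?_ this.lineDeriv.symm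
        simp [h.S_R, hs.ne']
    _ = _ := by
        rw [key]
        congr 1
        ext z
        rw [real_inner_smul_left]
        ring

end

end OneStep

section Gradient

open Module
open scoped RealInnerProductSpace Topology

variable {E : Type*} [NormedAddCommGroup E] [InnerProductSpace ℝ E] [FiniteDimensional ℝ E]
  [MeasurableSpace E] [BorelSpace E]
  {M s : ℝ} {S R : E → E →L[ℝ] E} {D : E → E →L[ℝ] E →L[ℝ] E} {f : E → ℝ} {c c' : ℝ}

/-! ### The commutator of the transition operator with a derivative -/

/-- The weight `⟪R D_v z, z⟫ - tr (R D_v)` with `C_v f (x) = 𝔼 [f (x + s S(x) Z) weight(Z)]`. -/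
noncomputable def commWeight (R : E → E →L[ℝ] E) (D : E → E →L[ℝ] E →L[ℝ] E) (v x z : E) : ℝ :=
  ∑ p, (⟪stdOrthonormalBasis ℝ E p, z⟫ * ⟪R x (D x v (stdOrthonormalBasis ℝ E p)), z⟫ -
    ⟪stdOrthonormalBasis ℝ E p, R x (D x v (stdOrthonormalBasis ℝ E p))⟫)

lemma continuous_commWeight (v x : E) : Continuous (commWeight R D v x) := by
  unfold commWeight
  fun_prop

lemma IsCoeff.abs_commWeight_le (h : IsCoeff M S D R) (v x z : E) :
    |commWeight R D v x z| ≤ finrank ℝ E * M ^ 2 * ‖v‖ * (1 + ‖z‖) ^ 2 := by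
  have hb : ∀ p, ‖stdOrthonormalBasis ℝ E p‖ = 1 := fun p ↦
    (stdOrthonormalBasis ℝ E).norm_eq_one p
  have hw : ∀ p, ‖R x (D x v (stdOrthonormalBasis ℝ E p))‖ ≤ M ^ 2 * ‖v‖ := fun p ↦ by
    simpa [hb] using h.norm_R_D_apply_le x v (stdOrthonormalBasis ℝ E p)
  refine (Finset.abs_sum_le_sum_abs _ _).trans ?_
  have : ∀ p ∈ (Finset.univ : Finset (Fin (finrank ℝ E))),
      |⟪stdOrthonormalBasis ℝ E p, z⟫ * ⟪R x (D x v (stdOrthonormalBasis ℝ E p)), z⟫ -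
        ⟪stdOrthonormalBasis ℝ E p, R x (D x v (stdOrthonormalBasis ℝ E p))⟫| ≤
      M ^ 2 * ‖v‖ * (1 + ‖z‖) ^ 2 := by
    intro p _
    have h1 := abs_real_inner_le_norm (stdOrthonormalBasis ℝ E p) z
    have h2 := abs_real_inner_le_norm (R x (D x v (stdOrthonormalBasis ℝ E p))) z
    have h3 := abs_real_inner_le_norm (stdOrthonormalBasis ℝ E p)
      (R x (D x v (stdOrthonormalBasis ℝ E p)))
    rw [hb, one_mul] at h1 h3
    have h4 : |⟪R x (D x v (stdOrthonormalBasis ℝ E p)), z⟫| ≤ M ^ 2 * ‖v‖ * ‖z‖ :=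
      h2.trans (by gcongr; exact hw p)
    refine (abs_sub _ _).trans ?_
    rw [abs_mul]
    have h5 := mul_le_mul h1 h4 (abs_nonneg _) (norm_nonneg z)
    have h6 : 0 ≤ M ^ 2 * ‖v‖ * ‖z‖ := by positivity
    nlinarith [hw p]
  refine (Finset.sum_le_sum this).trans_eq ?_
  simp
  ring

/-- Gaussian integration by parts against the linear vector field `z ↦ R D_v z`. -/
lemma IsCoeff.commOp_eq (h : IsCoeff M S D R) (hf : IsC1Bounded c c' f) (v x : E) :
    commOp s S D v f x =
      ∫ z, f (eulerStep s S x z) * commWeight R D v x z ∂(stdGaussian E) := by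
  set b := stdOrthonormalBasis ℝ E with hb
  let w : Fin (finrank ℝ E) → E := fun p ↦ R x (D x v (b p))
  have hM := h.pos
  have hc' := hf.c'_nonneg
  have hfc := hf.continuous
  have hdc := hf.continuous_fderiv
  have hec : Continuous (eulerStep s S x) := continuous_eulerStep_right x
  have int1 : ∀ p, Integrable
      (fun z ↦ f (eulerStep s S x z) * (⟪b p, z⟫ * ⟪w p, z⟫)) (stdGaussian E) := fun p ↦ by
    refine integrable_mul_weight (C := ‖b p‖ * ‖w p‖) hfc hf.le (by fun_prop) fun z ↦ ?_
    rw [abs_mul]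
    calc |⟪b p, z⟫| * |⟪w p, z⟫| ≤ (‖b p‖ * ‖z‖) * (‖w p‖ * ‖z‖) := by
          gcongr <;> exact abs_real_inner_le_norm _ _
      _ = ‖b p‖ * ‖w p‖ * ‖z‖ ^ 2 := by ring
      _ ≤ _ := by gcongr; exact norm_pow_le_one_add_pow_four z (by norm_num)
  have int2 : ∀ p, Integrable
      (fun z ↦ f (eulerStep s S x z) * ⟪b p, z⟫) (stdGaussian E) := fun p ↦ by
    refine integrable_mul_weight (C := ‖b p‖) hfc hf.le (by fun_prop) fun z ↦ ?_
    refine (abs_real_inner_le_norm _ _).trans ?_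
    gcongr
    simpa using norm_pow_le_one_add_pow_four z (k := 1) (by norm_num)
  have int3 : ∀ (p) (u : E), Integrable
      (fun z ↦ ⟪b p, z⟫ * fderiv ℝ f (eulerStep s S x z) u) (stdGaussian E) := fun p u ↦ by
    refine integrable_stdGaussian_of_le (Continuous.aestronglyMeasurable ?_) (‖b p‖ * (c' * ‖u‖))
      fun z ↦ ?_
    · exact (by fun_prop : Continuous fun z ↦ ⟪b p, z⟫).mul
        ((hdc.comp hec).clm_apply continuous_const)
    · rw [norm_mul]
      calc ‖⟪b p, z⟫‖ * ‖fderiv ℝ f (eulerStep s S x z) u‖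
          ≤ (‖b p‖ * ‖z‖) * (c' * ‖u‖) := by
            gcongr
            · exact abs_real_inner_le_norm _ _
            · exact (fderiv ℝ f _).le_of_opNorm_le (hf.fderiv_le _) u
        _ = ‖b p‖ * (c' * ‖u‖) * ‖z‖ := by ring
        _ ≤ _ := by
            gcongr
            simpa using norm_pow_le_one_add_pow_four z (k := 1) (by norm_num)
  have int4 := integrable_comp_eulerStep (s := s) (S := S) hfc hf.le x
  have key : ∀ p, ∫ z, (⟪b p, w p⟫ * f (eulerStep s S x z) +
      ⟪b p, z⟫ * fderiv ℝ f (eulerStep s S x z) (s • D x v (b p))) ∂(stdGaussian E) =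
      ∫ z, f (eulerStep s S x z) * (⟪b p, z⟫ * ⟪w p, z⟫) ∂(stdGaussian E) := fun p ↦ by
    have := integral_lineDeriv_stdGaussian (F := fun z ↦ ⟪b p, z⟫ * f (eulerStep s S x z))
      (F' := fun z ↦ ⟪b p, w p⟫ * f (eulerStep s S x z) +
        ⟪b p, z⟫ * fderiv ℝ f (eulerStep s S x z) (s • D x v (b p))) (w := w p)
      (by simpa only [mul_comm] using int2 p) ((int4.const_mul _).add (int3 p _))
      (by convert int1 p using 2; ring) (fun z ↦ ?_)
    · rw [this]
      congr 1
      ext z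
      ring
    · have hd : HasFDerivAt (eulerStep s S x) (s • S x) z :=
        ((s • S x).hasFDerivAt).const_add x
      have h1 := (hf.differentiable (eulerStep s S x z)).hasFDerivAt.comp z hd
      have h2 : HasFDerivAt (fun z : E ↦ ⟪b p, z⟫) (innerSL ℝ (b p)) z :=
        (innerSL ℝ (b p)).hasFDerivAt
      convert! (h2.mul h1).hasLineDerivAt (w p) using 1
      simp [w, h.S_R]
      ring
  have e1 : ∀ z, s * fderiv ℝ f (eulerStep s S x z) (D x v z) =
      ∑ p, ⟪b p, z⟫ * fderiv ℝ f (eulerStep s S x z) (s • D x v (b p)) := fun z ↦ by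
    have hz : D x v z = D x v (∑ p, ⟪b p, z⟫ • b p) := by rw [b.sum_repr' z]
    rw [hz]
    simp only [map_sum, map_smul, smul_eq_mul, Finset.mul_sum]
    exact Finset.sum_congr rfl fun p _ ↦ by ring
  have e2 : ∀ z, f (eulerStep s S x z) * commWeight R D v x z =
      ∑ p, (f (eulerStep s S x z) * (⟪b p, z⟫ * ⟪w p, z⟫) -
        ⟪b p, w p⟫ * f (eulerStep s S x z)) := fun z ↦ by
    rw [commWeight, Finset.mul_sum]
    exact Finset.sum_congr rfl fun p _ ↦ by ring
  have int5 : ∀ p, Integrable (fun z ↦ f (eulerStep s S x z) * (⟪b p, z⟫ * ⟪w p, z⟫) -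
      ⟪b p, w p⟫ * f (eulerStep s S x z)) (stdGaussian E) :=
    fun p ↦ (int1 p).sub (int4.const_mul _)
  rw [commOp, ← integral_const_mul]
  simp_rw [e1, e2]
  rw [integral_finsetSum _ fun p _ ↦ int3 p _, integral_finsetSum _ fun p _ ↦ int5 p]
  refine Finset.sum_congr rfl fun p _ ↦ ?_
  have k := key p
  rw [integral_add (int4.const_mul _) (int3 p _)] at k
  rw [integral_sub (int1 p) (int4.const_mul _), ← k]
  ring

lemma pow_two_le_pow_four (z : E) : (1 + ‖z‖) ^ 2 ≤ (1 + ‖z‖) ^ 4 :=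
  pow_le_pow_right₀ (by linarith [norm_nonneg z]) (by norm_num)

/-- The commutator does not lose any derivative. -/
lemma IsCoeff.abs_commOp_le (h : IsCoeff M S D R) (hf : IsC1Bounded c c' f) (v x : E) :
    |commOp s S D v f x| ≤ finrank ℝ E * M ^ 2 * momentConst E * ‖v‖ * c := by
  rw [h.commOp_eq hf]
  refine (abs_integral_mul_weight_le (C := finrank ℝ E * M ^ 2 * ‖v‖) hf.le fun z ↦ ?_).trans_eq
    (by ring)
  exact (h.abs_commWeight_le v x z).trans
    (mul_le_mul_of_nonneg_left (pow_two_le_pow_four z) (by positivity))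

lemma IsCoeff.continuous_commOp (h : IsCoeff M S D R) (hf : IsC1Bounded c c' f) (v : E) :
    Continuous (commOp s S D v f) := by
  have hD := h.continuous_D
  have hR := h.continuous_R
  have e : commOp s S D v f =
      fun x ↦ ∫ z, f (eulerStep s S x z) * commWeight R D v x z ∂(stdGaussian E) := by
    ext x
    exact h.commOp_eq hf v x
  rw [e]
  refine h.continuous_integral_mul (C := finrank ℝ E * M ^ 2 * ‖v‖) hf.continuous hf.le ?_
    fun x z ↦ ?_
  · unfold commWeight
    fun_prop
  · exact (h.abs_commWeight_le v x z).trans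
      (mul_le_mul_of_nonneg_left (pow_two_le_pow_four z) (by positivity))

/-! ### Differentiability of the transition operator -/

lemma IsCoeff.hasFDerivAt_eulerStep (h : IsCoeff M S D R) (x z : E) :
    HasFDerivAt (fun x ↦ eulerStep s S x z)
      (ContinuousLinearMap.id ℝ E + s • (D x).flip z) x := by
  refine (hasFDerivAt_id x).add (HasFDerivAt.const_smul ?_ s)
  have := (h.hasFDerivAt x).clm_apply (hasFDerivAt_const z x)
  convert! this using 1
  ext v
  simp

lemma IsCoeff.norm_fderiv_eulerStep_le (h : IsCoeff M S D R) (hs : 0 < s) (hs1 : s ≤ 1)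
    (x z : E) :
    ‖ContinuousLinearMap.id ℝ E + s • (D x).flip z‖ ≤ M * (1 + ‖z‖) ^ 4 := by
  have hM := h.pos
  refine ContinuousLinearMap.opNorm_le_bound _ (by positivity) fun v ↦ ?_
  have h1 : ‖v + s • D x v z‖ ≤ M * (1 + ‖z‖) * ‖v‖ := by
    refine (norm_add_le _ _).trans ?_
    rw [norm_smul, Real.norm_of_nonneg hs.le]
    have := h.norm_D_apply_apply_le x v z
    have h2 : s * ‖D x v z‖ ≤ M * ‖v‖ * ‖z‖ :=
      (mul_le_of_le_one_left (norm_nonneg _) hs1).trans this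
    nlinarith [mul_le_mul_of_nonneg_right h.one_le (norm_nonneg v)]
  refine h1.trans ?_
  gcongr
  exact le_self_pow₀ (by linarith [norm_nonneg z]) (by norm_num)

lemma IsCoeff.norm_fderiv_comp_eulerStep_le (h : IsCoeff M S D R) (hs : 0 < s) (hs1 : s ≤ 1)
    (hf : IsC1Bounded c c' f) (x z : E) :
    ‖(fderiv ℝ f (eulerStep s S x z)) ∘L (ContinuousLinearMap.id ℝ E + s • (D x).flip z)‖ ≤
      c' * M * (1 + ‖z‖) ^ 4 := by
  refine (ContinuousLinearMap.opNorm_comp_le _ _).trans ?_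
  rw [mul_assoc]
  exact mul_le_mul (hf.fderiv_le _) (h.norm_fderiv_eulerStep_le hs hs1 x z) (norm_nonneg _)
    hf.c'_nonneg

lemma IsCoeff.continuous_fderiv_comp_eulerStep (h : IsCoeff M S D R) (hf : IsC1Bounded c c' f) :
    Continuous fun p : E × E ↦ (fderiv ℝ f (eulerStep s S p.1 p.2)) ∘L
      (ContinuousLinearMap.id ℝ E + s • (D p.1).flip p.2) := by
  have hD := h.continuous_D
  have h1 : Continuous fun p : E × E ↦ (D p.1).flip p.2 := by
    have : Continuous fun x ↦ (D x).flip :=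
      (ContinuousLinearMap.flipₗᵢ ℝ E E E).continuous.comp hD
    exact (this.comp continuous_fst).clm_apply continuous_snd
  exact (hf.continuous_fderiv.comp h.continuous_eulerStep).clm_comp
    (continuous_const.add (h1.const_smul s))

lemma IsCoeff.hasFDerivAt_stepOp (h : IsCoeff M S D R) (hs : 0 < s) (hs1 : s ≤ 1)
    (hf : IsC1Bounded c c' f) (x : E) :
    HasFDerivAt (stepOp s S f) (∫ z, (fderiv ℝ f (eulerStep s S x z)) ∘L
      (ContinuousLinearMap.id ℝ E + s • (D x).flip z) ∂(stdGaussian E)) x := by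
  have hcont := h.continuous_fderiv_comp_eulerStep (s := s) hf
  refine hasFDerivAt_integral_of_dominated_of_fderiv_le
    (F := fun x z ↦ f (eulerStep s S x z))
    (F' := fun x z ↦ (fderiv ℝ f (eulerStep s S x z)) ∘L
      (ContinuousLinearMap.id ℝ E + s • (D x).flip z))
    (bound := fun z ↦ c' * M * (1 + ‖z‖) ^ 4) Filter.univ_mem
    (.of_forall fun x ↦ (hf.continuous.comp (continuous_eulerStep_right x)).aestronglyMeasurable)
    (integrable_comp_eulerStep hf.continuous hf.le x)
    (hcont.comp (by fun_prop : Continuous fun z : E ↦ (x, z))).aestronglyMeasurable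
    (.of_forall fun z x _ ↦ h.norm_fderiv_comp_eulerStep_le hs hs1 hf x z)
    (integrable_one_add_norm_pow_four.const_mul _)
    (.of_forall fun z x _ ↦ ?_)
  exact (hf.differentiable _).hasFDerivAt.comp x (h.hasFDerivAt_eulerStep x z)

lemma IsCoeff.isC1Bounded_stepOp (h : IsCoeff M S D R) (hs : 0 < s) (hs1 : s ≤ 1)
    (hf : IsC1Bounded c c' f) : IsC1Bounded c (c' * M * momentConst E) (stepOp s S f) where
  contDiff := by
    have hcont := h.continuous_fderiv_comp_eulerStep (s := s) hf
    rw [contDiff_one_iff_fderiv]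
    refine ⟨fun x ↦ (h.hasFDerivAt_stepOp hs hs1 hf x).differentiableAt, ?_⟩
    have e : fderiv ℝ (stepOp s S f) = fun x ↦ ∫ z, (fderiv ℝ f (eulerStep s S x z)) ∘L
        (ContinuousLinearMap.id ℝ E + s • (D x).flip z) ∂(stdGaussian E) := by
      ext1 x
      exact (h.hasFDerivAt_stepOp hs hs1 hf x).fderiv
    rw [e]
    exact continuous_of_dominated (bound := fun z ↦ c' * M * (1 + ‖z‖) ^ 4)
      (fun x ↦ (hcont.comp (by fun_prop : Continuous fun z : E ↦ (x, z))).aestronglyMeasurable)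
      (fun x ↦ .of_forall fun z ↦ h.norm_fderiv_comp_eulerStep_le hs hs1 hf x z)
      (integrable_one_add_norm_pow_four.const_mul _)
      (.of_forall fun z ↦ hcont.comp (by fun_prop : Continuous fun x : E ↦ (x, z)))
  le := abs_stepOp_le hf.le
  fderiv_le x := by
    rw [(h.hasFDerivAt_stepOp hs hs1 hf x).fderiv]
    exact norm_integral_stdGaussian_le
      fun z ↦ h.norm_fderiv_comp_eulerStep_le hs hs1 hf x z

lemma IsCoeff.isC1Bounded_iterate_stepOp (h : IsCoeff M S D R) (hs : 0 < s) (hs1 : s ≤ 1)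
    (hf : IsC1Bounded c c' f) (r : ℕ) : ∃ c₁, IsC1Bounded c c₁ ((stepOp s S)^[r] f) := by
  induction r with
  | zero => exact ⟨c', hf⟩
  | succ r ih =>
    obtain ⟨c₁, hc₁⟩ := ih
    rw [Function.iterate_succ_apply']
    exact ⟨_, h.isC1Bounded_stepOp hs hs1 hc₁⟩

/-- The chain rule under the integral. -/
lemma IsCoeff.fderiv_stepOp_apply (h : IsCoeff M S D R) (hs : 0 < s) (hs1 : s ≤ 1)
    (hf : IsC1Bounded c c' f) (x v : E) :
    fderiv ℝ (stepOp s S f) x v =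
      ∫ z, fderiv ℝ f (eulerStep s S x z) (v + s • D x v z) ∂(stdGaussian E) := by
  have hcont := h.continuous_fderiv_comp_eulerStep (s := s) hf
  rw [(h.hasFDerivAt_stepOp hs hs1 hf x).fderiv, ContinuousLinearMap.integral_apply]
  · simp
  · exact integrable_stdGaussian_of_le
      (hcont.comp (by fun_prop : Continuous fun z : E ↦ (x, z))).aestronglyMeasurable (c' * M)
      fun z ↦ h.norm_fderiv_comp_eulerStep_le hs hs1 hf x z

/-- `∂_v Q f = T_v f + C_v f`. -/
lemma IsCoeff.fderiv_stepOp_eq (h : IsCoeff M S D R) (hs : 0 < s) (hs1 : s ≤ 1)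
    (hf : IsC1Bounded c c' f) (x v : E) :
    fderiv ℝ (stepOp s S f) x v = dualOp s S R v f x + commOp s S D v f x := by
  have hM := h.pos
  have hdc := hf.continuous_fderiv
  have hec : Continuous (eulerStep s S x) := continuous_eulerStep_right x
  rw [h.fderiv_stepOp_apply hs hs1 hf, ← h.stepOp_fderiv_eq_dualOp hs hf.lipschitz, stepOp, commOp,
    ← integral_const_mul, ← integral_add]
  · simp
  · refine (integrable_const (c' * ‖v‖)).mono'
      ((hdc.comp hec).clm_apply continuous_const).aestronglyMeasurable (.of_forall fun z ↦ ?_)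
    exact (fderiv ℝ f _).le_of_opNorm_le (hf.fderiv_le _) v
  · refine Integrable.const_mul (integrable_stdGaussian_of_le
      ((hdc.comp hec).clm_apply (by fun_prop)).aestronglyMeasurable (c' * (M * ‖v‖)) fun z ↦ ?_) _
    have hc' := hf.c'_nonneg
    calc ‖fderiv ℝ f (eulerStep s S x z) (D x v z)‖ ≤ c' * (M * ‖v‖ * ‖z‖) := by
          refine ((fderiv ℝ f _).le_of_opNorm_le (hf.fderiv_le _) _).trans ?_
          gcongr
          exact h.norm_D_apply_apply_le x v z
      _ = c' * (M * ‖v‖) * ‖z‖ := by ring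
      _ ≤ _ := by
          gcongr
          simpa using norm_pow_le_one_add_pow_four z (k := 1) (by norm_num)

end Gradient

section GradientEstimate

open Module
open scoped RealInnerProductSpace Topology

variable {E : Type*} [NormedAddCommGroup E] [InnerProductSpace ℝ E] [FiniteDimensional ℝ E]
  [MeasurableSpace E] [BorelSpace E]
  {M s : ℝ} {S R : E → E →L[ℝ] E} {D : E → E →L[ℝ] E →L[ℝ] E} {f : E → ℝ} {c c' : ℝ}

/-! ### The gradient estimate for the iterated transition operator -/

/-- The constant of the one-step reverse Poincaré inequality. -/
noncomputable def gradConst (E : Type*) [NormedAddCommGroup E] [InnerProductSpace ℝ E]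
    [FiniteDimensional ℝ E] [MeasurableSpace E] [BorelSpace E] (M : ℝ) : ℝ :=
  (M + finrank ℝ E * M ^ 2) ^ 2 * momentConst E

/-- The Bismut weight: `∂_v Q f (x) = 𝔼 [f (x + s S(x) Z) weight(Z)]`. -/
noncomputable def gradWeight (s : ℝ) (R : E → E →L[ℝ] E) (D : E → E →L[ℝ] E →L[ℝ] E)
    (v x z : E) : ℝ :=
  s⁻¹ * ⟪R x v, z⟫ + commWeight R D v x z

lemma continuous_gradWeight (v x : E) : Continuous (gradWeight s R D v x) := by
  have := continuous_commWeight (R := R) (D := D) v x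
  unfold gradWeight
  fun_prop

lemma IsCoeff.abs_gradWeight_le (h : IsCoeff M S D R) (hs : 0 < s) (hs1 : s ≤ 1) (v x z : E) :
    |gradWeight s R D v x z| ≤ s⁻¹ * (M + finrank ℝ E * M ^ 2) * ‖v‖ * (1 + ‖z‖) ^ 2 := by
  have hM := h.pos
  have hs2 : 1 ≤ s⁻¹ := (one_le_inv₀ hs).2 hs1
  have h1 : |⟪R x v, z⟫| ≤ M * ‖v‖ * (1 + ‖z‖) ^ 2 := by
    calc |⟪R x v, z⟫| ≤ ‖R x v‖ * ‖z‖ := abs_real_inner_le_norm _ _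
      _ ≤ M * ‖v‖ * (1 + ‖z‖) ^ 2 := by
        gcongr
        · exact h.norm_R_apply_le x v
        · nlinarith [norm_nonneg z]
  have h2 := h.abs_commWeight_le v x z
  have h3 : (finrank ℝ E * M ^ 2 * ‖v‖ * (1 + ‖z‖) ^ 2) ≤
      s⁻¹ * (finrank ℝ E * M ^ 2 * ‖v‖ * (1 + ‖z‖) ^ 2) :=
    le_mul_of_one_le_left (by positivity) hs2
  calc |gradWeight s R D v x z| ≤ |s⁻¹ * ⟪R x v, z⟫| + |commWeight R D v x z| := abs_add_le _ _
    _ ≤ s⁻¹ * (M * ‖v‖ * (1 + ‖z‖) ^ 2) +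
        s⁻¹ * (finrank ℝ E * M ^ 2 * ‖v‖ * (1 + ‖z‖) ^ 2) := by
      rw [abs_mul, abs_of_pos (inv_pos.2 hs)]
      gcongr
      exact h2.trans h3
    _ = _ := by ring

lemma IsCoeff.integrable_mul_gradWeight (h : IsCoeff M S D R) (hs : 0 < s) (hs1 : s ≤ 1)
    (hf : Continuous f) (hc : ∀ x, |f x| ≤ c) (v x : E) :
    Integrable (fun z ↦ f (eulerStep s S x z) * gradWeight s R D v x z) (stdGaussian E) := by
  have hM := h.pos
  exact integrable_mul_weight hf hc (continuous_gradWeight v x) fun z ↦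
    (h.abs_gradWeight_le hs hs1 v x z).trans
      (mul_le_mul_of_nonneg_left (pow_two_le_pow_four z) (by positivity))

lemma IsCoeff.fderiv_stepOp_eq_gradWeight (h : IsCoeff M S D R) (hs : 0 < s) (hs1 : s ≤ 1)
    (hf : IsC1Bounded c c' f) (x v : E) :
    fderiv ℝ (stepOp s S f) x v =
      ∫ z, f (eulerStep s S x z) * gradWeight s R D v x z ∂(stdGaussian E) := by
  rw [h.fderiv_stepOp_eq hs hs1 hf, dualOp, h.commOp_eq hf, ← integral_const_mul, ← integral_add]
  · congr 1
    ext z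
    rw [gradWeight]
    ring
  · exact (integrable_mul_weight hf.continuous hf.le (by fun_prop)
      (h.abs_inner_R_le v x)).const_mul _
  · exact integrable_mul_weight hf.continuous hf.le (continuous_commWeight v x) fun z ↦
      (h.abs_commWeight_le v x z).trans
        (mul_le_mul_of_nonneg_left (pow_two_le_pow_four z) (by positivity))

/-- The weight is centred, since constants have derivative zero. -/
lemma IsCoeff.integral_gradWeight (h : IsCoeff M S D R) (hs : 0 < s) (hs1 : s ≤ 1) (x v : E) :
    ∫ z, gradWeight s R D v x z ∂(stdGaussian E) = 0 := by
  have h1 : IsC1Bounded 1 0 (fun _ : E ↦ (1 : ℝ)) :=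
    ⟨contDiff_const, by simp, by simp⟩
  have h2 := h.fderiv_stepOp_eq_gradWeight hs hs1 h1 x v
  have h3 : stepOp s S (fun _ : E ↦ (1 : ℝ)) = fun _ ↦ 1 := by
    ext x
    simp [stepOp]
  rw [h3] at h2
  simpa using h2.symm

/-- One-step reverse Poincaré inequality. -/
lemma IsCoeff.sq_fderiv_stepOp_le_variance (h : IsCoeff M S D R) (hs : 0 < s) (hs1 : s ≤ 1)
    (hf : IsC1Bounded c c' f) (x v : E) :
    s ^ 2 * (fderiv ℝ (stepOp s S f) x v) ^ 2 ≤ gradConst E M * ‖v‖ ^ 2 *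
      (stepOp s S (fun x ↦ f x ^ 2) x - (stepOp s S f x) ^ 2) := by
  set a := stepOp s S f x with ha
  have hM := h.pos
  have hW := continuous_gradWeight (s := s) (R := R) (D := D) v x
  have hfa : Continuous fun x ↦ f x - a := hf.continuous.sub continuous_const
  have hca : ∀ x, |f x - a| ≤ c + |a| := fun x ↦ (abs_sub _ _).trans (by linarith [hf.le x])
  have hc2 : ∀ x, |f x ^ 2| ≤ c ^ 2 := fun x ↦ by
    rw [abs_pow]; exact pow_le_pow_left₀ (abs_nonneg _) (hf.le x) 2
  have hca2 : ∀ x, |(f x - a) ^ 2| ≤ (c + |a|) ^ 2 := fun x ↦ by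
    rw [abs_pow]; exact pow_le_pow_left₀ (abs_nonneg _) (hca x) 2
  have e1 : fderiv ℝ (stepOp s S f) x v =
      ∫ z, (f (eulerStep s S x z) - a) * gradWeight s R D v x z ∂(stdGaussian E) := by
    have i0 := h.integrable_mul_gradWeight hs hs1 hf.continuous hf.le v x
    have i1 := h.integrable_mul_gradWeight hs hs1 (continuous_const (y := a))
      (fun _ : E ↦ le_rfl) v x
    simp_rw [sub_mul]
    rw [integral_sub i0 i1, integral_const_mul, h.integral_gradWeight hs hs1, mul_zero, sub_zero,
      h.fderiv_stepOp_eq_gradWeight hs hs1 hf]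
  have hWb : ∀ z, |gradWeight s R D v x z ^ 2| ≤
      s⁻¹ ^ 2 * (M + finrank ℝ E * M ^ 2) ^ 2 * ‖v‖ ^ 2 * (1 + ‖z‖) ^ 4 := fun z ↦ by
    rw [abs_pow]
    refine (pow_le_pow_left₀ (abs_nonneg _) (h.abs_gradWeight_le hs hs1 v x z) 2).trans_eq ?_
    ring
  have cs := sq_integral_mul_le (μ := stdGaussian E) (f := fun z ↦ f (eulerStep s S x z) - a)
    (g := gradWeight s R D v x)
    (integrable_comp_eulerStep (hfa.pow 2) hca2 x)
    (integrable_stdGaussian_of_le (hW.pow 2).aestronglyMeasurable _ hWb)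
    (h.integrable_mul_gradWeight hs hs1 hfa hca v x)
  have e2 : ∫ z, (f (eulerStep s S x z) - a) ^ 2 ∂(stdGaussian E) =
      stepOp s S (fun x ↦ f x ^ 2) x - a ^ 2 := by
    have hf2 : Continuous fun x ↦ f x ^ 2 := hf.continuous.pow 2
    have i2 := integrable_comp_eulerStep (s := s) (S := S) hf2 hc2 x
    have i1 := (integrable_comp_eulerStep (s := s) (S := S) hf.continuous hf.le x).const_mul (2 * a)
    have e : ∀ z, (f (eulerStep s S x z) - a) ^ 2 =
        f (eulerStep s S x z) ^ 2 - (2 * a) * f (eulerStep s S x z) + a ^ 2 := fun z ↦ by ring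
    have i3 : Integrable (fun z ↦ f (eulerStep s S x z) ^ 2 -
        (2 * a) * f (eulerStep s S x z)) (stdGaussian E) := i2.sub i1
    simp_rw [e]
    rw [integral_add i3 (integrable_const _), integral_sub i2 i1, integral_const_mul]
    simp only [integral_const, probReal_univ, one_smul]
    rw [stepOp, ha, stepOp]
    ring
  have e3 : ∫ z, gradWeight s R D v x z ^ 2 ∂(stdGaussian E) ≤
      s⁻¹ ^ 2 * (gradConst E M * ‖v‖ ^ 2) := by
    refine (le_abs_self _).trans ((norm_integral_stdGaussian_le (V := ℝ) hWb).trans_eq ?_)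
    rw [gradConst]
    ring
  have e4 : 0 ≤ stepOp s S (fun x ↦ f x ^ 2) x - a ^ 2 := by
    rw [← e2]; exact integral_nonneg fun z ↦ sq_nonneg _
  rw [e1]
  rw [e2] at cs
  calc s ^ 2 * (∫ z, (f (eulerStep s S x z) - a) * gradWeight s R D v x z ∂(stdGaussian E)) ^ 2
      ≤ s ^ 2 * ((stepOp s S (fun x ↦ f x ^ 2) x - a ^ 2) *
          (s⁻¹ ^ 2 * (gradConst E M * ‖v‖ ^ 2))) := by
        gcongr
        exact cs.trans (by gcongr)
    _ = _ := by field_simp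

/-- The transition operator almost commutes with the gradient in mean square: the cross term
vanishes since `Z` is centred, and the remaining error is of order `s ^ 2`. -/
lemma IsCoeff.sq_fderiv_stepOp_le (h : IsCoeff M S D R) (hs : 0 < s) (hs1 : s ≤ 1)
    (hf : IsC1Bounded c c' f) (x v : E) :
    (fderiv ℝ (stepOp s S f) x v) ^ 2 ≤ (1 + M ^ 2 * momentConst E * s ^ 2) * ‖v‖ ^ 2 *
      stepOp s S (fun x ↦ ‖fderiv ℝ f x‖ ^ 2) x := by
  have hM := h.pos
  have hdc := hf.continuous_fderiv
  have hec : Continuous (eulerStep s S x) := continuous_eulerStep_right x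
  have hDz : ∀ z, ‖v + s • D x v z‖ ^ 2 ≤
      ‖v‖ ^ 2 + 2 * s * ⟪v, D x v z⟫ + s ^ 2 * (M ^ 2 * ‖v‖ ^ 2 * ‖z‖ ^ 2) := fun z ↦ by
    rw [norm_add_sq_real, real_inner_smul_right, norm_smul, mul_pow, Real.norm_of_nonneg hs.le]
    have := pow_le_pow_left₀ (norm_nonneg _) (h.norm_D_apply_apply_le x v z) 2
    have h2 := mul_le_mul_of_nonneg_left this (sq_nonneg s)
    calc _ ≤ ‖v‖ ^ 2 + 2 * (s * ⟪v, D x v z⟫) + s ^ 2 * (M * ‖v‖ * ‖z‖) ^ 2 := by linarith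
      _ = _ := by ring
  have hz2 : ∀ z, ‖(⟪v, D x v z⟫ : ℝ)‖ ≤ ‖v‖ * (M * ‖v‖) * (1 + ‖z‖) ^ 4 := fun z ↦ by
    calc ‖(⟪v, D x v z⟫ : ℝ)‖ ≤ ‖v‖ * (M * ‖v‖ * ‖z‖) :=
          (abs_real_inner_le_norm _ _).trans (by gcongr; exact h.norm_D_apply_apply_le x v z)
      _ = ‖v‖ * (M * ‖v‖) * ‖z‖ := by ring
      _ ≤ _ := by
          gcongr
          simpa using norm_pow_le_one_add_pow_four z (k := 1) (by norm_num)
  have i1 : Integrable (fun z ↦ ⟪v, D x v z⟫) (stdGaussian E) :=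
    integrable_stdGaussian_of_le (Continuous.aestronglyMeasurable (by fun_prop)) _ hz2
  have i2 : Integrable (fun z : E ↦ ‖z‖ ^ 2) (stdGaussian E) := integrable_norm_pow_stdGaussian 2
  have i3 : Integrable (fun z ↦ ‖v‖ ^ 2 + 2 * s * ⟪v, D x v z⟫ +
      s ^ 2 * (M ^ 2 * ‖v‖ ^ 2 * ‖z‖ ^ 2)) (stdGaussian E) :=
    ((integrable_const _).add (i1.const_mul _)).add ((i2.const_mul _).const_mul _)
  have i4 : Integrable (fun z ↦ ‖v + s • D x v z‖ ^ 2) (stdGaussian E) := by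
    refine i3.mono' (Continuous.aestronglyMeasurable (by fun_prop)) (.of_forall fun z ↦ ?_)
    rw [Real.norm_of_nonneg (by positivity)]
    exact hDz z
  have e0 : ∫ z, (⟪v, D x v z⟫ : ℝ) ∂(stdGaussian E) = 0 :=
    integral_strongDual_stdGaussian ((innerSL ℝ v) ∘L (D x v))
  have e1 : ∫ z, ‖v + s • D x v z‖ ^ 2 ∂(stdGaussian E) ≤
      (1 + M ^ 2 * momentConst E * s ^ 2) * ‖v‖ ^ 2 := by
    have hm2 : ∫ z : E, ‖z‖ ^ 2 ∂(stdGaussian E) ≤ momentConst E :=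
      integral_mono i2 integrable_one_add_norm_pow_four
        fun z ↦ norm_pow_le_one_add_pow_four z (by norm_num)
    have i5 : Integrable (fun z ↦ ‖v‖ ^ 2 + 2 * s * ⟪v, D x v z⟫) (stdGaussian E) :=
      (integrable_const _).add (i1.const_mul _)
    calc ∫ z, ‖v + s • D x v z‖ ^ 2 ∂(stdGaussian E) ≤ _ := integral_mono i4 i3 hDz
      _ = ‖v‖ ^ 2 + s ^ 2 * (M ^ 2 * ‖v‖ ^ 2 * ∫ z : E, ‖z‖ ^ 2 ∂(stdGaussian E)) := by
        rw [integral_add i5 ((i2.const_mul _).const_mul _),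
          integral_add (integrable_const _) (i1.const_mul _), integral_const_mul,
          integral_const_mul, integral_const_mul, e0]
        simp
      _ ≤ ‖v‖ ^ 2 + s ^ 2 * (M ^ 2 * ‖v‖ ^ 2 * momentConst E) := by gcongr
      _ = _ := by ring
  have hc'2 : ∀ x, |‖fderiv ℝ f x‖ ^ 2| ≤ c' ^ 2 := fun x ↦ by
    rw [abs_of_nonneg (by positivity)]
    exact pow_le_pow_left₀ (norm_nonneg _) (hf.fderiv_le x) 2
  have hdc2 : Continuous fun x ↦ ‖fderiv ℝ f x‖ ^ 2 := hdc.norm.pow 2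
  have i6 := integrable_comp_eulerStep (s := s) (S := S) hdc2 hc'2 x
  have i7 : Integrable (fun z ↦ ‖fderiv ℝ f (eulerStep s S x z)‖ * ‖v + s • D x v z‖)
      (stdGaussian E) := by
    refine (i6.add i4).mono' ?_ (.of_forall fun z ↦ ?_)
    · exact ((hdc.comp hec).norm.mul (by fun_prop)).aestronglyMeasurable
    · rw [Real.norm_of_nonneg (by positivity), Pi.add_apply]
      nlinarith [sq_nonneg (‖fderiv ℝ f (eulerStep s S x z)‖ - ‖v + s • D x v z‖),
        norm_nonneg (fderiv ℝ f (eulerStep s S x z)), norm_nonneg (v + s • D x v z)]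
  have cs := sq_integral_mul_le i6 i4 i7
  have e2 : |fderiv ℝ (stepOp s S f) x v| ≤
      ∫ z, ‖fderiv ℝ f (eulerStep s S x z)‖ * ‖v + s • D x v z‖ ∂(stdGaussian E) := by
    rw [h.fderiv_stepOp_apply hs hs1 hf]
    exact norm_integral_le_of_norm_le i7 (.of_forall fun z ↦ (fderiv ℝ f _).le_opNorm _)
  calc (fderiv ℝ (stepOp s S f) x v) ^ 2 = |fderiv ℝ (stepOp s S f) x v| ^ 2 := (sq_abs _).symm
    _ ≤ _ := pow_le_pow_left₀ (abs_nonneg _) e2 2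
    _ ≤ _ := cs
    _ ≤ stepOp s S (fun x ↦ ‖fderiv ℝ f x‖ ^ 2) x *
        ((1 + M ^ 2 * momentConst E * s ^ 2) * ‖v‖ ^ 2) := by
        have : 0 ≤ ∫ z, ‖fderiv ℝ f (eulerStep s S x z)‖ ^ 2 ∂(stdGaussian E) :=
          integral_nonneg fun z ↦ by positivity
        exact mul_le_mul_of_nonneg_left e1 this
    _ = _ := by ring

lemma sq_norm_le_of_forall_sq_apply_le {L : E →L[ℝ] ℝ} {a : ℝ} (ha : 0 ≤ a)
    (h : ∀ v, (L v) ^ 2 ≤ a * ‖v‖ ^ 2) : ‖L‖ ^ 2 ≤ a := by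
  have : ‖L‖ ≤ √a := by
    refine ContinuousLinearMap.opNorm_le_bound _ (Real.sqrt_nonneg _) fun v ↦ ?_
    refine abs_le_of_sq_le_sq ?_ (by positivity)
    rw [mul_pow, Real.sq_sqrt ha]
    exact h v
  calc ‖L‖ ^ 2 ≤ (√a) ^ 2 := pow_le_pow_left₀ (norm_nonneg _) this 2
    _ = a := Real.sq_sqrt ha

/-- Discrete Bakry–Émery argument: the energy `r s² |∇ Q^r f|²` is controlled by the variance
`Q^r f² - (Q^r f)²`, since the one-step inequalities telescope. -/
lemma IsCoeff.sq_norm_fderiv_iterate_le (h : IsCoeff M S D R) (hs : 0 < s) (hs1 : s ≤ 1)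
    (hf : IsC1Bounded c c' f) (r : ℕ) (x : E) :
    r * s ^ 2 * ‖fderiv ℝ ((stepOp s S)^[r] f) x‖ ^ 2 ≤
      gradConst E M * (1 + M ^ 2 * momentConst E * s ^ 2) ^ r *
        ((stepOp s S)^[r] (fun x ↦ f x ^ 2) x - ((stepOp s S)^[r] f x) ^ 2) := by
  have hM := h.pos
  have hκ := one_le_momentConst (E := E)
  have hA : 0 ≤ gradConst E M := by unfold gradConst; positivity
  have hc2 : ∀ x, |f x ^ 2| ≤ c ^ 2 := fun x ↦ by
    rw [abs_pow]; exact pow_le_pow_left₀ (abs_nonneg _) (hf.le x) 2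
  set q := 1 + M ^ 2 * momentConst E * s ^ 2 with hq
  have hq1 : 1 ≤ q := by
    have : 0 ≤ M ^ 2 * momentConst E * s ^ 2 := by positivity
    linarith
  induction r generalizing x with
  | zero => simp
  | succ r ih =>
    obtain ⟨c₁, hr⟩ := h.isC1Bounded_iterate_stepOp hs hs1 hf r
    have hf2 : Continuous fun x ↦ f x ^ 2 := hf.continuous.pow 2
    have h2 := h.continuous_iterate_stepOp (s := s) hf2 hc2 r
    simp only [Function.iterate_succ_apply']
    set u := (stepOp s S)^[r] f
    set w := (stepOp s S)^[r] (fun x ↦ f x ^ 2)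
    have huc2 : ∀ x, |u x ^ 2| ≤ c ^ 2 := fun x ↦ by
      rw [abs_pow]; exact pow_le_pow_left₀ (abs_nonneg _) (hr.le x) 2
    have hdc2 : ∀ x, |‖fderiv ℝ u x‖ ^ 2| ≤ c₁ ^ 2 := fun x ↦ by
      rw [abs_of_nonneg (by positivity)]
      exact pow_le_pow_left₀ (norm_nonneg _) (hr.fderiv_le x) 2
    have hdcont : Continuous fun x ↦ ‖fderiv ℝ u x‖ ^ 2 := hr.continuous_fderiv.norm.pow 2
    have hvar : 0 ≤ stepOp s S (fun x ↦ u x ^ 2) x - (stepOp s S u x) ^ 2 := by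
      have := sq_integral_mul_le (μ := stdGaussian E) (f := fun z ↦ u (eulerStep s S x z))
        (g := fun _ ↦ 1) (integrable_comp_eulerStep (hr.continuous.pow 2) huc2 x)
        (by simp) (by simpa using integrable_comp_eulerStep hr.continuous hr.le x)
      simp only [mul_one, one_pow, integral_const, probReal_univ, one_smul] at this
      rw [stepOp, stepOp]
      linarith
    have hQd : 0 ≤ stepOp s S (fun x ↦ ‖fderiv ℝ u x‖ ^ 2) x :=
      integral_nonneg fun z ↦ by positivity
    -- the contraction estimate, combined with the induction hypothesis under `Q`
    have a1 : ‖fderiv ℝ (stepOp s S u) x‖ ^ 2 ≤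
        q * stepOp s S (fun x ↦ ‖fderiv ℝ u x‖ ^ 2) x :=
      sq_norm_le_of_forall_sq_apply_le (by positivity) fun v ↦
        (h.sq_fderiv_stepOp_le hs hs1 hr x v).trans_eq (by ring)
    have a2 : r * s ^ 2 * stepOp s S (fun x ↦ ‖fderiv ℝ u x‖ ^ 2) x ≤
        gradConst E M * q ^ r * (stepOp s S w x - stepOp s S (fun x ↦ u x ^ 2) x) := by
      have hu2 : Continuous fun x ↦ u x ^ 2 := hr.continuous.pow 2
      have m := stepOp_mono (s := s) (S := S) (c := r * s ^ 2 * c₁ ^ 2)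
        (c₁ := gradConst E M * q ^ r * (c ^ 2 + c ^ 2))
        (f := fun x ↦ r * s ^ 2 * ‖fderiv ℝ u x‖ ^ 2)
        (g := fun x ↦ gradConst E M * q ^ r * (w x - u x ^ 2))
        (continuous_const.mul hdcont) (fun x ↦ ?_)
        (continuous_const.mul (h2.1.sub hu2)) (fun x ↦ ?_) ih x
      · rw [stepOp_const_mul, stepOp_const_mul, stepOp_sub h2.1 h2.2 hu2 huc2] at m
        exact m
      · rw [abs_mul, abs_of_nonneg (by positivity : 0 ≤ (r : ℝ) * s ^ 2)]
        exact mul_le_mul_of_nonneg_left (hdc2 x) (by positivity)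
      · rw [abs_mul, abs_of_nonneg (by positivity : 0 ≤ gradConst E M * q ^ r)]
        exact mul_le_mul_of_nonneg_left ((abs_sub _ _).trans (add_le_add (h2.2 x) (huc2 x)))
          (by positivity)
    -- the one-step reverse Poincaré inequality pays for the new step
    have a3 : s ^ 2 * ‖fderiv ℝ (stepOp s S u) x‖ ^ 2 ≤ gradConst E M *
        (stepOp s S (fun x ↦ u x ^ 2) x - (stepOp s S u x) ^ 2) := by
      have : ‖fderiv ℝ (stepOp s S u) x‖ ^ 2 ≤ (s ^ 2)⁻¹ * (gradConst E M *
          (stepOp s S (fun x ↦ u x ^ 2) x - (stepOp s S u x) ^ 2)) :=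
        sq_norm_le_of_forall_sq_apply_le (by positivity) fun v ↦ by
          have := h.sq_fderiv_stepOp_le_variance hs hs1 hr x v
          rw [mul_assoc, ← div_eq_inv_mul, le_div_iff₀ (by positivity)]
          linarith
      rwa [← div_eq_inv_mul, le_div_iff₀ (by positivity), mul_comm] at this
    have a4 : gradConst E M * (stepOp s S (fun x ↦ u x ^ 2) x - (stepOp s S u x) ^ 2) ≤
        gradConst E M * q ^ (r + 1) *
          (stepOp s S (fun x ↦ u x ^ 2) x - (stepOp s S u x) ^ 2) := by
      refine mul_le_mul_of_nonneg_right ?_ hvar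
      exact le_mul_of_one_le_right hA (one_le_pow₀ hq1)
    have a5 : r * s ^ 2 * ‖fderiv ℝ (stepOp s S u) x‖ ^ 2 ≤ q * (gradConst E M * q ^ r *
        (stepOp s S w x - stepOp s S (fun x ↦ u x ^ 2) x)) := by
      calc r * s ^ 2 * ‖fderiv ℝ (stepOp s S u) x‖ ^ 2
          ≤ r * s ^ 2 * (q * stepOp s S (fun x ↦ ‖fderiv ℝ u x‖ ^ 2) x) := by gcongr
        _ = q * (r * s ^ 2 * stepOp s S (fun x ↦ ‖fderiv ℝ u x‖ ^ 2) x) := by ring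
        _ ≤ _ := by gcongr
    push_cast
    calc (r + 1) * s ^ 2 * ‖fderiv ℝ (stepOp s S u) x‖ ^ 2
        = r * s ^ 2 * ‖fderiv ℝ (stepOp s S u) x‖ ^ 2 +
          s ^ 2 * ‖fderiv ℝ (stepOp s S u) x‖ ^ 2 := by ring
      _ ≤ _ := add_le_add a5 (a3.trans a4)
      _ = _ := by ring

/-- The constant of the gradient estimate over a time interval of length at most one. -/
noncomputable def iterGradConst (E : Type*) [NormedAddCommGroup E] [InnerProductSpace ℝ E]
    [FiniteDimensional ℝ E] [MeasurableSpace E] [BorelSpace E] (M : ℝ) : ℝ :=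
  √(gradConst E M * Real.exp (M ^ 2 * momentConst E))

/-- Gradient estimate: `|∇ Q^r f| ≤ C (r s²)^{-1/2} sup |f|` as long as `r s² ≤ 1`. -/
lemma IsCoeff.norm_fderiv_iterate_le (h : IsCoeff M S D R) (hs : 0 < s) (hs1 : s ≤ 1)
    (hf : IsC1Bounded c c' f) {r : ℕ} (hr : 0 < r) (hrs : r * s ^ 2 ≤ 1) (x : E) :
    ‖fderiv ℝ ((stepOp s S)^[r] f) x‖ ≤ iterGradConst E M * c / √(r * s ^ 2) := by
  have hM := h.pos
  have hκ := one_le_momentConst (E := E)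
  have hc := hf.c_nonneg
  have hA : 0 ≤ gradConst E M := by unfold gradConst; positivity
  have hc2 : ∀ x, |f x ^ 2| ≤ c ^ 2 := fun x ↦ by
    rw [abs_pow]; exact pow_le_pow_left₀ (abs_nonneg _) (hf.le x) 2
  have hf2 : Continuous fun x ↦ f x ^ 2 := hf.continuous.pow 2
  have h2 := (h.continuous_iterate_stepOp (s := s) hf2 hc2 r).2 x
  have hpos : 0 < (r : ℝ) * s ^ 2 := by positivity
  have hexp : (1 + M ^ 2 * momentConst E * s ^ 2) ^ r ≤ Real.exp (M ^ 2 * momentConst E) := by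
    calc (1 + M ^ 2 * momentConst E * s ^ 2) ^ r
        ≤ (Real.exp (M ^ 2 * momentConst E * s ^ 2)) ^ r := by
          gcongr
          rw [add_comm]
          exact Real.add_one_le_exp _
      _ = Real.exp (M ^ 2 * momentConst E * (r * s ^ 2)) := by
          rw [← Real.exp_nat_mul]
          congr 1
          ring
      _ ≤ _ := by
          refine Real.exp_le_exp.2 ?_
          exact mul_le_of_le_one_right (a := M ^ 2 * momentConst E) (by positivity) hrs
  have key : r * s ^ 2 * ‖fderiv ℝ ((stepOp s S)^[r] f) x‖ ^ 2 ≤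
      gradConst E M * Real.exp (M ^ 2 * momentConst E) * c ^ 2 := by
    have k := h.sq_norm_fderiv_iterate_le hs hs1 hf r x
    have k1 : (stepOp s S)^[r] (fun x ↦ f x ^ 2) x - ((stepOp s S)^[r] f x) ^ 2 ≤ c ^ 2 := by
      linarith [le_abs_self ((stepOp s S)^[r] (fun x ↦ f x ^ 2) x),
        sq_nonneg ((stepOp s S)^[r] f x)]
    calc _ ≤ _ := k
      _ ≤ gradConst E M * (1 + M ^ 2 * momentConst E * s ^ 2) ^ r * c ^ 2 := by gcongr
      _ ≤ _ := by gcongr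
  rw [le_div_iff₀ (Real.sqrt_pos.2 hpos)]
  refine le_of_abs_le (abs_le_of_sq_le_sq ?_ (by unfold iterGradConst; positivity))
  rw [mul_pow, mul_pow, iterGradConst, Real.sq_sqrt hpos.le, Real.sq_sqrt (by positivity)]
  linarith

end GradientEstimate

section DualEstimate

open Module
open scoped RealInnerProductSpace Topology Convolution

variable {E : Type*} [NormedAddCommGroup E] [InnerProductSpace ℝ E] [FiniteDimensional ℝ E]
  [MeasurableSpace E] [BorelSpace E]
  {M s : ℝ} {S R : E → E →L[ℝ] E} {D : E → E →L[ℝ] E →L[ℝ] E} {f : E → ℝ} {c c' : ℝ}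

/-! ### Smooth approximation of bounded continuous functions -/

/-- Convolution with a bump function preserves the supremum bound and gives a bounded gradient. -/
lemma isC1Bounded_convolution (φ : ContDiffBump (0 : E)) {g : E → ℝ} (hg : Continuous g)
    (hc : ∀ x, |g x| ≤ c) :
    ∃ c', IsC1Bounded c c'
      (φ.normed volume ⋆[ContinuousLinearMap.lsmul ℝ ℝ, volume] g : E → ℝ) := by
  have hcs : HasCompactSupport (φ.normed (volume : Measure E)) := φ.hasCompactSupport_normed
  have hφ : ContDiff ℝ 1 (φ.normed (volume : Measure E)) := φ.contDiff_normed
  have hgl : LocallyIntegrable g (volume : Measure E) := hg.locallyIntegrable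
  set L := (ContinuousLinearMap.lsmul ℝ ℝ : ℝ →L[ℝ] ℝ →L[ℝ] ℝ)
  refine ⟨(∫ t, ‖fderiv ℝ (φ.normed (volume : Measure E)) t‖) * c,
    ?_, fun x ↦ ?_, fun x ↦ ?_⟩
  · exact hcs.contDiff_convolution_left (n := 1) L hφ hgl
  · have hi : Integrable (φ.normed (volume : Measure E)) := φ.integrable_normed
    have := norm_integral_le_of_norm_le (μ := (volume : Measure E))
      (f := fun t ↦ L (φ.normed volume t) (g (x - t))) (hi.mul_const c)
      (.of_forall fun t ↦ by
        simp only [L, ContinuousLinearMap.lsmul_apply, smul_eq_mul, norm_mul, Real.norm_eq_abs,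
          abs_of_nonneg (φ.nonneg_normed t)]
        exact mul_le_mul_of_nonneg_left (hc _) (φ.nonneg_normed t))
    rwa [integral_mul_const, φ.integral_normed, one_mul] at this
  · rw [(hcs.hasFDerivAt_convolution_left L hφ hgl x).fderiv]
    have hd : Continuous (fderiv ℝ (φ.normed (volume : Measure E))) :=
      hφ.continuous_fderiv (by simp)
    have hi : Integrable (fun t ↦ ‖fderiv ℝ (φ.normed (volume : Measure E)) t‖) :=
      (hd.integrable_of_hasCompactSupport (hcs.fderiv (𝕜 := ℝ))).norm
    rw [← integral_mul_const]
    refine norm_integral_le_of_norm_le (hi.mul_const _) (.of_forall fun t ↦ ?_)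
    refine ContinuousLinearMap.opNorm_le_bound _
      (mul_nonneg (norm_nonneg _) ((abs_nonneg _).trans (hc 0))) fun v ↦ ?_
    rw [ContinuousLinearMap.precompL_apply]
    simp only [L, ContinuousLinearMap.lsmul_apply, smul_eq_mul, norm_mul]
    rw [mul_right_comm]
    exact mul_le_mul (ContinuousLinearMap.le_opNorm _ v) (hc _) (norm_nonneg _) (by positivity)

lemma exists_seq_isC1Bounded {g : E → ℝ} (hg : Continuous g) (hc : ∀ x, |g x| ≤ c) :
    ∃ gn : ℕ → E → ℝ, (∀ n, ∃ c', IsC1Bounded c c' (gn n)) ∧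
      ∀ x, Filter.Tendsto (fun n ↦ gn n x) Filter.atTop (𝓝 (g x)) := by
  let φ : ℕ → ContDiffBump (0 : E) := fun n ↦
    ⟨1 / ((n : ℝ) + 1) / 2, 1 / ((n : ℝ) + 1), by positivity, half_lt_self (by positivity)⟩
  refine ⟨fun n ↦ ((φ n).normed volume ⋆[ContinuousLinearMap.lsmul ℝ ℝ, volume] g),
    fun n ↦ isC1Bounded_convolution (φ n) hg hc, fun x ↦ ?_⟩
  exact ContDiffBump.convolution_tendsto_right_of_continuous
    (tendsto_one_div_add_atTop_nhds_zero_nat (𝕜 := ℝ)) hg x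

/-! ### Bounds for `Q^j T_v` -/

/-- The operator `Q^j T_v` has norm at most `a ‖v‖` on bounded continuous functions. -/
def DualBound (s : ℝ) (S R : E → E →L[ℝ] E) (j : ℕ) (a : ℝ) : Prop :=
  ∀ (g : E → ℝ) (c : ℝ) (v x : E), Continuous g → (∀ x, |g x| ≤ c) →
    |(stepOp s S)^[j] (dualOp s S R v g) x| ≤ a * ‖v‖ * c

/-- It suffices to bound `Q^j T_v` on smooth functions. -/
lemma IsCoeff.dualBound_of_isC1Bounded (h : IsCoeff M S D R) (hs : 0 < s) {j : ℕ} {a : ℝ}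
    (H : ∀ (g : E → ℝ) (c c' : ℝ) (v x : E), IsC1Bounded c c' g →
      |(stepOp s S)^[j] (dualOp s S R v g) x| ≤ a * ‖v‖ * c) : DualBound s S R j a := by
  intro g c v x hg hc
  obtain ⟨gn, h1, h2⟩ := exists_seq_isC1Bounded hg hc
  choose cn hgn using h1
  have lim := h.tendsto_iterate_stepOp (s := s)
    (fun n ↦ h.continuous_dualOp (s := s) (hgn n).continuous (hgn n).le v)
    (fun n ↦ h.abs_dualOp_le hs (hgn n).le v)
    (fun x ↦ h.tendsto_dualOp (s := s) (fun n ↦ (hgn n).continuous) (fun n ↦ (hgn n).le) h2 v x)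
    j x
  exact le_of_tendsto lim.abs (.of_forall fun n ↦ H (gn n) c (cn n) v x (hgn n))

/-- `Q` is a contraction for the supremum norm, so bounds persist for larger powers. -/
lemma DualBound.add (h : IsCoeff M S D R) (hs : 0 < s) {j : ℕ} {a : ℝ}
    (H : DualBound s S R j a) (i : ℕ) : DualBound s S R (i + j) a := by
  intro g c v x hg hc
  rw [Function.iterate_add_apply]
  have h1 := h.continuous_iterate_stepOp (s := s) (h.continuous_dualOp (s := s) hg hc v)
    (h.abs_dualOp_le hs hc v) j
  exact (h.continuous_iterate_stepOp h1.1 (fun x ↦ H g c v x hg hc) i).2 x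

lemma DualBound.mono {j : ℕ} {a a' : ℝ} (H : DualBound s S R j a) (ha : a ≤ a') :
    DualBound s S R j a' := by
  intro g c v x hg hc
  have hc0 : 0 ≤ c := (abs_nonneg _).trans (hc 0)
  exact (H g c v x hg hc).trans (by gcongr)

lemma IsCoeff.iterate_stepOp_sum (h : IsCoeff M S D R) {ι : Type*} (t : Finset ι)
    {g : ι → E → ℝ} {C : ι → ℝ} (hg : ∀ i, Continuous (g i)) (hC : ∀ i x, |g i x| ≤ C i) (r : ℕ) :
    (stepOp s S)^[r] (fun x ↦ ∑ i ∈ t, g i x) = fun x ↦ ∑ i ∈ t, (stepOp s S)^[r] (g i) x := by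
  classical
  induction t using Finset.induction_on with
  | empty =>
    have := iterate_stepOp_const_mul (s := s) (S := S) 0 (fun _ ↦ 0) r
    simpa using this
  | insert i t hi ih =>
    simp only [Finset.sum_insert hi]
    rw [h.iterate_stepOp_add (c₁ := ∑ i ∈ t, C i) (hg i) (hC i)
      (continuous_finsetSum _ fun i _ ↦ hg i)
      (fun x ↦ (Finset.abs_sum_le_sum_abs _ _).trans (Finset.sum_le_sum fun i _ ↦ hC i x)), ih]

/-! ### The commutator with frozen coefficients -/

/-- The coefficient vectors `⟪b_q, S b_p⟫ D_v b_p` of the second order operator `C_v`. -/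
noncomputable def commCoeff (S : E → E →L[ℝ] E) (D : E → E →L[ℝ] E →L[ℝ] E) (v : E)
    (pq : Fin (finrank ℝ E) × Fin (finrank ℝ E)) (y : E) : E :=
  ⟪stdOrthonormalBasis ℝ E pq.2, S y (stdOrthonormalBasis ℝ E pq.1)⟫ •
    D y v (stdOrthonormalBasis ℝ E pq.1)

lemma IsCoeff.abs_inner_S_le (h : IsCoeff M S D R)
    (pq : Fin (finrank ℝ E) × Fin (finrank ℝ E)) (y : E) :
    |⟪stdOrthonormalBasis ℝ E pq.2, S y (stdOrthonormalBasis ℝ E pq.1)⟫| ≤ M := by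
  refine (abs_real_inner_le_norm _ _).trans ?_
  simpa using h.norm_S_apply_le y (stdOrthonormalBasis ℝ E pq.1)

lemma IsCoeff.norm_commCoeff_le (h : IsCoeff M S D R) (v : E)
    (pq : Fin (finrank ℝ E) × Fin (finrank ℝ E)) (y : E) :
    ‖commCoeff S D v pq y‖ ≤ M ^ 2 * ‖v‖ := by
  have hM := h.pos
  rw [commCoeff, norm_smul, Real.norm_eq_abs]
  calc _ ≤ M * (M * ‖v‖) := by
        gcongr
        · exact h.abs_inner_S_le pq y
        · simpa using h.norm_D_apply_apply_le y v (stdOrthonormalBasis ℝ E pq.1)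
    _ = _ := by ring

lemma IsCoeff.commCoeff_lip (h : IsCoeff M S D R) (v : E)
    (pq : Fin (finrank ℝ E) × Fin (finrank ℝ E)) (x y : E) :
    ‖commCoeff S D v pq x - commCoeff S D v pq y‖ ≤ 2 * M ^ 2 * ‖v‖ * ‖x - y‖ := by
  have hM := h.pos
  set bp := stdOrthonormalBasis ℝ E pq.1 with hbp
  set bq := stdOrthonormalBasis ℝ E pq.2 with hbq
  have hp : ‖bp‖ = 1 := (stdOrthonormalBasis ℝ E).norm_eq_one _
  have hq : ‖bq‖ = 1 := (stdOrthonormalBasis ℝ E).norm_eq_one _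
  have e : commCoeff S D v pq x - commCoeff S D v pq y =
      ⟪bq, S x bp⟫ • (D x - D y) v bp + ⟪bq, (S x - S y) bp⟫ • D y v bp := by
    simp only [commCoeff, ← hbp, ← hbq, sub_apply, inner_sub_right,
      sub_smul, smul_sub]
    abel
  have h1 : ‖(D x - D y) v bp‖ ≤ M * ‖x - y‖ * ‖v‖ := by
    calc ‖(D x - D y) v bp‖ ≤ ‖D x - D y‖ * ‖v‖ * ‖bp‖ := ContinuousLinearMap.le_opNorm₂ _ _ _
      _ ≤ M * ‖x - y‖ * ‖v‖ * 1 := by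
        rw [hp]
        gcongr
        exact h.D_lip x y
      _ = _ := by ring
  have h2 : |⟪bq, (S x - S y) bp⟫| ≤ M * ‖x - y‖ := by
    calc |⟪bq, (S x - S y) bp⟫| ≤ ‖bq‖ * (‖S x - S y‖ * ‖bp‖) :=
          (abs_real_inner_le_norm _ _).trans (by gcongr; exact (S x - S y).le_opNorm bp)
      _ ≤ _ := by
          rw [hp, hq]
          simpa using h.S_lip x y
  have h3 : ‖D y v bp‖ ≤ M * ‖v‖ := by simpa [hp] using h.norm_D_apply_apply_le y v bp
  rw [e]
  refine (norm_add_le _ _).trans ?_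
  rw [norm_smul, norm_smul, Real.norm_eq_abs, Real.norm_eq_abs]
  calc _ ≤ M * (M * ‖x - y‖ * ‖v‖) + (M * ‖x - y‖) * (M * ‖v‖) := by
        gcongr
        exact h.abs_inner_S_le pq x
    _ = _ := by ring

lemma IsCoeff.continuous_commCoeff (h : IsCoeff M S D R) (v : E)
    (pq : Fin (finrank ℝ E) × Fin (finrank ℝ E)) : Continuous (commCoeff S D v pq) := by
  have hS := h.continuous_S
  have hD := h.continuous_D
  unfold commCoeff
  fun_prop

lemma IsC1Bounded.abs_fderiv_apply_le (hf : IsC1Bounded c c' f) (x u : E) :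
    |fderiv ℝ f x u| ≤ c' * ‖u‖ :=
  (fderiv ℝ f x).le_of_opNorm_le (hf.fderiv_le x) u

/-- `C_v f (x)` is `s²` times a sum of terms `T_u (∂_w f) (x)` with directions `u, w` depending
on `x`. -/
lemma IsCoeff.commOp_eq_sum_dualOp (h : IsCoeff M S D R) (hs : 0 < s)
    (hf : IsC1Bounded c c' f) (v x : E) :
    commOp s S D v f x = s ^ 2 * ∑ pq, dualOp s S R (stdOrthonormalBasis ℝ E pq.2)
      (fun y ↦ fderiv ℝ f y (commCoeff S D v pq x)) x := by
  set b := stdOrthonormalBasis ℝ E with hb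
  have hdc := hf.continuous_fderiv
  have hgc : ∀ u : E, Continuous fun y ↦ fderiv ℝ f y u :=
    fun u ↦ hdc.clm_apply continuous_const
  have e1 : ∀ z, fderiv ℝ f (eulerStep s S x z) (D x v z) =
      ∑ p, fderiv ℝ f (eulerStep s S x z) (D x v (b p)) * ⟪R x (S x (b p)), z⟫ := fun z ↦ by
    have hz : D x v z = D x v (∑ p, ⟪b p, z⟫ • b p) := by rw [b.sum_repr' z]
    rw [hz]
    simp only [map_sum, map_smul, smul_eq_mul, h.R_S]
    exact Finset.sum_congr rfl fun p _ ↦ by ring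
  have e2 : commOp s S D v f x =
      s ^ 2 * ∑ p, dualOp s S R (S x (b p)) (fun y ↦ fderiv ℝ f y (D x v (b p))) x := by
    rw [commOp]
    simp_rw [e1]
    rw [integral_finsetSum _ fun p _ ↦ integrable_mul_weight (hgc (D x v (b p)))
      (fun y ↦ hf.abs_fderiv_apply_le y _) (by fun_prop) (h.abs_inner_R_le (S x (b p)) x)]
    simp_rw [dualOp, ← Finset.mul_sum, ← mul_assoc]
    congr 1
    field_simp
  rw [e2, Fintype.sum_prod_type]
  congr 1
  refine Finset.sum_congr rfl fun p _ ↦ ?_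
  have e3 : S x (b p) = ∑ q, ⟪b q, S x (b p)⟫ • b q := (b.sum_repr' _).symm
  conv_lhs => rw [e3]
  rw [h.dualOp_sum_smul _ _ _ (hgc _) (fun y ↦ hf.abs_fderiv_apply_le y _)]
  refine Finset.sum_congr rfl fun q _ ↦ ?_
  simp only [commCoeff, ← hb, map_smul, smul_eq_mul, dualOp, mul_assoc, integral_const_mul]
  ring

/-- Replacing the frozen direction `β(x)` by `β(x + s S(x) z)` costs only a bounded error, since
the weight of `T_u` is of order `s⁻¹` and `β` is Lipschitz. -/
lemma IsCoeff.abs_dualOp_frozen_sub_le (h : IsCoeff M S D R) (hs : 0 < s)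
    (hf : IsC1Bounded c c' f) (v x : E) (pq : Fin (finrank ℝ E) × Fin (finrank ℝ E)) :
    |dualOp s S R (stdOrthonormalBasis ℝ E pq.2)
        (fun y ↦ fderiv ℝ f y (commCoeff S D v pq x)) x -
      dualOp s S R (stdOrthonormalBasis ℝ E pq.2)
        (fun y ↦ fderiv ℝ f y (commCoeff S D v pq y)) x| ≤
      2 * M ^ 4 * momentConst E * ‖v‖ * c' := by
  have hM := h.pos
  have hc' := hf.c'_nonneg
  have hdc := hf.continuous_fderiv
  have hβ := h.continuous_commCoeff v pq
  set u := stdOrthonormalBasis ℝ E pq.2 with hu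
  have hu1 : ‖u‖ = 1 := (stdOrthonormalBasis ℝ E).norm_eq_one _
  have i1 : Integrable (fun z ↦ fderiv ℝ f (eulerStep s S x z) (commCoeff S D v pq x) *
      ⟪R x u, z⟫) (stdGaussian E) :=
    integrable_mul_weight (f := fun y ↦ fderiv ℝ f y (commCoeff S D v pq x))
      (hdc.clm_apply continuous_const) (fun y ↦ hf.abs_fderiv_apply_le y _) (by fun_prop)
      (h.abs_inner_R_le u x)
  have i2 : Integrable (fun z ↦ fderiv ℝ f (eulerStep s S x z)
      (commCoeff S D v pq (eulerStep s S x z)) * ⟪R x u, z⟫) (stdGaussian E) :=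
    integrable_mul_weight (f := fun y ↦ fderiv ℝ f y (commCoeff S D v pq y))
      (c := c' * (M ^ 2 * ‖v‖)) (hdc.clm_apply hβ)
      (fun y ↦ (hf.abs_fderiv_apply_le y _).trans
        (by gcongr; exact h.norm_commCoeff_le v pq y)) (by fun_prop)
      (h.abs_inner_R_le u x)
  rw [dualOp, dualOp, ← mul_sub, ← integral_sub i1 i2, abs_mul, abs_of_pos (inv_pos.2 hs),
    inv_mul_le_iff₀ hs]
  refine (norm_integral_stdGaussian_le (V := ℝ) (C := s * (2 * M ^ 4 * ‖v‖ * c'))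
    fun z ↦ ?_).trans_eq (by ring)
  rw [← sub_mul, ← map_sub, norm_mul]
  have h1 : ‖x - eulerStep s S x z‖ ≤ s * (M * ‖z‖) := by
    rw [eulerStep, sub_add_cancel_left, norm_neg, norm_smul, Real.norm_of_nonneg hs.le]
    gcongr
    exact h.norm_S_apply_le x z
  have h2 : ‖(⟪R x u, z⟫ : ℝ)‖ ≤ M * ‖z‖ := by
    refine (abs_real_inner_le_norm _ _).trans ?_
    gcongr
    simpa [hu1] using h.norm_R_apply_le x u
  calc _ ≤ (c' * (2 * M ^ 2 * ‖v‖ * (s * (M * ‖z‖)))) * (M * ‖z‖) := by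
        refine mul_le_mul ?_ h2 (norm_nonneg _) (by positivity)
        refine (hf.abs_fderiv_apply_le _ _).trans ?_
        gcongr
        exact (h.commCoeff_lip v pq x _).trans (by gcongr)
    _ = s * (2 * M ^ 4 * ‖v‖ * c') * ‖z‖ ^ 2 := by ring
    _ ≤ _ := by
        gcongr
        exact norm_pow_le_one_add_pow_four z (by norm_num)

/-- The constant of the commutator estimate. -/
noncomputable def commConst (E : Type*) [NormedAddCommGroup E] [InnerProductSpace ℝ E]
    [FiniteDimensional ℝ E] [MeasurableSpace E] [BorelSpace E] (M : ℝ) : ℝ :=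
  finrank ℝ E ^ 2 * (2 * M ^ 4 * momentConst E)

/-- A bound for `Q^i T` gives a bound for `Q^i C_v` that gains a factor `s²` at the price of one
derivative of `f`. -/
lemma IsCoeff.abs_iterate_commOp_le (h : IsCoeff M S D R) (hs : 0 < s)
    (hf : IsC1Bounded c c' f) {i : ℕ} {a : ℝ} (ha : 0 ≤ a) (H : DualBound s S R i a) (v x : E) :
    |(stepOp s S)^[i] (commOp s S D v f) x| ≤
      s ^ 2 * (commConst E M * (a + 1) * ‖v‖ * c') := by
  have hM := h.pos
  have hc' := hf.c'_nonneg
  have hκ := one_le_momentConst (E := E)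
  set b := stdOrthonormalBasis ℝ E with hb
  let g : Fin (finrank ℝ E) × Fin (finrank ℝ E) → E → ℝ :=
    fun pq y ↦ fderiv ℝ f y (commCoeff S D v pq y)
  have hgc : ∀ pq, Continuous (g pq) := fun pq ↦
    hf.continuous_fderiv.clm_apply (h.continuous_commCoeff v pq)
  have hgb : ∀ pq y, |g pq y| ≤ c' * (M ^ 2 * ‖v‖) := fun pq y ↦
    (hf.abs_fderiv_apply_le y _).trans (by gcongr; exact h.norm_commCoeff_le v pq y)
  let T : Fin (finrank ℝ E) × Fin (finrank ℝ E) → E → ℝ := fun pq ↦ dualOp s S R (b pq.2) (g pq)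
  have hTc : ∀ pq, Continuous (T pq) := fun pq ↦ h.continuous_dualOp (hgc pq) (hgb pq) _
  have hTb := fun pq ↦ h.abs_dualOp_le hs (hgb pq) (b pq.2)
  let err : E → ℝ := fun x ↦ (s ^ 2)⁻¹ * commOp s S D v f x - ∑ pq, T pq x
  have herrc : Continuous err := (continuous_const.mul (h.continuous_commOp hf v)).sub
    (continuous_finsetSum _ fun pq _ ↦ hTc pq)
  have hcard : ((Finset.univ : Finset (Fin (finrank ℝ E) × Fin (finrank ℝ E))).card : ℝ) =
      (finrank ℝ E : ℝ) ^ 2 := by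
    simp [sq]
  have herrb : ∀ x, |err x| ≤ finrank ℝ E ^ 2 * (2 * M ^ 4 * momentConst E * ‖v‖ * c') := by
    intro x
    have e : err x = ∑ pq, (dualOp s S R (b pq.2)
        (fun y ↦ fderiv ℝ f y (commCoeff S D v pq x)) x - T pq x) := by
      simp only [err]
      rw [h.commOp_eq_sum_dualOp hs hf, inv_mul_cancel_left₀ (by positivity),
        ← Finset.sum_sub_distrib]
    rw [e]
    refine (Finset.abs_sum_le_sum_abs _ _).trans ((Finset.sum_le_sum fun pq _ ↦
      h.abs_dualOp_frozen_sub_le hs hf v x pq).trans_eq ?_)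
    rw [Finset.sum_const, nsmul_eq_mul, hcard]
  have e : commOp s S D v f = fun x ↦ s ^ 2 * ((∑ pq, T pq x) + err x) := by
    ext x
    simp only [err, add_sub_cancel]
    rw [mul_inv_cancel_left₀ (by positivity)]
  rw [e, iterate_stepOp_const_mul, h.iterate_stepOp_add
    (continuous_finsetSum _ fun pq _ ↦ hTc pq)
    (fun x ↦ (Finset.abs_sum_le_sum_abs _ _).trans (Finset.sum_le_sum fun pq _ ↦ hTb pq x))
    herrc herrb, h.iterate_stepOp_sum _ hTc hTb]
  dsimp only
  rw [abs_mul, abs_of_nonneg (sq_nonneg s)]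
  gcongr
  have h1 : |∑ pq, (stepOp s S)^[i] (T pq) x| ≤ finrank ℝ E ^ 2 * (a * (c' * (M ^ 2 * ‖v‖))) := by
    refine (Finset.abs_sum_le_sum_abs _ _).trans ((Finset.sum_le_sum fun pq _ ↦
      H (g pq) _ (b pq.2) x (hgc pq) (hgb pq)).trans_eq ?_)
    simp only [b.norm_eq_one, mul_one]
    rw [Finset.sum_const, nsmul_eq_mul, hcard]
  have h2 := (h.continuous_iterate_stepOp (s := s) herrc herrb i).2 x
  have h3 : M ^ 2 ≤ 2 * M ^ 4 * momentConst E := by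
    have : M ^ 2 ≤ M ^ 4 := pow_le_pow_right₀ h.one_le (by norm_num)
    nlinarith [pow_pos hM 4]
  calc _ ≤ _ := abs_add_le _ _
    _ ≤ finrank ℝ E ^ 2 * (a * (c' * (M ^ 2 * ‖v‖))) +
        finrank ℝ E ^ 2 * (2 * M ^ 4 * momentConst E * ‖v‖ * c') := add_le_add h1 h2
    _ ≤ finrank ℝ E ^ 2 * (a * (c' * ((2 * M ^ 4 * momentConst E) * ‖v‖))) +
        finrank ℝ E ^ 2 * (2 * M ^ 4 * momentConst E * ‖v‖ * c') := by gcongr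
    _ = _ := by rw [commConst]; ring

/-- Moving the derivative from one side of `Q^{j+1}` to the other by successive commutators. -/
lemma IsCoeff.iterate_dualOp_eq (h : IsCoeff M S D R) (hs : 0 < s) (hs1 : s ≤ 1)
    (hf : IsC1Bounded c c' f) (v : E) (j : ℕ) (x : E) :
    (stepOp s S)^[j] (dualOp s S R v f) x = fderiv ℝ ((stepOp s S)^[j + 1] f) x v -
      ∑ r ∈ Finset.range (j + 1),
        (stepOp s S)^[j - r] (commOp s S D v ((stepOp s S)^[r] f)) x := by
  induction j generalizing f c' with
  | zero =>
    simp only [Function.iterate_zero, id, zero_add, Function.iterate_one, Finset.sum_range_one,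
      Nat.sub_self]
    rw [h.fderiv_stepOp_eq hs hs1 hf]
    ring
  | succ j ih =>
    have hQf := h.isC1Bounded_stepOp hs hs1 hf
    have e : dualOp s S R v f = fun x ↦ fderiv ℝ (stepOp s S f) x v - commOp s S D v f x := by
      ext x
      rw [h.fderiv_stepOp_eq hs hs1 hf]
      ring
    have hcc := h.continuous_commOp (s := s) hf v
    have hcb := h.abs_commOp_le (s := s) hf v
    have hdc : Continuous fun x ↦ fderiv ℝ (stepOp s S f) x v :=
      hQf.continuous_fderiv.clm_apply continuous_const
    have e2 : stepOp s S (dualOp s S R v f) = fun x ↦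
        dualOp s S R v (stepOp s S f) x - stepOp s S (commOp s S D v f) x := by
      rw [e, stepOp_sub hdc (fun x ↦ hQf.abs_fderiv_apply_le x v) hcc hcb]
      ext x
      rw [h.stepOp_fderiv_eq_dualOp hs hQf.lipschitz]
    rw [Function.iterate_succ_apply, e2, h.iterate_stepOp_sub
      (h.continuous_dualOp hQf.continuous hQf.le v) (h.abs_dualOp_le hs hQf.le v)
      (h.continuous_stepOp hcc hcb) (abs_stepOp_le hcb)]
    dsimp only
    rw [ih hQf, ← Function.iterate_succ_apply, Finset.sum_range_succ' _ (j + 1)]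
    simp only [Nat.add_sub_add_right, Function.iterate_succ_apply, Nat.sub_zero,
      Function.iterate_zero, id]
    ring

end DualEstimate

/-! ### Two elementary sums -/

lemma sum_range_inv_sqrt_le (j : ℕ) :
    ∑ r ∈ Finset.range j, 1 / √((r : ℝ) + 1) ≤ 2 * √(j : ℝ) := by
  induction j with
  | zero => simp
  | succ j ih =>
    rw [Finset.sum_range_succ]
    push_cast
    have h1 : (0 : ℝ) < √((j : ℝ) + 1) := Real.sqrt_pos.2 (by positivity)
    have h2 : 1 / √((j : ℝ) + 1) ≤ 2 * (√((j : ℝ) + 1) - √(j : ℝ)) := by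
      rw [div_le_iff₀ h1]
      have e1 := Real.mul_self_sqrt (by positivity : (0 : ℝ) ≤ (j : ℝ) + 1)
      have e2 := Real.mul_self_sqrt (by positivity : (0 : ℝ) ≤ (j : ℝ))
      nlinarith [sq_nonneg (√((j : ℝ) + 1) - √(j : ℝ))]
    linarith

/-- The discrete Beta integral `B(1/2, 1/2)` is bounded. -/
lemma sum_range_inv_sqrt_mul_inv_sqrt_le (j : ℕ) :
    ∑ r ∈ Finset.range j, 1 / √((j - r : ℕ) : ℝ) * (1 / √((r : ℝ) + 1)) ≤ 4 := by
  have hJ : (0 : ℝ) < √((j : ℝ) + 1) := Real.sqrt_pos.2 (by positivity)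
  have h1 : ∀ r ∈ Finset.range j, 1 / √((j - r : ℕ) : ℝ) * (1 / √((r : ℝ) + 1)) ≤
      (1 / √((j - 1 - r : ℕ) + 1 : ℝ) + 1 / √((r : ℝ) + 1)) / √((j : ℝ) + 1) := by
    intro r hr
    have hr := Finset.mem_range.1 hr
    have hN : j - r = (j - 1 - r) + 1 := by omega
    rw [hN]
    push_cast
    set p : ℝ := ((j - 1 - r : ℕ) : ℝ) + 1 with hp
    set q : ℝ := (r : ℝ) + 1 with hq
    have hpq : (j : ℝ) + 1 = p + q := by
      have : j = (j - 1 - r) + 1 + r := by omega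
      rw [hp, hq]
      nth_rewrite 1 [this]
      push_cast
      ring
    have p0 : 0 < √p := Real.sqrt_pos.2 (by positivity)
    have q0 : 0 < √q := Real.sqrt_pos.2 (by positivity)
    -- `√(p + q) ≤ √p + √q`
    have hsub : √((j : ℝ) + 1) ≤ √p + √q := by
      rw [hpq]
      refine Real.sqrt_le_iff.2 ⟨by positivity, ?_⟩
      have e1 := Real.mul_self_sqrt (by positivity : (0 : ℝ) ≤ p)
      have e2 := Real.mul_self_sqrt (by positivity : (0 : ℝ) ≤ q)
      nlinarith [mul_pos p0 q0]
    rw [le_div_iff₀ hJ]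
    have e : 1 / √p + 1 / √q = 1 / √p * (1 / √q) * (√p + √q) := by
      field_simp
      ring
    rw [e]
    gcongr
  have h2 : ∑ r ∈ Finset.range j, 1 / √((j - 1 - r : ℕ) + 1 : ℝ) =
      ∑ r ∈ Finset.range j, 1 / √((r : ℝ) + 1) :=
    Finset.sum_range_reflect (fun r ↦ 1 / √((r : ℝ) + 1)) j
  have h3 := sum_range_inv_sqrt_le j
  have h4 : √(j : ℝ) ≤ √((j : ℝ) + 1) := Real.sqrt_le_sqrt (by linarith)
  calc _ ≤ _ := Finset.sum_le_sum h1
    _ = (2 * ∑ r ∈ Finset.range j, 1 / √((r : ℝ) + 1)) / √((j : ℝ) + 1) := by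
      rw [← Finset.sum_div, Finset.sum_add_distrib, h2]
      ring
    _ ≤ 4 := by
      rw [div_le_iff₀ hJ]
      linarith

section Bootstrap

open Module
open scoped RealInnerProductSpace Topology

variable {E : Type*} [NormedAddCommGroup E] [InnerProductSpace ℝ E] [FiniteDimensional ℝ E]
  [MeasurableSpace E] [BorelSpace E]
  {M s : ℝ} {S R : E → E →L[ℝ] E} {D : E → E →L[ℝ] E →L[ℝ] E} {f : E → ℝ} {c c' : ℝ}

/-! ### The singular Gronwall argument -/

/-- A common upper bound for the constants of the gradient, commutator and one-step estimates. -/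
noncomputable def bootConst (E : Type*) [NormedAddCommGroup E] [InnerProductSpace ℝ E]
    [FiniteDimensional ℝ E] [MeasurableSpace E] [BorelSpace E] (M : ℝ) : ℝ :=
  1 + iterGradConst E M + finrank ℝ E * M ^ 2 * momentConst E +
    commConst E M * iterGradConst E M

lemma one_le_bootConst (hM : 0 < M) : 1 ≤ bootConst E M := by
  have hκ := one_le_momentConst (E := E)
  unfold bootConst commConst iterGradConst
  have : 0 ≤ √(gradConst E M * Real.exp (M ^ 2 * momentConst E)) := Real.sqrt_nonneg _
  have : 0 ≤ (finrank ℝ E : ℝ) * M ^ 2 * momentConst E := by positivity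
  have : 0 ≤ (finrank ℝ E : ℝ) ^ 2 * (2 * M ^ 4 * momentConst E) *
    √(gradConst E M * Real.exp (M ^ 2 * momentConst E)) := by positivity
  linarith

/-- A bound for `Q^j T_v` in terms of bounds for smaller powers: a Volterra inequality whose kernel
has the integrable singularity `(r s²)^{-1/2}` of the gradient estimate. -/
lemma IsCoeff.dualBound_of_forall_lt (h : IsCoeff M S D R) (hs : 0 < s) (hs1 : s ≤ 1) {j : ℕ}
    (hj : (j + 1 : ℕ) * s ^ 2 ≤ 1) {a : ℕ → ℝ} (ha : ∀ i < j, 0 ≤ a i)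
    (H : ∀ i < j, DualBound s S R i (a i)) :
    DualBound s S R j (bootConst E M * (1 / √((j + 1 : ℕ) * s ^ 2) + 1 +
      ∑ r ∈ Finset.range j, s ^ 2 * ((a (j - (r + 1)) + 1) * (1 / √((r + 1 : ℕ) * s ^ 2))))) := by
  refine h.dualBound_of_isC1Bounded hs fun g c c' v x hg ↦ ?_
  have hM := h.pos
  have hκ := one_le_momentConst (E := E)
  have hc := hg.c_nonneg
  have hK0 : 0 ≤ commConst E M := by unfold commConst; positivity
  have hL0 : 0 ≤ iterGradConst E M := by unfold iterGradConst; positivity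
  have hT0 : 0 ≤ finrank ℝ E * M ^ 2 * momentConst E := by positivity
  have hKL0 : 0 ≤ commConst E M * iterGradConst E M := by positivity
  have hC0 : 0 ≤ bootConst E M := by unfold bootConst; positivity
  have hC1 : iterGradConst E M ≤ bootConst E M := by unfold bootConst; linarith
  have hC2 : finrank ℝ E * M ^ 2 * momentConst E ≤ bootConst E M := by unfold bootConst; linarith
  have hC3 : commConst E M * iterGradConst E M ≤ bootConst E M := by unfold bootConst; linarith
  have t1 : |fderiv ℝ ((stepOp s S)^[j + 1] g) x v| ≤
      bootConst E M * (1 / √((j + 1 : ℕ) * s ^ 2)) * ‖v‖ * c := by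
    have := h.norm_fderiv_iterate_le hs hs1 hg (Nat.succ_pos j) hj x
    calc |fderiv ℝ ((stepOp s S)^[j + 1] g) x v|
        ≤ (iterGradConst E M * c / √((j + 1 : ℕ) * s ^ 2)) * ‖v‖ :=
          (fderiv ℝ _ x).le_of_opNorm_le this v
      _ ≤ (bootConst E M * c / √((j + 1 : ℕ) * s ^ 2)) * ‖v‖ := by gcongr
      _ = _ := by ring
  have t2 : |(stepOp s S)^[j] (commOp s S D v g) x| ≤ bootConst E M * ‖v‖ * c := by
    refine ((h.continuous_iterate_stepOp (s := s) (h.continuous_commOp hg v)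
      (h.abs_commOp_le hg v) j).2 x).trans ?_
    gcongr
  have t3 : ∀ r ∈ Finset.range j,
      |(stepOp s S)^[j - (r + 1)] (commOp s S D v ((stepOp s S)^[r + 1] g)) x| ≤
        bootConst E M * (s ^ 2 * ((a (j - (r + 1)) + 1) * (1 / √((r + 1 : ℕ) * s ^ 2)))) *
          ‖v‖ * c := by
    intro r hr
    have hr := Finset.mem_range.1 hr
    have hrs : ((r + 1 : ℕ) : ℝ) * s ^ 2 ≤ 1 := by
      refine le_trans ?_ hj
      gcongr
    obtain ⟨c₁, hr1⟩ := h.isC1Bounded_iterate_stepOp hs hs1 hg (r + 1)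
    have hr2 : IsC1Bounded c (iterGradConst E M * c / √((r + 1 : ℕ) * s ^ 2))
        ((stepOp s S)^[r + 1] g) :=
      ⟨hr1.contDiff, hr1.le, h.norm_fderiv_iterate_le hs hs1 hg (Nat.succ_pos r) hrs⟩
    have hlt : j - (r + 1) < j := by omega
    have ha' := ha _ hlt
    calc _ ≤ _ := h.abs_iterate_commOp_le hs hr2 ha' (H _ hlt) v x
      _ = (commConst E M * iterGradConst E M) *
          (s ^ 2 * ((a (j - (r + 1)) + 1) * (1 / √((r + 1 : ℕ) * s ^ 2)))) * ‖v‖ * c := by ring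
      _ ≤ _ := by gcongr
  rw [h.iterate_dualOp_eq hs hs1 hg, Finset.sum_range_succ']
  have t4 := (Finset.abs_sum_le_sum_abs (fun r ↦
    (stepOp s S)^[j - (r + 1)] (commOp s S D v ((stepOp s S)^[r + 1] g)) x)
      (Finset.range j)).trans (Finset.sum_le_sum t3)
  rw [← Finset.sum_mul, ← Finset.sum_mul, ← Finset.mul_sum] at t4
  refine (abs_sub _ _).trans ((add_le_add t1 ((abs_add_le _ _).trans
    (add_le_add t4 (le_of_eq_of_le ?_ t2)))).trans_eq ?_)
  · simp
  · ring

/-- On a short time interval the Volterra inequality closes by induction. -/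
lemma IsCoeff.dualBound_short (h : IsCoeff M S D R) (hs : 0 < s) (hs1 : s ≤ 1) (j : ℕ)
    (hj : j = 0 ∨ (j + 1 : ℕ) * s ^ 2 ≤ 1 / (8 * bootConst E M) ^ 2) :
    DualBound s S R j (8 * bootConst E M / √((j + 1 : ℕ) * s ^ 2)) := by
  have hC1 : 1 ≤ bootConst E M := one_le_bootConst h.pos
  set C := bootConst E M with hC
  induction j using Nat.strong_induction_on with
  | _ j ih =>
  have hj1 : ((j + 1 : ℕ) : ℝ) * s ^ 2 ≤ 1 := by
    rcases hj with rfl | hj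
    · have := pow_le_one₀ (n := 2) hs.le hs1
      push_cast
      linarith
    · exact hj.trans ((div_le_one (by positivity)).2 (one_le_pow₀ (by linarith)))
  have hsq : ∀ k : ℕ, √((k : ℝ) * s ^ 2) = √(k : ℝ) * s := fun k ↦ by
    rw [Real.sqrt_mul (by positivity), Real.sqrt_sq hs.le]
  have H := h.dualBound_of_forall_lt hs hs1 hj1
    (a := fun i ↦ 8 * C / √((i + 1 : ℕ) * s ^ 2))
    (fun i _ ↦ by positivity) (fun i hi ↦ ih i hi (Or.inr (by
      rcases hj with rfl | hj
      · exact absurd hi (by omega)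
      · refine le_trans ?_ hj
        gcongr)))
  refine H.mono ?_
  set θ := √((j + 1 : ℕ) * s ^ 2) with hθ
  have hθ0 : 0 < θ := Real.sqrt_pos.2 (by positivity)
  have hθ1 : θ ≤ 1 := Real.sqrt_le_one.2 hj1
  have hinv : 1 ≤ 1 / θ := (one_le_div hθ0).2 hθ1
  -- the sum splits into a discrete Beta integral and a discrete `∫ r^{-1/2}`
  have hsum : ∑ r ∈ Finset.range j, s ^ 2 * ((8 * C / √((j - (r + 1) + 1 : ℕ) * s ^ 2) + 1) *
      (1 / √((r + 1 : ℕ) * s ^ 2))) ≤ 32 * C * (if j = 0 then 0 else 1) + 2 * θ := by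
    have e : ∀ r ∈ Finset.range j, s ^ 2 * ((8 * C / √((j - (r + 1) + 1 : ℕ) * s ^ 2) + 1) *
        (1 / √((r + 1 : ℕ) * s ^ 2))) =
        8 * C * (1 / √((j - r : ℕ) : ℝ) * (1 / √((r : ℝ) + 1))) + s * (1 / √((r : ℝ) + 1)) := by
      intro r hr
      have hr := Finset.mem_range.1 hr
      have e1 : j - (r + 1) + 1 = j - r := by omega
      have p1 : 0 < √((j - r : ℕ) : ℝ) := Real.sqrt_pos.2 (by exact_mod_cast Nat.sub_pos_of_lt hr)
      have p2 : 0 < √((r : ℝ) + 1) := Real.sqrt_pos.2 (by positivity)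
      rw [e1, hsq, hsq]
      push_cast
      field_simp
    rw [Finset.sum_congr rfl e, Finset.sum_add_distrib, ← Finset.mul_sum, ← Finset.mul_sum]
    have b1 := sum_range_inv_sqrt_mul_inv_sqrt_le j
    have b2 := sum_range_inv_sqrt_le j
    have b3 : s * (2 * √(j : ℝ)) ≤ 2 * θ := by
      rw [hθ, hsq]
      have : √(j : ℝ) ≤ √((j + 1 : ℕ) : ℝ) := Real.sqrt_le_sqrt (by push_cast; linarith)
      nlinarith
    refine add_le_add ?_ ((mul_le_mul_of_nonneg_left b2 hs.le).trans b3)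
    split_ifs with hj0
    · simp [hj0]
    · nlinarith
  -- the smallness of the time interval absorbs the Beta integral
  have hbeta : 32 * C * (if j = 0 then 0 else 1) ≤ 4 * (1 / θ) := by
    rcases hj with rfl | hj
    · simp only [if_true, mul_zero]
      positivity
    · have h8 : θ ≤ 1 / (8 * C) := by
        rw [hθ]
        refine (Real.sqrt_le_sqrt hj).trans_eq ?_
        rw [Real.sqrt_div zero_le_one, Real.sqrt_one, Real.sqrt_sq (by positivity)]
      have h9 : 8 * C ≤ 1 / θ := by
        rw [le_div_iff₀ (by positivity)] at h8
        rw [le_div_iff₀ hθ0]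
        linarith
      split_ifs <;> linarith
  have h2θ : 2 * θ ≤ 2 * (1 / θ) := by linarith
  calc C * (1 / θ + 1 + _) ≤ C * (1 / θ + 1 / θ + (4 * (1 / θ) + 2 * (1 / θ))) := by
        gcongr
        exact hsum.trans (add_le_add hbeta h2θ)
    _ = 8 * C / θ := by ring

/-- The main analytic estimate: `|Q^j T_v g| ≤ C ((j+1) s²)^{-1/2} ‖v‖ sup |g|` up to time one. -/
theorem IsCoeff.dualBound (h : IsCoeff M S D R) (hs : 0 < s) (hs1 : s ≤ 1) (j : ℕ)
    (hj : (j + 1 : ℕ) * s ^ 2 ≤ 1) :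
    DualBound s S R j (128 * bootConst E M ^ 2 / √((j + 1 : ℕ) * s ^ 2)) := by
  have hC1 : 1 ≤ bootConst E M := one_le_bootConst h.pos
  set C := bootConst E M with hC
  set τ := 1 / (8 * C) ^ 2 with hτ
  have hτ0 : 0 < τ := by positivity
  have hθ0 : 0 < √(((j + 1 : ℕ) : ℝ) * s ^ 2) := Real.sqrt_pos.2 (by positivity)
  have hθ1 : √(((j + 1 : ℕ) : ℝ) * s ^ 2) ≤ 1 := Real.sqrt_le_one.2 hj
  by_cases hshort : ((j + 1 : ℕ) : ℝ) * s ^ 2 ≤ τ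
  · refine (h.dualBound_short hs hs1 j (Or.inr hshort)).mono ?_
    have : 8 * C ≤ 128 * C ^ 2 := by nlinarith
    exact div_le_div_of_nonneg_right this hθ0.le
  · -- otherwise use the bound at an intermediate time of order `τ`
    push Not at hshort
    obtain ⟨m, hmj, hm, hmτ⟩ : ∃ m ≤ j, (m = 0 ∨ ((m + 1 : ℕ) : ℝ) * s ^ 2 ≤ τ) ∧
        τ / 4 ≤ ((m + 1 : ℕ) : ℝ) * s ^ 2 := by
      have hs2 : 0 < s ^ 2 := by positivity
      by_cases h1 : τ / 2 ≤ s ^ 2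
      · exact ⟨0, Nat.zero_le _, Or.inl rfl, by push_cast; linarith⟩
      · push Not at h1
        have f1 := Nat.floor_le (by positivity : 0 ≤ τ / s ^ 2)
        have f2 := Nat.lt_floor_add_one (τ / s ^ 2)
        rw [le_div_iff₀ hs2] at f1
        rw [div_lt_iff₀ hs2] at f2
        have f3 : 0 < ⌊τ / s ^ 2⌋₊ := by
          rw [Nat.floor_pos, le_div_iff₀ hs2]
          linarith
        obtain ⟨m, hm⟩ := Nat.exists_eq_succ_of_ne_zero f3.ne'
        rw [hm] at f1 f2
        refine ⟨m, ?_, Or.inr f1, ?_⟩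
        · have : ((m + 1 : ℕ) : ℝ) * s ^ 2 < ((j + 1 : ℕ) : ℝ) * s ^ 2 := lt_of_le_of_lt f1 hshort
          have := lt_of_mul_lt_mul_right this hs2.le
          have : m + 1 < j + 1 := by exact_mod_cast this
          omega
        · have : ((Nat.succ m : ℕ) : ℝ) + 1 = ((m + 1 : ℕ) : ℝ) + 1 := by simp
          rw [this, add_mul, one_mul] at f2
          linarith
    have B := (h.dualBound_short hs hs1 m hm).add h hs (j - m)
    rw [Nat.sub_add_cancel hmj] at B
    refine B.mono ?_
    have hθm : 1 / (16 * C) ≤ √(((m + 1 : ℕ) : ℝ) * s ^ 2) := by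
      refine Real.le_sqrt_of_sq_le ?_
      refine le_trans (le_of_eq ?_) hmτ
      rw [hτ]
      field_simp
      norm_num
    calc 8 * C / √(((m + 1 : ℕ) : ℝ) * s ^ 2) ≤ 8 * C / (1 / (16 * C)) := by gcongr
      _ = 128 * C ^ 2 := by field_simp; norm_num
      _ ≤ 128 * C ^ 2 / √(((j + 1 : ℕ) : ℝ) * s ^ 2) :=
        le_div_self (by positivity) hθ0 hθ1

end Bootstrap

section Chain

open scoped RealInnerProductSpace Topology

variable {d : ℕ} {Ω : Type*} [MeasurableSpace Ω] {P : Measure Ω} [IsProbabilityMeasure P]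

/-! ### The normalised Brownian increments -/

/-- The normalised increments of a Brownian motion along the grid `i / n` agree almost surely with
a measurable family of independent standard normal variables. -/
lemma IsBrownianVec.exists_iIndepFun {B : ℝ≥0 → Ω → EuclideanSpace ℝ (Fin d)}
    (hB : IsBrownianVec B P) {n : ℕ} (hn : 1 ≤ n) :
    ∃ η : Fin d × ℕ → Ω → ℝ, (∀ q, Measurable (η q)) ∧ iIndepFun η P ∧
      (∀ q, P.map (η q) = gaussianReal 0 1) ∧
      ∀ q : Fin d × ℕ, ∀ᵐ ω ∂P, √(n : ℝ) *
        (B (((q.2 : ℕ) + 1 : ℝ≥0) / n) ω q.1 - B (((q.2 : ℕ) : ℝ≥0) / n) ω q.1) = η q ω := by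
  have hn0 : (0 : ℝ) < n := by exact_mod_cast hn
  let t : ℕ → ℝ≥0 := fun i ↦ (i : ℝ≥0) / n
  have ht : Monotone t := fun i j hij ↦ by
    simp only [t]
    gcongr
  have htt : ∀ i : ℕ, t (i + 1) = ((i : ℝ≥0) + 1) / n := fun i ↦ by simp [t]
  let ξ : Fin d × ℕ → Ω → ℝ := fun q ω ↦
    √(n : ℝ) * (B (t (q.2 + 1)) ω q.1 - B (t q.2) ω q.1)
  have hBm : ∀ p t, AEMeasurable (fun ω ↦ B t ω p) P := fun p t ↦
    (hB.isBrownianReal p).toIsPreBrownianReal.aemeasurable t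
  have hξm : ∀ q, AEMeasurable (ξ q) P := fun q ↦
    ((hBm q.1 _).sub (hBm q.1 _)).const_mul _
  have hlaw : ∀ q, P.map (ξ q) = gaussianReal 0 1 := fun q ↦ by
    have h1 := ((hB.isBrownianReal q.1).toIsPreBrownianReal.hasLaw_sub (t (q.2 + 1)) (t q.2))
    have h2 := gaussianReal_const_mul h1 (√(n : ℝ))
    rw [mul_zero] at h2
    refine h2.map_eq.trans ?_
    congr 1
    rw [← NNReal.coe_inj]
    have e : dist ((t (q.2 + 1) : ℝ)) ((t q.2 : ℝ)) = 1 / n := by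
      rw [Real.dist_eq, htt]
      simp only [t]
      push_cast
      rw [← sub_div, add_sub_cancel_left, abs_of_pos (by positivity)]
    simp only [NNReal.coe_one, NNReal.coe_mul, NNReal.coe_mk, coe_nndist]
    change √(n : ℝ) ^ 2 * dist ((t (q.2 + 1) : ℝ)) ((t q.2 : ℝ)) = 1
    rw [e, Real.sq_sqrt hn0.le]
    field_simp
  refine ⟨fun q ↦ (hξm q).mk (ξ q), fun q ↦ (hξm q).measurable_mk, ?_, fun q ↦ ?_, fun q ↦ ?_⟩
  · have ind1 : iIndepFun (fun (p : Fin d) ω (i : ℕ) ↦ ξ (p, i) ω) P :=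
      hB.indep.comp (fun _ path i ↦ √(n : ℝ) * (path (t (i + 1)) - path (t i)))
        (fun _ ↦ by fun_prop)
    have ind1' : iIndepFun (fun (p : Fin d) ω (i : ℕ) ↦ (hξm (p, i)).mk (ξ (p, i)) ω) P := by
      refine ind1.congr fun p ↦ ?_
      filter_upwards [ae_all_iff.2 fun i ↦ (hξm (p, i)).ae_eq_mk] with ω hω
      ext i
      exact hω i
    have ind2 : ∀ p, iIndepFun (fun i : ℕ ↦ (hξm (p, i)).mk (ξ (p, i))) P := fun p ↦ by
      refine iIndepFun.congr (fun i ↦ (hξm (p, i)).ae_eq_mk) ?_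
      exact ((hB.isBrownianReal p).toIsPreBrownianReal.hasIndepIncrements.nat ht).comp
        (fun _ x ↦ √(n : ℝ) * x) (fun _ ↦ by fun_prop)
    exact iIndepFun_uncurry' (X := fun p i ↦ (hξm (p, i)).mk (ξ (p, i)))
      (fun p i ↦ (hξm (p, i)).measurable_mk) ind1' ind2
  · rw [← hlaw q]
    exact Measure.map_congr (hξm q).ae_eq_mk.symm
  · filter_upwards [(hξm q).ae_eq_mk] with ω hω
    rw [← hω]
    simp only [ξ, htt]
    rfl

/-- The random vectors `(η (p, i))_p` assembled from a family of real random variables. -/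
noncomputable def noiseVec (η : Fin d × ℕ → Ω → ℝ) (i : ℕ) (ω : Ω) : EuclideanSpace ℝ (Fin d) :=
  WithLp.toLp 2 fun p ↦ η (p, i) ω

/-- The Markov chain `Y_{i+1} = Φ(Y_i, ζ_i)`, `Y_0 = y`, driven by the noise vectors `ζ_i`. -/
noncomputable def chain (Φ : EuclideanSpace ℝ (Fin d) → EuclideanSpace ℝ (Fin d) →
      EuclideanSpace ℝ (Fin d)) (y : EuclideanSpace ℝ (Fin d)) (η : Fin d × ℕ → Ω → ℝ) :
    ℕ → Ω → EuclideanSpace ℝ (Fin d)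
  | 0, _ => y
  | i + 1, ω => Φ (chain Φ y η i ω) (noiseVec η i ω)

variable {η : Fin d × ℕ → Ω → ℝ} {y : EuclideanSpace ℝ (Fin d)}
  {Φ : EuclideanSpace ℝ (Fin d) → EuclideanSpace ℝ (Fin d) → EuclideanSpace ℝ (Fin d)}

lemma measurable_noiseVec (hη : ∀ q, Measurable (η q)) (i : ℕ) : Measurable (noiseVec η i) := by
  unfold noiseVec
  exact (WithLp.measurable_toLp 2 _).comp (measurable_pi_lambda _ fun p ↦ hη (p, i))

lemma map_noiseVec (hη : ∀ q, Measurable (η q)) (hind : iIndepFun η P)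
    (hlaw : ∀ q, P.map (η q) = gaussianReal 0 1) (i : ℕ) :
    P.map (noiseVec η i) = stdGaussian (EuclideanSpace ℝ (Fin d)) := by
  have h1 : iIndepFun (fun p ↦ η (p, i)) P :=
    hind.precomp (g := fun p : Fin d ↦ (p, i)) fun p q h ↦ by simpa using h
  have h2 := h1.map_fun_eq_pi_map (fun p ↦ (hη (p, i)).aemeasurable)
  simp_rw [hlaw] at h2
  rw [← map_pi_eq_stdGaussian, ← h2, Measure.map_map (WithLp.measurable_toLp 2 _)
    (measurable_pi_lambda _ fun p ↦ hη (p, i))]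
  rfl

/-- `Y_i` is a measurable function of the noise variables of index less than `i`. -/
lemma exists_chain_eq (hΦ : Measurable fun p : EuclideanSpace ℝ (Fin d) ×
      EuclideanSpace ℝ (Fin d) ↦ Φ p.1 p.2) (i : ℕ) :
    ∃ g : (((Finset.univ ×ˢ Finset.range i : Finset (Fin d × ℕ))) → ℝ) →
        EuclideanSpace ℝ (Fin d), Measurable g ∧ ∀ ω, chain Φ y η i ω = g fun q ↦ η q ω := by
  induction i with
  | zero => exact ⟨fun _ ↦ y, measurable_const, fun _ ↦ rfl⟩
  | succ i ih =>
    obtain ⟨g, hg, hgη⟩ := ih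
    have hsub : ∀ q : (Finset.univ ×ˢ Finset.range i : Finset (Fin d × ℕ)),
        (q : Fin d × ℕ) ∈ (Finset.univ ×ˢ Finset.range (i + 1) : Finset (Fin d × ℕ)) := fun q ↦ by
      have := q.2
      simp only [Finset.mem_product, Finset.mem_univ, Finset.mem_range, true_and] at this ⊢
      omega
    have hmem : ∀ p : Fin d, (p, i) ∈
        (Finset.univ ×ˢ Finset.range (i + 1) : Finset (Fin d × ℕ)) := fun p ↦ by simp
    refine ⟨fun u ↦ Φ (g fun q ↦ u ⟨q, hsub q⟩) (WithLp.toLp 2 fun p ↦ u ⟨(p, i), hmem p⟩),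
      ?_, fun ω ↦ ?_⟩
    · refine hΦ.comp (Measurable.prodMk (hg.comp ?_) ((WithLp.measurable_toLp 2 _).comp ?_))
      · fun_prop
      · fun_prop
    · simp only [chain, hgη, noiseVec]

lemma measurable_chain (hη : ∀ q, Measurable (η q))
    (hΦ : Measurable fun p : EuclideanSpace ℝ (Fin d) × EuclideanSpace ℝ (Fin d) ↦ Φ p.1 p.2)
    (i : ℕ) : Measurable (chain Φ y η i) := by
  obtain ⟨g, hg, hgη⟩ := exists_chain_eq (η := η) (y := y) hΦ i
  have e : chain Φ y η i = fun ω ↦ g fun q ↦ η q ω := funext hgη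
  rw [e]
  exact hg.comp (measurable_pi_lambda _ fun q ↦ hη q)

lemma map_chain_succ (hη : ∀ q, Measurable (η q)) (hind : iIndepFun η P)
    (hlaw : ∀ q, P.map (η q) = gaussianReal 0 1)
    (hΦ : Measurable fun p : EuclideanSpace ℝ (Fin d) × EuclideanSpace ℝ (Fin d) ↦ Φ p.1 p.2)
    (i : ℕ) : P.map (chain Φ y η (i + 1)) =
      ((P.map (chain Φ y η i)).prod (stdGaussian (EuclideanSpace ℝ (Fin d)))).map
        (fun p ↦ Φ p.1 p.2) := by
  obtain ⟨g, hg, hgη⟩ := exists_chain_eq (η := η) (y := y) hΦ i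
  have hmem : ∀ p : Fin d, (p, i) ∈ (Finset.univ ×ˢ {i} : Finset (Fin d × ℕ)) := fun p ↦ by simp
  have hdisj : Disjoint (Finset.univ ×ˢ Finset.range i : Finset (Fin d × ℕ))
      (Finset.univ ×ˢ {i}) := by
    rw [Finset.disjoint_left]
    intro q hq hq'
    simp only [Finset.mem_product, Finset.mem_univ, true_and, Finset.mem_range,
      Finset.mem_singleton] at hq hq'
    omega
  have hI := hind.indepFun_finset _ _ hdisj hη
  have hI2 : IndepFun (chain Φ y η i) (noiseVec η i) P := by
    have := hI.comp (φ := g) (ψ := fun u ↦ WithLp.toLp 2 fun p ↦ u ⟨(p, i), hmem p⟩) hg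
      ((WithLp.measurable_toLp 2 _).comp (by fun_prop))
    have e : chain Φ y η i = g ∘ fun ω q ↦ η q ω := funext hgη
    rw [e]
    exact this
  have hYm := measurable_chain (y := y) hη hΦ i
  have hZm := measurable_noiseVec hη i
  have hprod := (indepFun_iff_map_prod_eq_prod_map_map hYm.aemeasurable hZm.aemeasurable).1 hI2
  rw [map_noiseVec hη hind hlaw] at hprod
  rw [← hprod, Measure.map_map hΦ (hYm.prodMk hZm)]
  rfl

variable {s M : ℝ}
  {S R : EuclideanSpace ℝ (Fin d) → EuclideanSpace ℝ (Fin d) →L[ℝ] EuclideanSpace ℝ (Fin d)}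
  {D : EuclideanSpace ℝ (Fin d) →
    EuclideanSpace ℝ (Fin d) →L[ℝ] EuclideanSpace ℝ (Fin d) →L[ℝ] EuclideanSpace ℝ (Fin d)}

/-- The Markov property of the chain. -/
lemma IsCoeff.integral_chain_succ (h : IsCoeff M S D R) (hη : ∀ q, Measurable (η q))
    (hind : iIndepFun η P) (hlaw : ∀ q, P.map (η q) = gaussianReal 0 1) (i : ℕ)
    {F : EuclideanSpace ℝ (Fin d) → ℝ} {c : ℝ} (hF : Measurable F) (hc : ∀ x, |F x| ≤ c) :
    ∫ ω, F (chain (eulerStep s S) y η (i + 1) ω) ∂P =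
      ∫ ω, stepOp s S F (chain (eulerStep s S) y η i ω) ∂P := by
  have hΦ := (h.continuous_eulerStep (s := s)).measurable
  have hYm := measurable_chain (y := y) hη hΦ i
  have : IsProbabilityMeasure (P.map (chain (eulerStep s S) y η i)) :=
    Measure.isProbabilityMeasure_map hYm.aemeasurable
  have hFΦ : Measurable fun p : EuclideanSpace ℝ (Fin d) × EuclideanSpace ℝ (Fin d) ↦
    F (eulerStep s S p.1 p.2) := hF.comp hΦ
  rw [← integral_map (measurable_chain hη hΦ (i + 1)).aemeasurable hF.aestronglyMeasurable,
    map_chain_succ hη hind hlaw hΦ, integral_map hΦ.aemeasurable hF.aestronglyMeasurable,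
    integral_prod, integral_map hYm.aemeasurable]
  · rfl
  · exact hFΦ.stronglyMeasurable.integral_prod_right'.aestronglyMeasurable
  · exact (integrable_const c).mono' hFΦ.aestronglyMeasurable (.of_forall fun p ↦ hc _)

lemma IsCoeff.integral_chain (h : IsCoeff M S D R) (hη : ∀ q, Measurable (η q))
    (hind : iIndepFun η P) (hlaw : ∀ q, P.map (η q) = gaussianReal 0 1) (i : ℕ)
    {F : EuclideanSpace ℝ (Fin d) → ℝ} {c : ℝ} (hF : Continuous F) (hc : ∀ x, |F x| ≤ c) :
    ∫ ω, F (chain (eulerStep s S) y η i ω) ∂P = (stepOp s S)^[i] F y := by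
  induction i generalizing F with
  | zero => simp [chain]
  | succ i ih =>
    rw [h.integral_chain_succ hη hind hlaw i hF.measurable hc,
      ih (h.continuous_stepOp hF hc) (abs_stepOp_le hc), Function.iterate_succ_apply]

/-- After one step the chain has no mass on the Lebesgue null set where a Lipschitz function fails
to be differentiable. -/
lemma IsCoeff.ae_differentiableAt_chain (h : IsCoeff M S D R) (hs : 0 < s)
    (hη : ∀ q, Measurable (η q)) (hind : iIndepFun η P)
    (hlaw : ∀ q, P.map (η q) = gaussianReal 0 1) (i : ℕ)
    {G : EuclideanSpace ℝ (Fin d) → ℝ} {C : ℝ≥0} (hG : LipschitzWith C G) :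
    ∀ᵐ ω ∂P, DifferentiableAt ℝ G (chain (eulerStep s S) y η (i + 1) ω) := by
  have hΦ := (h.continuous_eulerStep (s := s)).measurable
  have hYm := measurable_chain (y := y) hη hΦ i
  have hms := measurableSet_of_differentiableAt ℝ G
  have : IsProbabilityMeasure (P.map (chain (eulerStep s S) y η i)) :=
    Measure.isProbabilityMeasure_map hYm.aemeasurable
  rw [← ae_map_iff (measurable_chain hη hΦ (i + 1)).aemeasurable hms,
    map_chain_succ hη hind hlaw hΦ, ae_map_iff hΦ.aemeasurable hms]
  refine (Measure.ae_prod_iff_ae_ae (hΦ hms)).2 ?_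
  exact .of_forall fun x ↦ h.ae_differentiableAt_eulerStep hs hG x

/-- The bound on `𝔼 ∂_v G(Y_{i+1})`, which equals `Q^i T_v G (y)` by the Markov property and the
integration by parts in the last step. -/
theorem IsCoeff.abs_integral_fderiv_chain_le (h : IsCoeff M S D R) (hs : 0 < s) (hs1 : s ≤ 1)
    (hη : ∀ q, Measurable (η q)) (hind : iIndepFun η P)
    (hlaw : ∀ q, P.map (η q) = gaussianReal 0 1) {i : ℕ} (hi : (i + 1 : ℕ) * s ^ 2 ≤ 1)
    {G : EuclideanSpace ℝ (Fin d) → ℝ} {C : ℝ≥0} {c : ℝ} (hG : LipschitzWith C G)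
    (hc : ∀ x, |G x| ≤ c) (v : EuclideanSpace ℝ (Fin d)) :
    |∫ ω, fderiv ℝ G (chain (eulerStep s S) y η (i + 1) ω) v ∂P| ≤
      128 * bootConst (EuclideanSpace ℝ (Fin d)) M ^ 2 / √((i + 1 : ℕ) * s ^ 2) * ‖v‖ * c := by
  have hb : ∀ x, |fderiv ℝ G x v| ≤ C * ‖v‖ := fun x ↦
    (fderiv ℝ G x).le_of_opNorm_le (norm_fderiv_le_of_lipschitz ℝ hG) v
  rw [h.integral_chain_succ hη hind hlaw i (measurable_fderiv_apply_const ℝ G v) hb]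
  simp_rw [h.stepOp_fderiv_eq_dualOp hs hG]
  rw [h.integral_chain hη hind hlaw i (h.continuous_dualOp hG.continuous hc v)
    (h.abs_dualOp_le hs hc v)]
  exact h.dualBound hs hs1 i hi G c v y hG.continuous hc

end Chain

section Norms

open scoped RealInnerProductSpace Topology

variable {d : ℕ} {V : Type*} [NormedAddCommGroup V] [NormedSpace ℝ V]

/-! ### The norms of the statement -/

lemma enorm_le_c0Norm (f : EuclideanSpace ℝ (Fin d) → V) (x : EuclideanSpace ℝ (Fin d)) :
    ‖f x‖ₑ ≤ c0Norm f := le_iSup (fun x ↦ ‖f x‖ₑ) x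

lemma norm_le_toReal_c0Norm {f : EuclideanSpace ℝ (Fin d) → V} (hf : c0Norm f ≠ ⊤)
    (x : EuclideanSpace ℝ (Fin d)) : ‖f x‖ ≤ (c0Norm f).toReal := by
  have := ENNReal.toReal_mono hf (enorm_le_c0Norm f x)
  rwa [toReal_enorm] at this

lemma enorm_sub_le_lipSeminorm_mul (f : EuclideanSpace ℝ (Fin d) → V)
    (x y : EuclideanSpace ℝ (Fin d)) : ‖f x - f y‖ₑ ≤ lipSeminorm f * ‖x - y‖ₑ := by
  by_cases hxy : x = y
  · simp [hxy]
  · have h : ‖f x - f y‖ₑ / ‖x - y‖ₑ ≤ lipSeminorm f :=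
      le_iSup_of_le x (le_iSup_of_le y (le_iSup_of_le hxy le_rfl))
    exact (ENNReal.div_le_iff (by simpa [sub_eq_zero] using hxy) enorm_ne_top).1 h

lemma norm_sub_le_toReal_lipSeminorm_mul {f : EuclideanSpace ℝ (Fin d) → V}
    (hf : lipSeminorm f ≠ ⊤) (x y : EuclideanSpace ℝ (Fin d)) :
    ‖f x - f y‖ ≤ (lipSeminorm f).toReal * ‖x - y‖ := by
  have := ENNReal.toReal_mono (ENNReal.mul_ne_top hf enorm_ne_top)
    (enorm_sub_le_lipSeminorm_mul f x y)
  rwa [ENNReal.toReal_mul, toReal_enorm, toReal_enorm] at this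

lemma lipschitzWith_lipSeminorm {f : EuclideanSpace ℝ (Fin d) → V} (hf : lipSeminorm f ≠ ⊤) :
    LipschitzWith (lipSeminorm f).toNNReal f :=
  LipschitzWith.of_dist_le_mul fun x y ↦ by
    rw [dist_eq_norm, dist_eq_norm]
    exact norm_sub_le_toReal_lipSeminorm_mul hf x y

/-- A linear map on Euclidean space is bounded by the sum of the norms of its columns. -/
lemma opNorm_le_sum_single (A : EuclideanSpace ℝ (Fin d) →L[ℝ] V) :
    ‖A‖ ≤ ∑ i, ‖A (EuclideanSpace.single i 1)‖ := by
  refine A.opNorm_le_bound (by positivity) fun v ↦ ?_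
  have hv : v = ∑ i, v i • EuclideanSpace.single i (1 : ℝ) := by
    conv_lhs => rw [← (EuclideanSpace.basisFun (Fin d) ℝ).sum_repr v]
    simp
  have h1 : A v = ∑ i, v i • A (EuclideanSpace.single i 1) := by
    conv_lhs => rw [hv]
    simp
  rw [h1, Finset.sum_mul]
  refine (norm_sum_le _ _).trans (Finset.sum_le_sum fun i _ ↦ ?_)
  rw [norm_smul, mul_comm]
  gcongr
  exact PiLp.norm_apply_le v i

variable {σ : EuclideanSpace ℝ (Fin d) → V} {K : ℝ≥0}

lemma norm_le_of_c2Norm_le (h : c2Norm σ ≤ K) (x : EuclideanSpace ℝ (Fin d)) : ‖σ x‖ ≤ K := by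
  have h1 : ‖σ x‖ₑ ≤ K := (enorm_le_c0Norm σ x).trans
    ((le_self_add.trans le_self_add).trans h)
  rwa [← ofReal_norm, ENNReal.ofReal_le_coe, ] at h1

lemma norm_fderiv_le_of_c2Norm_le (h : c2Norm σ ≤ K) (x : EuclideanSpace ℝ (Fin d)) :
    ‖fderiv ℝ σ x‖ ≤ K := by
  refine (opNorm_le_sum_single _).trans ?_
  have h1 : ∑ i, ‖partialDeriv i σ x‖ₑ ≤ K :=
    (Finset.sum_le_sum fun i _ ↦ enorm_le_c0Norm _ x).trans
      ((le_add_self.trans le_self_add).trans h)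
  have h2 := ENNReal.toReal_mono ENNReal.coe_ne_top h1
  rw [ENNReal.toReal_sum (fun _ _ ↦ enorm_ne_top)] at h2
  simpa [partialDeriv] using h2

lemma norm_fderiv_sub_le_of_c2Norm_le (h : c2Norm σ ≤ K) (x y : EuclideanSpace ℝ (Fin d)) :
    ‖fderiv ℝ σ x - fderiv ℝ σ y‖ ≤ K * ‖x - y‖ := by
  refine (opNorm_le_sum_single _).trans ?_
  have h1 : ∑ i, ‖partialDeriv i σ x - partialDeriv i σ y‖ₑ ≤ K * ‖x - y‖ₑ := by
    refine (Finset.sum_le_sum fun i _ ↦ enorm_sub_le_lipSeminorm_mul _ x y).trans ?_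
    rw [← Finset.sum_mul]
    gcongr
    exact le_add_self.trans h
  have h2 := ENNReal.toReal_mono (ENNReal.mul_ne_top ENNReal.coe_ne_top enorm_ne_top) h1
  rw [ENNReal.toReal_sum (fun _ _ ↦ enorm_ne_top)] at h2
  simpa [partialDeriv] using h2

/-- The image of a `C²` function under a linear map on a finite-dimensional space inherits the
bounds, up to a constant. -/
lemma exists_forall_hasFDerivAt [FiniteDimensional ℝ V] {W : Type*} [NormedAddCommGroup W]
    [NormedSpace ℝ W] (Λ : V →ₗ[ℝ] W) :
    ∃ C : ℝ, 0 ≤ C ∧ ∀ {σ : EuclideanSpace ℝ (Fin d) → V} {K : ℝ≥0}, Differentiable ℝ σ →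
      c2Norm σ ≤ K → (∀ x, ‖Λ (σ x)‖ ≤ C * K) ∧
        ∃ D : EuclideanSpace ℝ (Fin d) → EuclideanSpace ℝ (Fin d) →L[ℝ] W,
          (∀ x, HasFDerivAt (fun x ↦ Λ (σ x)) (D x) x) ∧ (∀ x, ‖D x‖ ≤ C * K) ∧
          ∀ x y, ‖D x - D y‖ ≤ C * K * ‖x - y‖ := by
  set L := Λ.toContinuousLinearMap with hL
  refine ⟨‖L‖, norm_nonneg _, fun {σ K} hσ hK ↦ ⟨fun x ↦ ?_, fun x ↦ L.comp (fderiv ℝ σ x),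
    fun x ↦ L.hasFDerivAt.comp x (hσ x).hasFDerivAt, fun x ↦ ?_, fun x y ↦ ?_⟩⟩
  · exact (L.le_opNorm _).trans
      (mul_le_mul_of_nonneg_left (norm_le_of_c2Norm_le hK x) (norm_nonneg _))
  · exact (L.opNorm_comp_le _).trans
      (mul_le_mul_of_nonneg_left (norm_fderiv_le_of_c2Norm_le hK x) (norm_nonneg _))
  · rw [← ContinuousLinearMap.comp_sub, mul_assoc]
    exact (L.opNorm_comp_le _).trans
      (mul_le_mul_of_nonneg_left (norm_fderiv_sub_le_of_c2Norm_le hK x y) (norm_nonneg _))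

end Norms

section Matrices

open scoped RealInnerProductSpace

variable {d : ℕ}

/-! ### The coefficient as an operator field -/

/-- The linear map sending a matrix to the operator it defines on Euclidean space. Its continuity is
not bundled, so that it can be used with any norm on matrices. -/
noncomputable def matrixOp (d : ℕ) : Matrix (Fin d) (Fin d) ℝ →ₗ[ℝ]
    EuclideanSpace ℝ (Fin d) →L[ℝ] EuclideanSpace ℝ (Fin d) :=
  (Matrix.toEuclideanCLM (n := Fin d) (𝕜 := ℝ)).toAlgEquiv.toLinearMap

lemma matrixOp_apply (A : Matrix (Fin d) (Fin d) ℝ) (v : EuclideanSpace ℝ (Fin d)) :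
    matrixOp d A v = A.toEuclideanLin v := rfl

lemma matrixOp_mul (A B : Matrix (Fin d) (Fin d) ℝ) (v : EuclideanSpace ℝ (Fin d)) :
    matrixOp d (A * B) v = matrixOp d A (matrixOp d B v) := by
  change Matrix.toEuclideanCLM (n := Fin d) (𝕜 := ℝ) (A * B) v = _
  rw [map_mul]
  rfl

lemma matrixOp_one (v : EuclideanSpace ℝ (Fin d)) : matrixOp d 1 v = v := by
  change Matrix.toEuclideanCLM (n := Fin d) (𝕜 := ℝ) 1 v = _
  rw [map_one]
  rfl

lemma inner_matrixOp (A : Matrix (Fin d) (Fin d) ℝ) (v w : EuclideanSpace ℝ (Fin d)) :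
    ⟪v, matrixOp d A w⟫ = v.ofLp ⬝ᵥ A.mulVec w.ofLp := by
  change ⟪v, Matrix.toEuclideanCLM (n := Fin d) (𝕜 := ℝ) A w⟫ = _
  rw [EuclideanSpace.inner_eq_star_dotProduct, Matrix.ofLp_toEuclideanCLM, dotProduct_comm]
  simp

lemma inner_matrixOp_transpose (A : Matrix (Fin d) (Fin d) ℝ) (v w : EuclideanSpace ℝ (Fin d)) :
    ⟪matrixOp d A.transpose v, w⟫ = ⟪v, matrixOp d A w⟫ := by
  rw [real_inner_comm, inner_matrixOp, inner_matrixOp, Matrix.mulVec_transpose,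
    dotProduct_comm, Matrix.dotProduct_mulVec]

/-- If `A Aᵀ ⪰ lam I` with `lam > 0`, then `A` has an inverse of operator norm at most
`lam ^ (-1/2)`. -/
lemma exists_inverse_of_posSemidef {lam : ℝ} (hlam : 0 < lam) {A : Matrix (Fin d) (Fin d) ℝ}
    (hA : (A * A.transpose - lam • (1 : Matrix (Fin d) (Fin d) ℝ)).PosSemidef) :
    A * A⁻¹ = 1 ∧ A⁻¹ * A = 1 ∧ ‖matrixOp d A⁻¹‖ ≤ (√lam)⁻¹ := by
  have hlow : ∀ v, lam * ‖v‖ ^ 2 ≤ ‖matrixOp d A.transpose v‖ ^ 2 := fun v ↦ by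
    have h1 := hA.dotProduct_mulVec_nonneg v.ofLp
    have h2 : 0 ≤ ⟪v, matrixOp d (A * A.transpose - lam • (1 : Matrix (Fin d) (Fin d) ℝ)) v⟫ := by
      rw [inner_matrixOp]
      simpa using h1
    rw [map_sub, map_smul, sub_apply, inner_sub_right,
      smul_apply, inner_smul_right, matrixOp_one, matrixOp_mul,
      ← inner_matrixOp_transpose, real_inner_self_eq_norm_sq, real_inner_self_eq_norm_sq] at h2
    linarith
  have hsl : 0 < √lam := Real.sqrt_pos.2 hlam
  have hlow' : ∀ v, √lam * ‖v‖ ≤ ‖matrixOp d A.transpose v‖ := fun v ↦ by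
    refine le_of_sq_le_sq ?_ (norm_nonneg _)
    rw [mul_pow, Real.sq_sqrt hlam.le]
    exact hlow v
  have hunit : IsUnit A := by
    rw [← Matrix.isUnit_transpose, ← Matrix.mulVec_injective_iff_isUnit]
    intro v w hvw
    have h1 : matrixOp d A.transpose (WithLp.toLp 2 (v - w)) = 0 := by
      ext p
      have := congrFun hvw p
      simp [matrixOp_apply, this]
    have h2 := hlow' (WithLp.toLp 2 (v - w))
    rw [h1, norm_zero] at h2
    have h3 : ‖(WithLp.toLp 2 (v - w) : EuclideanSpace ℝ (Fin d))‖ ≤ 0 := by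
      by_contra hc
      exact absurd h2 (not_le.2 (mul_pos hsl (not_le.1 hc)))
    have h4 := norm_le_zero_iff.1 h3
    have h5 : v - w = 0 := by simpa using congrArg WithLp.ofLp h4
    exact sub_eq_zero.1 h5
  have hdet := (Matrix.isUnit_iff_isUnit_det A).1 hunit
  have hr := Matrix.mul_nonsing_inv A hdet
  refine ⟨hr, Matrix.nonsing_inv_mul A hdet, ?_⟩
  refine ContinuousLinearMap.opNorm_le_bound _ (by positivity) fun v ↦ ?_
  -- The bound for `A⁻¹` is obtained by duality from that for its transpose.
  set u := matrixOp d A⁻¹ v with hu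
  have ht : ∀ w, ‖matrixOp d A⁻¹.transpose w‖ ≤ (√lam)⁻¹ * ‖w‖ := fun w ↦ by
    have h1 := hlow' (matrixOp d A⁻¹.transpose w)
    rw [← matrixOp_mul, ← Matrix.transpose_mul, Matrix.nonsing_inv_mul A hdet,
      Matrix.transpose_one, matrixOp_one] at h1
    rwa [inv_mul_eq_div, le_div_iff₀ hsl, mul_comm]
  have h3 : ‖u‖ ^ 2 ≤ (√lam)⁻¹ * ‖v‖ * ‖u‖ := by
    rw [← real_inner_self_eq_norm_sq]
    conv_lhs => rw [hu, ← inner_matrixOp_transpose, ← hu]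
    refine (real_inner_le_norm _ _).trans ?_
    calc _ ≤ (√lam)⁻¹ * ‖u‖ * ‖v‖ := by gcongr; exact ht u
      _ = _ := by ring
  rcases (norm_nonneg u).eq_or_lt with h0 | h0
  · rw [← h0]; positivity
  · rw [sq] at h3
    exact le_of_mul_le_mul_right h3 h0

/-- A uniformly elliptic `C²` coefficient satisfies the standing assumptions, with a constant that
depends only on `d`, the `C²` bound and the ellipticity constant. -/
lemma exists_forall_isCoeff (d : ℕ) (K : ℝ≥0) {lam : ℝ} (hlam : 0 < lam) :
    ∃ M : ℝ, 0 < M ∧ ∀ σ : EuclideanSpace ℝ (Fin d) → Matrix (Fin d) (Fin d) ℝ,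
      Differentiable ℝ σ → c2Norm σ ≤ K → IsElliptic lam σ →
      ∃ D R, IsCoeff M (fun x ↦ matrixOp d (σ x)) D R := by
  obtain ⟨C, hC, hD⟩ := exists_forall_hasFDerivAt (matrixOp d)
  have h0 : 0 ≤ (√lam)⁻¹ := by positivity
  have h1 : 0 ≤ C * K := by positivity
  refine ⟨1 + C * K + (√lam)⁻¹, by positivity, fun σ hσ hK hell ↦ ?_⟩
  obtain ⟨hS, D, hder, hDle, hDlip⟩ := hD hσ hK
  refine ⟨D, fun x ↦ matrixOp d (σ x)⁻¹, ?_⟩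
  have hle : C * K ≤ 1 + C * K + (√lam)⁻¹ := by linarith
  exact
    { one_le := by linarith
      hasFDerivAt := hder
      norm_S_le := fun x ↦ (hS x).trans hle
      norm_D_le := fun x ↦ (hDle x).trans hle
      norm_R_le := fun x ↦
        (exists_inverse_of_posSemidef hlam (hell x)).2.2.trans (by linarith)
      D_lip := fun x y ↦ (hDlip x y).trans (by gcongr)
      S_R := fun x v ↦ by
        rw [← matrixOp_mul, (exists_inverse_of_posSemidef hlam (hell x)).1, matrixOp_one]
      R_S := fun x v ↦ by
        rw [← matrixOp_mul, (exists_inverse_of_posSemidef hlam (hell x)).2.1, matrixOp_one] }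

end Matrices

section Scheme

variable {d : ℕ} {Ω : Type*} [MeasurableSpace Ω] {P : Measure Ω}

/-! ### The scheme as a Markov chain -/

/-- On the grid, `∫₀^{j/n} H_{κ_n(r)} dB_r` is the sum over the first `j` cells. -/
lemma gridIntegral_natCast_div {n : ℕ} (hn : 1 ≤ n)
    (H : ℝ≥0 → Ω → Matrix (Fin d) (Fin d) ℝ) (B : ℝ≥0 → Ω → EuclideanSpace ℝ (Fin d))
    (j : ℕ) (ω : Ω) :
    gridIntegral n H B ((j : ℝ≥0) / n) ω = ∑ i ∈ Finset.range j,
      (H ((i : ℝ≥0) / n) ω).toEuclideanLin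
        (B (((i : ℝ≥0) + 1) / n) ω - B ((i : ℝ≥0) / n) ω) := by
  have hn0 : (n : ℝ≥0) ≠ 0 := by
    have : n ≠ 0 := by omega
    exact_mod_cast this
  rw [gridIntegral, mul_div_cancel₀ _ hn0, Nat.floor_natCast, Finset.sum_range_succ]
  have hlast : min ((j : ℝ≥0) / n) (((j : ℝ≥0) + 1) / n) = (j : ℝ≥0) / n :=
    min_eq_left (by gcongr; exact le_self_add)
  rw [hlast, sub_self, map_zero, add_zero]
  refine Finset.sum_congr rfl fun i hi ↦ ?_
  have hij : ((i : ℝ≥0) + 1) / n ≤ (j : ℝ≥0) / n := by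
    gcongr
    exact_mod_cast Finset.mem_range.1 hi
  rw [min_eq_right hij]

/-- On the grid, the Euler–Maruyama scheme is the chain with transition map `eulerStep` of step
size `1 / n`, driven by the normalised Brownian increments. -/
lemma IsEulerMaruyama.ae_eq_chain
    {σ : EuclideanSpace ℝ (Fin d) → Matrix (Fin d) (Fin d) ℝ}
    {B X : ℝ≥0 → Ω → EuclideanSpace ℝ (Fin d)} {y : EuclideanSpace ℝ (Fin d)} {n : ℕ}
    (hX : IsEulerMaruyama P n σ B y X) (hn : 1 ≤ n) {η : Fin d × ℕ → Ω → ℝ}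
    (hη : ∀ q : Fin d × ℕ, ∀ᵐ ω ∂P, √(n : ℝ) *
      (B (((q.2 : ℕ) + 1 : ℝ≥0) / n) ω q.1 - B (((q.2 : ℕ) : ℝ≥0) / n) ω q.1) = η q ω) :
    ∀ᵐ ω ∂P, ∀ j : ℕ, X ((j : ℝ≥0) / n) ω =
      chain (eulerStep (√(n : ℝ))⁻¹ fun x ↦ matrixOp d (σ x)) y η j ω := by
  have hs : 0 < √(n : ℝ) := Real.sqrt_pos.2 (by exact_mod_cast hn)
  filter_upwards [hX, ae_all_iff.2 hη] with ω hω hηω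
  have hinc : ∀ i : ℕ, B (((i : ℝ≥0) + 1) / n) ω - B ((i : ℝ≥0) / n) ω =
      (√(n : ℝ))⁻¹ • noiseVec η i ω := fun i ↦ by
    ext p
    have h1 := hηω (p, i)
    simp only [noiseVec, PiLp.sub_apply, PiLp.smul_apply, smul_eq_mul, ← h1]
    field_simp
  intro j
  induction j with
  | zero =>
    rw [hω, gridIntegral_natCast_div hn]
    simp [chain]
  | succ j ih =>
    have h1 := hω ((j : ℝ≥0) / n)
    have h2 := hω (((j + 1 : ℕ) : ℝ≥0) / n)
    rw [gridIntegral_natCast_div hn] at h1 h2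
    rw [Finset.sum_range_succ, ← add_assoc, ← h1, hinc, map_smul, ih] at h2
    exact h2

end Scheme

end EulerMaruyama

theorem mainTheorem7 (d : ℕ) (K : ℝ≥0) :
    ∃ c : ℝ, 0 < c ∧ ∀ lam : ℝ, 0 < lam → ∃ N : ℝ, 0 < N ∧
      ∀ (σ : EuclideanSpace ℝ (Fin d) → Matrix (Fin d) (Fin d) ℝ),
        Differentiable ℝ σ → EulerMaruyama.c2Norm σ ≤ (K : ℝ≥0∞) →
        EulerMaruyama.IsElliptic lam σ →
      ∀ {Ω : Type*} [MeasurableSpace Ω] (P : Measure Ω) [IsProbabilityMeasure P]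
        (B : ℝ≥0 → Ω → EuclideanSpace ℝ (Fin d)), EulerMaruyama.IsBrownianVec B P →
      ∀ (n : ℕ), 1 ≤ n →
      ∀ (y : EuclideanSpace ℝ (Fin d)) (X : ℝ≥0 → Ω → EuclideanSpace ℝ (Fin d)),
        EulerMaruyama.IsEulerMaruyama P n σ B y X →
      ∀ (G : EuclideanSpace ℝ (Fin d) → ℝ), EulerMaruyama.c1Norm G < ⊤ →
      ∀ (j : ℕ), 1 ≤ j → j ≤ n → ∀ (k : Fin d),
        (∀ᵐ ω ∂P, DifferentiableAt ℝ G (X ((j : ℝ≥0) / n) ω)) ∧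
        Integrable (fun ω ↦ EulerMaruyama.partialDeriv k G (X ((j : ℝ≥0) / n) ω)) P ∧
        |∫ ω, EulerMaruyama.partialDeriv k G (X ((j : ℝ≥0) / n) ω) ∂P| ≤
          N * (EulerMaruyama.c0Norm G).toReal * ((j : ℝ) / n) ^ (-(1 / 2) : ℝ) +
          N * (EulerMaruyama.c1Norm G).toReal * Real.exp (-c * n) := by
  open EulerMaruyama in
  refine ⟨1, one_pos, fun lam hlam ↦ ?_⟩
  obtain ⟨M, hM0, hcoeff⟩ := exists_forall_isCoeff d K hlam
  have hb := one_le_bootConst (E := EuclideanSpace ℝ (Fin d)) hM0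
  refine ⟨128 * bootConst (EuclideanSpace ℝ (Fin d)) M ^ 2, by positivity, ?_⟩
  intro σ hσ hK hell Ω _ P _ B hB n hn y X hX G hG j hj hjn k
  obtain ⟨D, R, h⟩ := hcoeff σ hσ hK hell
  obtain ⟨η, hηm, hind, hlaw, hη⟩ := hB.exists_iIndepFun hn
  have hXc := hX.ae_eq_chain hn hη
  have hn0 : (0 : ℝ) < n := by exact_mod_cast hn
  have hs : 0 < (√(n : ℝ))⁻¹ := inv_pos.2 (Real.sqrt_pos.2 hn0)
  have hs1 : (√(n : ℝ))⁻¹ ≤ 1 :=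
    inv_le_one_of_one_le₀ (Real.one_le_sqrt.2 (by exact_mod_cast hn))
  obtain ⟨i, rfl⟩ : ∃ i, j = i + 1 := ⟨j - 1, by omega⟩
  have htime : ((i + 1 : ℕ) : ℝ) * (√(n : ℝ))⁻¹ ^ 2 = ((i + 1 : ℕ) : ℝ) / n := by
    rw [inv_pow, Real.sq_sqrt hn0.le]
    rfl
  have htime1 : ((i + 1 : ℕ) : ℝ) * (√(n : ℝ))⁻¹ ^ 2 ≤ 1 := by
    rw [htime, div_le_one hn0]
    exact_mod_cast hjn
  obtain ⟨hG0, hG1⟩ : c0Norm G ≠ ⊤ ∧ lipSeminorm G ≠ ⊤ := by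
    simpa [c1Norm] using hG.ne
  have hGlip := lipschitzWith_lipSeminorm hG1
  have hGc : ∀ x, |G x| ≤ (c0Norm G).toReal := norm_le_toReal_c0Norm hG0
  have hdiff := h.ae_differentiableAt_chain (y := y) hs hηm hind hlaw i hGlip
  have hbound := h.abs_integral_fderiv_chain_le (y := y) hs hs1 hηm hind hlaw htime1 hGlip hGc
    (EuclideanSpace.single k 1)
  have hae : (fun ω ↦ partialDeriv k G (X (((i + 1 : ℕ) : ℝ≥0) / n) ω)) =ᵐ[P] fun ω ↦
      fderiv ℝ G (chain (eulerStep (√(n : ℝ))⁻¹ fun x ↦ matrixOp d (σ x)) y η (i + 1) ω)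
        (EuclideanSpace.single k 1) := by
    filter_upwards [hXc] with ω hω
    rw [hω]
    rfl
  refine ⟨?_, ?_, ?_⟩
  · filter_upwards [hXc, hdiff] with ω hω hd
    rwa [hω]
  · refine Integrable.congr ?_ hae.symm
    have hmeas := (measurable_fderiv_apply_const ℝ G (EuclideanSpace.single k (1 : ℝ))).comp
      (measurable_chain (y := y) hηm
        (h.continuous_eulerStep (s := (√(n : ℝ))⁻¹)).measurable (i + 1))
    exact (integrable_const _).mono' hmeas.aestronglyMeasurable (.of_forall fun ω ↦
      (fderiv ℝ G _).le_of_opNorm_le (norm_fderiv_le_of_lipschitz ℝ hGlip) _)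
  · rw [integral_congr_ae hae]
    refine hbound.trans ?_
    rw [htime, PiLp.norm_single, norm_one, mul_one]
    have hpow : (((i + 1 : ℕ) : ℝ) / n) ^ (-(1 / 2) : ℝ) = (√(((i + 1 : ℕ) : ℝ) / n))⁻¹ := by
      rw [Real.rpow_neg (by positivity), Real.sqrt_eq_rpow]
    rw [hpow]
    have hexp : 0 ≤ 128 * bootConst (EuclideanSpace ℝ (Fin d)) M ^ 2 * (c1Norm G).toReal *
        Real.exp (-1 * n) := by positivity
    have e : 128 * bootConst (EuclideanSpace ℝ (Fin d)) M ^ 2 / √(((i + 1 : ℕ) : ℝ) / n) *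
        (c0Norm G).toReal = 128 * bootConst (EuclideanSpace ℝ (Fin d)) M ^ 2 *
        (c0Norm G).toReal * (√(((i + 1 : ℕ) : ℝ) / n))⁻¹ := by
      rw [div_eq_mul_inv]
      ring
    rw [e]
    -- The first term alone dominates; the exponential one is nonnegative.
    exact le_add_of_nonneg_right hexp
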